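/- **Theorem 2.1 (Rearrangement Lemma).** Let $A$ be a unital $C^*$-algebra, $h=h^*\in A$, $k=e^h$, and let $U\subseteq\mathbb R$ be an open set containing the spectrum of $h$. For an integer $n\ge 0$ let $A^{\otimes_\gamma n+1}$ be the projective tensor product (a Banach algebra), and for $a\in A$, $0\le l\le n$, let $a^{(l)}=1\otimes\cdots\otimes a\otimes\cdots\otimes 1$ with $a$ in slot $l$. Let $\iota: A^{\otimes_\gamma n+1}\to L_{\rm cont}(A^{\otimes_\gamma n},A)$ be the contraction, the continuous extension of $\iota(a_0\otimes\cdots\otimes a_n)(\rho_1\otimes\cdots\otimes\rho_n)=a_0\rho_1a_1\cdots\rho_na_n$. There is exactly one continuous linear map $\Psi_\gamma: C^\infty(U^{n+1})\to A^{\otimes_\gamma n+1}$ (the smooth functional calculus of $h$) with $\Psi_\gamma(f_0\otimes\cdots\otimes f_n)=f_0(h)\otimes\cdots\otimes f_n(h)$ for all $f_0,\dots,f_n\in C^\infty(U)$, where $C^\infty$ carries the Fréchet topology of uniform convergence of all derivatives on compact sets; we write $f(h^{(0)},\dots,h^{(n)})=\Psi_\gamma(f)$. Let $\alpha=(\alpha_0,\dots,\alpha_n)$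 be positive integers and $d>0$. Put $\triangle^n=\{u\in\mathbb R^n: u_l\ge 0,\ \sum_l u_l\le 1\}$, $$\omega_\alpha(u)=\frac{1}{\Gamma(\alpha_0)\cdots\Gamma(\alpha_n)}\Big(1-\sum_{l=1}^n u_l\Big)^{\alpha_0-1}\prod_{l=1}^n u_l^{\alpha_l-1},\qquad \tilde H_\alpha(\bar z;d)=\Gamma(d+1)\int_{\triangle^n}\omega_\alpha(u)(1-\bar z\cdot u)^{-(d+1)}\,du$$ (the last integral converges for $\bar z\in(-\infty,1)^n$). Let $\mathbf y^{(j)}=(k^{(j-1)})^{-1}k^{(j)}$ and $\mathbf z^{(l)}=1-\mathbf y^{(1)}\cdots\mathbf y^{(l)}$ for $1\le j,l\le n$, regarded as functions of $h^{(0)},\dots,h^{(n)}$, and let $\tilde H_\alpha(\bar{\mathbf z};d)$ and $(1-\bar{\mathbf z}\cdot u)^{-(d+1)}$, $u\in\triangle^n$, denote the elements of $A^{\otimes_\gamma n+1}$ obtained by applying $\Psi_\gamma$ to the corresponding smooth functions of $(x_0,\dots,x_n)$. Then the elements $k^{(l)}r-ix$ ($r>0$, $x\in\mathbb R$) of $A^{\otimes_\gamma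 n+1}$ are invertible, and $$\frac1{2\pi}\int_0^\infty\int_{-\infty}^\infty e^{-ix}\prod_{l=0}^n\big(k^{(l)}r-ix\big)^{-\alpha_l}\,r^d\,dx\,dr=(k^{(0)})^{-(d+1)}\,\tilde H_\alpha(\bar{\mathbf z};d)\quad\text{in }A^{\otimes_\gamma n+1},$$ where $$\tilde H_\alpha(\bar{\mathbf z};d)=\Gamma(d+1)\int_{\triangle^n}\omega_\alpha(u)\,(1-\bar{\mathbf z}\cdot u)^{-(d+1)}\,du .$$ The outer integral over $r$ of the inner integral and the integral over $\triangle^n$ are Bochner integrals. The inner integral converges for every $r>0$ as an improper integral $\lim_{a\to-\infty,\,b\to\infty}\int_a^b$, and is a Bochner integral whenever $\alpha_0+\cdots+\alpha_n\ge 2$ (that is, except when $n=0$ and $\alpha_0=1$). Consequently, as operators $A^{\otimes_\gamma n}\to A$, the image under $\iota$ of the left-hand side is $\iota\big(\tilde H_\alpha(\bar{\mathbf z};d)\big)$ followed by left multiplication by $k^{-(d+1)}$. -/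

import Mathlib

open MeasureTheory Filter Topology Set
open scoped ContDiff TensorProduct

namespace Rearrangement

noncomputable section

/-! ### The projective tensor product as a Banach algebra -/

section ProjectiveTensor

variable {𝕜 : Type*} [NontriviallyNormedField 𝕜] {A : Type*} [NormedRing A] [NormedAlgebra 𝕜 A]

theorem norm_tprod_mul_le {n : ℕ} (a : Fin n → A) (y : ⨂[𝕜] _ : Fin n, A) :
    ‖PiTensorProduct.tprod 𝕜 a * y‖ ≤ (∏ i, ‖a i‖) * ‖y‖ := by
  have h : PiTensorProduct.tprod 𝕜 a * y
      = PiTensorProduct.mapL (fun i => ContinuousLinearMap.mul 𝕜 A (a i)) y := by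
    rw [PiTensorProduct.mapL_apply]
    induction y using PiTensorProduct.induction_on with
    | smul_tprod s b =>
      have := PiTensorProduct.smul_tprod_mul_smul_tprod (1 : 𝕜) s a b
      rw [one_smul, one_mul] at this
      rw [this, map_smul, PiTensorProduct.map_tprod]
      rfl
    | add y z hy hz => rw [mul_add, hy, hz, map_add]
  rw [h]
  refine (ContinuousLinearMap.le_opNorm _ _).trans ?_
  refine mul_le_mul_of_nonneg_right ((PiTensorProduct.opNorm_mapL _).trans ?_) (norm_nonneg _)
  exact Finset.prod_le_prod (fun _ _ => norm_nonneg _)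
    (fun i _ => ContinuousLinearMap.opNorm_mul_apply_le 𝕜 A (a i))

theorem projectiveNorm_mul_le {n : ℕ} (x y : ⨂[𝕜] _ : Fin n, A) : ‖x * y‖ ≤ ‖x‖ * ‖y‖ := by
  have key : ∀ L : List (𝕜 × (Fin n → A)),
      ‖(L.map fun q => q.1 • PiTensorProduct.tprod 𝕜 q.2).sum * y‖
        ≤ (L.map fun q => ‖q.1‖ * ∏ i, ‖q.2 i‖).sum * ‖y‖ := by
    intro L
    induction L with
    | nil => simp
    | cons q L ih =>
      rw [List.map_cons, List.map_cons, List.sum_cons, List.sum_cons, add_mul, add_mul]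
      refine (norm_add_le _ _).trans (add_le_add ?_ ih)
      rw [smul_mul_assoc, mul_assoc]
      exact (PiTensorProduct.projectiveSeminorm_smul_le _ _).trans
        (mul_le_mul_of_nonneg_left (norm_tprod_mul_le _ _) (norm_nonneg _))
  rw [PiTensorProduct.norm_def x, Real.iInf_mul_of_nonneg (norm_nonneg _)]
  refine le_ciInf fun ⟨p, hp⟩ => ?_
  have h := key p.toList
  rwa [(PiTensorProduct.mem_lifts_iff x p).mp hp] at h

/-- The algebraic tensor product of `n` copies of `A` with the projective norm. -/
def AlgTensor (𝕜 : Type*) [NontriviallyNormedField 𝕜] (A : Type*) [NormedRing A]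
    [NormedAlgebra 𝕜 A] (n : ℕ) : Type _ := ⨂[𝕜] _ : Fin n, A

instance instSeminormedRingAlgTensor (n : ℕ) : SeminormedRing (AlgTensor 𝕜 A n) where
  __ := (inferInstance : SeminormedAddCommGroup (⨂[𝕜] _ : Fin n, A))
  __ := (inferInstance : Ring (⨂[𝕜] _ : Fin n, A))
  norm_mul_le := projectiveNorm_mul_le

instance instNormedAlgebraAlgTensor (n : ℕ) : NormedAlgebra 𝕜 (AlgTensor 𝕜 A n) where
  __ := (inferInstance : Algebra 𝕜 (⨂[𝕜] _ : Fin n, A))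
  norm_smul_le := PiTensorProduct.projectiveSeminorm_smul_le

/-- The projective tensor product of `n` copies of `A`: the completion of the algebraic
tensor product for the projective norm. -/
def ProjTensor (𝕜 : Type*) [NontriviallyNormedField 𝕜] (A : Type*) [NormedRing A]
    [NormedAlgebra 𝕜 A] (n : ℕ) : Type _ := UniformSpace.Completion (AlgTensor 𝕜 A n)

instance instNormedRingProjTensor (n : ℕ) : NormedRing (ProjTensor 𝕜 A n) :=
  inferInstanceAs (NormedRing (UniformSpace.Completion (AlgTensor 𝕜 A n)))

instance instNormedAlgebraProjTensor (n : ℕ) : NormedAlgebra 𝕜 (ProjTensor 𝕜 A n) where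
  __ := (inferInstance : Algebra 𝕜 (UniformSpace.Completion (AlgTensor 𝕜 A n)))
  norm_smul_le := (inferInstance :
    NormedSpace 𝕜 (UniformSpace.Completion (AlgTensor 𝕜 A n))).norm_smul_le

instance instCompleteSpaceProjTensor (n : ℕ) : CompleteSpace (ProjTensor 𝕜 A n) :=
  inferInstanceAs (CompleteSpace (UniformSpace.Completion (AlgTensor 𝕜 A n)))

/-- The canonical isometric map from the algebraic to the projective tensor product. -/
def toProj (𝕜 : Type*) [NontriviallyNormedField 𝕜] (A : Type*) [NormedRing A]
    [NormedAlgebra 𝕜 A] (n : ℕ) : AlgTensor 𝕜 A n →L[𝕜] ProjTensor 𝕜 A n :=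
  UniformSpace.Completion.toComplL (𝕜 := 𝕜) (E := AlgTensor 𝕜 A n)

theorem denseRange_toProj (n : ℕ) : DenseRange (toProj 𝕜 A n) :=
  UniformSpace.Completion.denseRange_coe

theorem isUniformInducing_toProj (n : ℕ) : IsUniformInducing (toProj 𝕜 A n) :=
  UniformSpace.Completion.isUniformInducing_coe _

theorem norm_toProj {n : ℕ} (x : AlgTensor 𝕜 A n) : ‖toProj 𝕜 A n x‖ = ‖x‖ :=
  UniformSpace.Completion.norm_coe x

theorem toProj_mul {n : ℕ} (x y : AlgTensor 𝕜 A n) :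
    toProj 𝕜 A n (x * y) = toProj 𝕜 A n x * toProj 𝕜 A n y :=
  UniformSpace.Completion.coe_mul x y

/-- The elementary tensor `a₁ ⊗ ⋯ ⊗ aₙ` in the projective tensor product. -/
def elemTensor (𝕜 : Type*) [NontriviallyNormedField 𝕜] {A : Type*} [NormedRing A]
    [NormedAlgebra 𝕜 A] {n : ℕ} (a : Fin n → A) : ProjTensor 𝕜 A n :=
  toProj 𝕜 A n (PiTensorProduct.tprod 𝕜 a : ⨂[𝕜] _ : Fin n, A)

theorem elemTensor_mul {n : ℕ} (a b : Fin n → A) :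
    elemTensor 𝕜 a * elemTensor 𝕜 b = elemTensor 𝕜 (a * b) := by
  refine (toProj_mul _ _).symm.trans ?_
  exact congrArg (toProj 𝕜 A n) (PiTensorProduct.tprod_mul_tprod a b)

theorem elemTensor_one {n : ℕ} : elemTensor 𝕜 (1 : Fin n → A) = 1 :=
  UniformSpace.Completion.coe_one _

/-- `a⁽ˡ⁾ = 1 ⊗ ⋯ ⊗ a ⊗ ⋯ ⊗ 1`, with `a` in the slot `l`. -/
def slot (𝕜 : Type*) [NontriviallyNormedField 𝕜] {A : Type*} [NormedRing A]
    [NormedAlgebra 𝕜 A] {n : ℕ} (l : Fin n) (a : A) : ProjTensor 𝕜 A n :=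
  elemTensor 𝕜 (Function.update (fun _ => 1) l a)

/-! ### The contraction map -/

/-- Extension of a bounded operator from the algebraic to the completed projective tensor
product, as a bounded linear map of the operator. -/
def extendProj (𝕜 : Type*) [NontriviallyNormedField 𝕜] (A : Type*) [NormedRing A]
    [NormedAlgebra 𝕜 A] (n : ℕ) (F : Type*) [NormedAddCommGroup F]
    [NormedSpace 𝕜 F] [CompleteSpace F] :
    (AlgTensor 𝕜 A n →L[𝕜] F) →L[𝕜] (ProjTensor 𝕜 A n →L[𝕜] F) :=
  LinearMap.mkContinuous
    { toFun := fun f : AlgTensor 𝕜 A n →L[𝕜] F => f.extend (toProj 𝕜 A n)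
      map_add' := fun f g => by
        refine ContinuousLinearMap.extend_unique _ (denseRange_toProj n)
          (isUniformInducing_toProj n) _ ?_
        ext x
        simp [ContinuousLinearMap.extend_eq _ (denseRange_toProj n) (isUniformInducing_toProj n)]
      map_smul' := fun c f => by
        refine ContinuousLinearMap.extend_unique _ (denseRange_toProj n)
          (isUniformInducing_toProj n) _ ?_
        ext x
        simp [ContinuousLinearMap.extend_eq _ (denseRange_toProj n) (isUniformInducing_toProj n)] }
    1 fun f => by
      rw [one_mul]
      refine ContinuousLinearMap.opNorm_le_bound _ (norm_nonneg _) fun x => ?_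
      refine (denseRange_toProj n).induction_on x
        (isClosed_le (by fun_prop) (by fun_prop)) fun x => ?_
      have hf := f.extend_eq (denseRange_toProj n) (isUniformInducing_toProj n) x
      rw [norm_toProj]
      exact (congrArg norm hf).trans_le (f.le_opNorm x)

theorem extendProj_toProj {n : ℕ} {F : Type*} [NormedAddCommGroup F]
    [NormedSpace 𝕜 F] [CompleteSpace F] (f : AlgTensor 𝕜 A n →L[𝕜] F)
    (x : AlgTensor 𝕜 A n) : extendProj 𝕜 A n F f (toProj 𝕜 A n x) = f x :=
  f.extend_eq (denseRange_toProj n) (isUniformInducing_toProj n) x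

/-- The bounded operator on the projective tensor product given by a bounded multilinear map. -/
def liftProj (𝕜 : Type*) [NontriviallyNormedField 𝕜] (A : Type*) [NormedRing A]
    [NormedAlgebra 𝕜 A] (n : ℕ) (F : Type*) [NormedAddCommGroup F]
    [NormedSpace 𝕜 F] [CompleteSpace F] :
    ContinuousMultilinearMap 𝕜 (fun _ : Fin n => A) F →L[𝕜] (ProjTensor 𝕜 A n →L[𝕜] F) :=
  (extendProj 𝕜 A n F).comp
    (PiTensorProduct.liftIsometry 𝕜 (fun _ : Fin n => A) F
      ).toContinuousLinearEquiv.toContinuousLinearMap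

theorem liftProj_elemTensor {n : ℕ} {F : Type*} [NormedAddCommGroup F]
    [NormedSpace 𝕜 F] [CompleteSpace F] (f : ContinuousMultilinearMap 𝕜 (fun _ : Fin n => A) F)
    (a : Fin n → A) : liftProj 𝕜 A n F f (elemTensor 𝕜 a) = f a := by
  refine (extendProj_toProj _ _).trans ?_
  change PiTensorProduct.liftIsometry 𝕜 (fun _ : Fin n => A) F f _ = _
  rw [PiTensorProduct.liftIsometry_apply_apply, PiTensorProduct.lift.tprod]
  rfl

/-- The operator `ρ₁ ⊗ ⋯ ⊗ ρₙ ↦ ρ₁ a₁ ρ₂ a₂ ⋯ ρₙ aₙ`, depending multilinearly on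
`a₁, …, aₙ`. -/
def contractTail (𝕜 : Type*) [NontriviallyNormedField 𝕜] (A : Type*) [NormedRing A]
    [NormedAlgebra 𝕜 A] [CompleteSpace A] (n : ℕ) :
    ContinuousMultilinearMap 𝕜 (fun _ : Fin n => A) (ProjTensor 𝕜 A n →L[𝕜] A) :=
  ((liftProj 𝕜 A n A).comp
    (ContinuousLinearMap.apply 𝕜 _ (ContinuousMultilinearMap.mkPiAlgebraFin 𝕜 n A))
  ).compContinuousMultilinearMap
    ((ContinuousMultilinearMap.compContinuousLinearMapContinuousMultilinear 𝕜
      (fun _ : Fin n => A) (fun _ : Fin n => A) A).compContinuousLinearMap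
        (fun _ => (ContinuousLinearMap.mul 𝕜 A).flip))

/-- The multilinear map `(a₀, …, aₙ) ↦ B a₀ (T (a₁, …, aₙ))`. -/
def consMultilinear {E F G : Type*} [NormedAddCommGroup E] [NormedSpace 𝕜 E]
    [NormedAddCommGroup F] [NormedSpace 𝕜 F] [NormedAddCommGroup G] [NormedSpace 𝕜 G] {n : ℕ}
    (B : E →L[𝕜] F →L[𝕜] G) (T : ContinuousMultilinearMap 𝕜 (fun _ : Fin n => E) F) :
    ContinuousMultilinearMap 𝕜 (fun _ : Fin (n + 1) => E) G :=
  ContinuousLinearMap.uncurryLeft (n := n) (Ei := fun _ => E)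
    (((ContinuousLinearMap.compContinuousMultilinearMapL 𝕜 (fun _ : Fin n => E) F G).flip T).comp B)

/-- The operator `ρ₁ ⊗ ⋯ ⊗ ρₙ ↦ a₀ ρ₁ a₁ ρ₂ ⋯ ρₙ aₙ`, depending multilinearly on
`a₀, …, aₙ`. -/
def contractMultilinear (𝕜 : Type*) [NontriviallyNormedField 𝕜] (A : Type*) [NormedRing A]
    [NormedAlgebra 𝕜 A] [CompleteSpace A] (n : ℕ) :
    ContinuousMultilinearMap 𝕜 (fun _ : Fin (n + 1) => A) (ProjTensor 𝕜 A n →L[𝕜] A) :=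
  consMultilinear
    ((ContinuousLinearMap.compL 𝕜 (ProjTensor 𝕜 A n) A A).comp (ContinuousLinearMap.mul 𝕜 A))
    (contractTail 𝕜 A n)

/-- The contraction `ι` from the `(n+1)`-fold projective tensor product to the bounded operators
from the `n`-fold projective tensor product to `A`. -/
def contraction (𝕜 : Type*) [NontriviallyNormedField 𝕜] (A : Type*) [NormedRing A]
    [NormedAlgebra 𝕜 A] [CompleteSpace A] (n : ℕ) :
    ProjTensor 𝕜 A (n + 1) →L[𝕜] (ProjTensor 𝕜 A n →L[𝕜] A) :=
  liftProj 𝕜 A (n + 1) _ (contractMultilinear 𝕜 A n)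

/-- `ι(a₀ ⊗ ⋯ ⊗ aₙ)(ρ₁ ⊗ ⋯ ⊗ ρₙ) = a₀ ρ₁ a₁ ⋯ ρₙ aₙ`. -/
theorem contraction_elemTensor [CompleteSpace A] {n : ℕ} (a : Fin (n + 1) → A) (ρ : Fin n → A) :
    contraction 𝕜 A n (elemTensor 𝕜 a) (elemTensor 𝕜 ρ)
      = a 0 * (List.ofFn fun j : Fin n => ρ j * a j.succ).prod := by
  rw [contraction, liftProj_elemTensor]
  change a 0 * (contractTail 𝕜 A n (Fin.tail a)) (elemTensor 𝕜 ρ) = _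
  congr 1
  exact liftProj_elemTensor _ _

end ProjectiveTensor

/-! ### Smooth functional calculus -/

/-- The cube `Uᵐ ⊆ ℝᵐ`. -/
def cube (m : ℕ) (U : Set ℝ) : Set (Fin m → ℝ) := Set.univ.pi fun _ => U

/-- Complex functions on `ℝᵐ` that are smooth on `Uᵐ`. Their values outside `Uᵐ` are irrelevant. -/
def SmoothOn (m : ℕ) (U : Set ℝ) : Submodule ℂ ((Fin m → ℝ) → ℂ) where
  carrier := {f | ContDiffOn ℝ ∞ f (cube m U)}
  add_mem' hf hg := ContDiffOn.add hf hg
  zero_mem' := contDiffOn_const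
  smul_mem' c _ hf := ContDiffOn.const_smul c hf

/-- `Ψ` is the smooth functional calculus `Ψ_γ : C^∞(U^m) → A ⊗_γ ⋯ ⊗_γ A` of `h`: the continuous
linear map with `Ψ(f₁ ⊗ ⋯ ⊗ fₘ) = f₁(h) ⊗ ⋯ ⊗ fₘ(h)`. Continuity is for the Fréchet topology of
uniform convergence of all derivatives on compact subsets of `U^m`; for a linear map it is the
existence of an estimate by finitely many of the defining seminorms. -/
structure IsSmoothCalculus {A : Type*} [CStarAlgebra A] (h : A) (U : Set ℝ) {m : ℕ}
    (Ψ : SmoothOn m U →ₗ[ℂ] ProjTensor ℂ A m) : Prop where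
  continuous : ∃ (K : Set (Fin m → ℝ)) (N : ℕ) (C : ℝ), IsCompact K ∧ K ⊆ cube m U ∧
    ∀ (F : SmoothOn m U) (B : ℝ), 0 ≤ B →
      (∀ j ≤ N, ∀ x ∈ K, ‖iteratedFDerivWithin ℝ j F.1 (cube m U) x‖ ≤ B) → ‖Ψ F‖ ≤ C * B
  map_elemTensor : ∀ f : Fin m → ℝ → ℂ, (∀ i, ContDiffOn ℝ ∞ (f i) U) →
    ∀ F : SmoothOn m U, (∀ x ∈ cube m U, F.1 x = ∏ i, f i (x i)) →
      Ψ F = elemTensor ℂ fun i => cfc (fun t : ℂ => f i t.re) h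

/-! ### The hypergeometric integral -/

/-- The simplex `{u ∈ ℝⁿ : u_l ≥ 0, ∑ u_l ≤ 1}`. -/
def simplex (n : ℕ) : Set (Fin n → ℝ) := {u | (∀ l, 0 ≤ u l) ∧ ∑ l, u l ≤ 1}

/-- `ω_α(u) = (∏ Γ(α_l))⁻¹ (1 - ∑ u_l)^(α₀ - 1) ∏ u_l^(α_l - 1)`. -/
def omega {n : ℕ} (α : Fin (n + 1) → ℕ) (u : Fin n → ℝ) : ℝ :=
  (∏ l, Real.Gamma (α l))⁻¹ * (1 - ∑ l, u l) ^ (α 0 - 1) * ∏ l : Fin n, u l ^ (α l.succ - 1)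

/-- `H̃_α(z; d) = Γ(d+1) ∫_Δ ω_α(u) (1 - z·u)^(-(d+1)) du`. -/
def Htilde {n : ℕ} (α : Fin (n + 1) → ℕ) (d : ℝ) (z : Fin n → ℝ) : ℝ :=
  Real.Gamma (d + 1) * ∫ u in simplex n, omega α u * (1 - z ⬝ᵥ u) ^ (-(d + 1))

/-- `y⁽ʲ⁾ = (k⁽ʲ⁻¹⁾)⁻¹ k⁽ʲ⁾` as a function of `(h⁽⁰⁾, …, h⁽ⁿ⁾)`, where `k = e^h`; the
index `j` runs over `1, …, n` in this formula and over `0, …, n - 1` in the code. -/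
def yVar {n : ℕ} (x : Fin (n + 1) → ℝ) (j : Fin n) : ℝ :=
  (Real.exp (x j.castSucc))⁻¹ * Real.exp (x j.succ)

/-- `z⁽ˡ⁾ = 1 - y⁽¹⁾ ⋯ y⁽ˡ⁾` as a function of `(h⁽⁰⁾, …, h⁽ⁿ⁾)`. -/
def zVar {n : ℕ} (x : Fin (n + 1) → ℝ) (l : Fin n) : ℝ :=
  1 - ∏ j ∈ Finset.Iic l, yVar x j

/-! ### The operator-valued integrals -/

/-- The integrand `e^{-ix} ∏_l (k⁽ˡ⁾ r - ix)^{-α_l} r^d`, with `k = e^h`. -/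
def integrand {A : Type*} [CStarAlgebra A] (h : A) {n : ℕ} (α : Fin (n + 1) → ℕ) (d : ℝ)
    (r x : ℝ) : ProjTensor ℂ A (n + 1) :=
  (Complex.exp (-(Complex.I * x)) * ((r ^ d : ℝ) : ℂ)) •
    (List.ofFn fun l : Fin (n + 1) =>
      Ring.inverse ((r : ℂ) • slot ℂ l (NormedSpace.exp h) - (Complex.I * x) • 1) ^ α l).prod

/-- The integral of `f` over `ℝ` converges, possibly only conditionally (as an improper integral
with both limits going to infinity independently), with value `v`. -/
def HasImproperIntegral {E : Type*} [NormedAddCommGroup E] [NormedSpace ℝ E] (f : ℝ → E) (v : E) :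
    Prop :=
  LocallyIntegrable f ∧
    Tendsto (fun p : ℝ × ℝ => ∫ x in p.1..p.2, f x) (atBot ×ˢ atTop) (𝓝 v)

end

end Rearrangement

open scoped FourierTransform

namespace Rearrangement

noncomputable section

/-! ### Slots, elementary tensors and the contraction -/

section Tensor

variable {𝕜 : Type*} [NontriviallyNormedField 𝕜] {A : Type*} [NormedRing A] [NormedAlgebra 𝕜 A]

/-! The inner integral is a Fourier inversion. For fixed `r > 0`, the power `(rk - ix)^{-m}` is the
Fourier transform, at `ξ = -x/2π`, of `t ↦ Γ(m)⁻¹ t^{m-1} e^{-rtk}` on the half line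
(`fourier_gammaFun`). The tensor product of these powers is therefore the Fourier transform of a
multilinear convolution (`fourier_multiConv`). Integrating it against `e^{-ix}` recovers, up to
`2π`, the convolution at the point `1`. With `w = (1 - ∑ u_l, u₁, …, uₙ)`, that value is the
integral over the simplex of `ω_α(u) e^{-r w₀ k} ⊗ ⋯ ⊗ e^{-r wₙ k}` (`integral_resolvent_tensor`).
Inversion needs an integrable transform, hence total exponent at least `2`. In the remaining case, a
single resolvent, integration by parts reduces exponent `1` to exponent `2`
(`hasImproperIntegral_integrand`).

The outer integral is computed on scalar functions. The tensor above, weighted by `r^d ω_α(u)`, is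
the smooth calculus applied to `r^d ω_α(u) e^{-rc}` with `c = ∑ w_l e^{x_l}`. Here `c = e^{x₀} (1 -
z·u)` (`one_sub_zVar_dotProduct`), so integrating over `r` first gives `Γ(d+1) e^{-(d+1)x₀} ω_α(u)
(1 - z·u)^{-(d+1)}`. Integrating over `u` then yields `H̃_α` times a function of `x₀` alone, which
the calculus turns into a factor in slot `0` (`IsSmoothCalculus.slot_mul`).

Moving the calculus through these integrals rests on `IsSmoothContinuous.integral_comm`: a
Fréchet-continuous map is controlled by finitely many derivatives on a compact set, that is, by a
jet in a Banach space, and jets of a dominated family can be integrated there.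

The calculus itself comes from Fourier analysis. After a cutoff, a smooth function is a
superposition of exponentials `e^{2πi ξ·x}`, which are elementary tensors. This defines the
calculus, because the tensors `⊗ e^{2πi ξ_l h}` have norm at most `1`. It also proves uniqueness,
because continuous maps commute with the superposition (`IsSmoothContinuous.ext_expFun`). -/

/-- Elementary tensors as a continuous multilinear map. -/
def elemTensorL (𝕜 : Type*) [NontriviallyNormedField 𝕜] (A : Type*) [NormedRing A]
    [NormedAlgebra 𝕜 A] (n : ℕ) :
    ContinuousMultilinearMap 𝕜 (fun _ : Fin n => A) (ProjTensor 𝕜 A n) :=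
  (toProj 𝕜 A n).compContinuousMultilinearMap
    (PiTensorProduct.tprodL 𝕜 : ContinuousMultilinearMap 𝕜 (fun _ : Fin n => A) _)

theorem elemTensorL_apply {n : ℕ} (a : Fin n → A) : elemTensorL 𝕜 A n a = elemTensor 𝕜 a := rfl

theorem norm_elemTensor_le {n : ℕ} (a : Fin n → A) : ‖elemTensor 𝕜 a‖ ≤ ∏ i, ‖a i‖ :=
  (norm_toProj _).trans_le (PiTensorProduct.projectiveSeminorm_tprod_le a)

theorem continuous_elemTensor {n : ℕ} :
    Continuous fun a : Fin n → A => elemTensor 𝕜 a := (elemTensorL 𝕜 A n).cont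

theorem slot_eq {n : ℕ} (l : Fin n) (a : A) :
    slot 𝕜 l a = elemTensor 𝕜 (Function.update (1 : Fin n → A) l a) := rfl

/-- The embedding of `A` as the slot `l`, as an algebra homomorphism. -/
def slotHom (𝕜 : Type*) [NontriviallyNormedField 𝕜] (A : Type*) [NormedRing A]
    [NormedAlgebra 𝕜 A] {n : ℕ} (l : Fin n) : A →ₐ[𝕜] ProjTensor 𝕜 A n :=
  AlgHom.ofLinearMap ((elemTensorL 𝕜 A n).toMultilinearMap.toLinearMap 1 l)
    (by
      change elemTensor 𝕜 (Function.update (1 : Fin n → A) l 1) = 1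
      rw [← elemTensor_one]
      congr 1
      exact Function.update_eq_self l (1 : Fin n → A))
    (fun a b => by
      change elemTensor 𝕜 (Function.update (1 : Fin n → A) l (a * b))
        = elemTensor 𝕜 (Function.update 1 l a) * elemTensor 𝕜 (Function.update 1 l b)
      rw [elemTensor_mul, ← Pi.mulSingle, ← Pi.mulSingle, ← Pi.mulSingle, Pi.mulSingle_mul])

theorem slotHom_apply {n : ℕ} (l : Fin n) (a : A) : slotHom 𝕜 A l a = slot 𝕜 l a := rfl

theorem slot_mul_elemTensor {n : ℕ} (a : A) (b : Fin (n + 1) → A) :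
    slot 𝕜 0 a * elemTensor 𝕜 b = elemTensor 𝕜 (Fin.cons (a * b 0) (Fin.tail b)) := by
  rw [slot_eq, elemTensor_mul]
  congr 1
  ext i
  refine Fin.cases ?_ (fun j => ?_) i
  · simp
  · simp [Fin.tail]

theorem prod_ofFn_slot {n : ℕ} (a : Fin n → A) :
    (List.ofFn fun l => slot 𝕜 l (a l)).prod = elemTensor 𝕜 a := by
  -- Generalized to partial products so that induction applies; without repetitions, each new slot
  -- meets a `1`.
  have key : ∀ L : List (Fin n), L.Nodup → (L.map fun l => slot 𝕜 l (a l)).prod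
      = elemTensor 𝕜 fun i => if i ∈ L then a i else 1 := by
    intro L
    induction L with
    | nil => intro _; simp [← elemTensor_one]; rfl
    | cons l L ih =>
      intro hL
      rw [List.nodup_cons] at hL
      rw [List.map_cons, List.prod_cons, ih hL.2, slot_eq, elemTensor_mul]
      congr 1
      ext i
      by_cases h : i = l
      · subst h; simp [hL.1]
      · simp [h]
  rw [List.ofFn_eq_map, key _ (List.nodup_finRange n)]
  simp

theorem projTensor_hom_ext {m : ℕ} {F : Type*} [NormedAddCommGroup F] [NormedSpace 𝕜 F]
    {T₁ T₂ : ProjTensor 𝕜 A m →L[𝕜] F}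
    (h : ∀ b : Fin m → A, T₁ (elemTensor 𝕜 b) = T₂ (elemTensor 𝕜 b)) : T₁ = T₂ := by
  ext y
  refine (denseRange_toProj m).induction_on y
    (isClosed_eq T₁.continuous T₂.continuous) fun x => ?_
  refine PiTensorProduct.induction_on (motive := fun x : ⨂[𝕜] _ : Fin m, A =>
    T₁ (toProj 𝕜 A m x) = T₂ (toProj 𝕜 A m x)) x ?_ ?_
  · intro c b
    have e : toProj 𝕜 A m (c • PiTensorProduct.tprod 𝕜 b : ⨂[𝕜] _ : Fin m, A)
      = c • elemTensor 𝕜 b := (toProj 𝕜 A m).map_smul c _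
    rw [e, map_smul, map_smul, h]
  · intro x y hx hy
    have e : toProj 𝕜 A m (x + y : ⨂[𝕜] _ : Fin m, A) = toProj 𝕜 A m x + toProj 𝕜 A m y :=
      (toProj 𝕜 A m).map_add x y
    rw [e, map_add, map_add, hx, hy]

/-- Both sides are bounded and linear in `y`, and their values are determined on elementary tensors,
where `a` simply multiplies the leftmost factor. This transfers the identity from the tensor product
to operators. -/
theorem contraction_slot_mul [CompleteSpace A] {n : ℕ} (a : A) (y : ProjTensor 𝕜 A (n + 1)) :
    contraction 𝕜 A n (slot 𝕜 0 a * y)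
      = (ContinuousLinearMap.mul 𝕜 A a).comp (contraction 𝕜 A n y) := by
  let L₁ : ProjTensor 𝕜 A (n + 1) →L[𝕜] (ProjTensor 𝕜 A n →L[𝕜] A) :=
    (contraction 𝕜 A n).comp (ContinuousLinearMap.mul 𝕜 _ (slot 𝕜 0 a))
  let L₂ : ProjTensor 𝕜 A (n + 1) →L[𝕜] (ProjTensor 𝕜 A n →L[𝕜] A) :=
    (ContinuousLinearMap.compL 𝕜 (ProjTensor 𝕜 A n) A A (ContinuousLinearMap.mul 𝕜 A a)).comp
      (contraction 𝕜 A n)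
  have : L₁ = L₂ := by
    refine projTensor_hom_ext fun b => ?_
    change contraction 𝕜 A n (slot 𝕜 0 a * elemTensor 𝕜 b)
      = (ContinuousLinearMap.mul 𝕜 A a).comp (contraction 𝕜 A n (elemTensor 𝕜 b))
    refine projTensor_hom_ext fun ρ => ?_
    change contraction 𝕜 A n (slot 𝕜 0 a * elemTensor 𝕜 b) (elemTensor 𝕜 ρ)
      = a * (contraction 𝕜 A n (elemTensor 𝕜 b) (elemTensor 𝕜 ρ))
    rw [slot_mul_elemTensor, contraction_elemTensor, contraction_elemTensor, Fin.cons_zero,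
      mul_assoc]
    rfl
  exact DFunLike.congr_fun this y

end Tensor

/-! ### Integrals of multilinear expressions -/

section Fubini

/-- A tuple is the finite sum of its coordinate embeddings, so no separability of `E` is needed. -/
theorem aestronglyMeasurable_pi {E : Type*} [NormedAddCommGroup E] {Ω : Type*}
    [MeasurableSpace Ω] {μ : Measure Ω} {n : ℕ}
    {g : Ω → Fin n → E} (hg : ∀ i, AEStronglyMeasurable (fun w => g w i) μ) :
    AEStronglyMeasurable g μ := by
  have : g = fun w => ∑ i, Pi.single i (g w i) := by
    ext w i
    simp
  rw [this]
  exact Finset.aestronglyMeasurable_fun_sum _ fun i _ =>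
    (continuous_single (A := fun _ : Fin n => E) i).comp_aestronglyMeasurable (hg i)

variable {A : Type*} [NormedAddCommGroup A] [NormedSpace ℂ A]
  {B : Type*} [NormedAddCommGroup B] [NormedSpace ℂ B]

theorem integrable_multilinear {n : ℕ}
    (M : ContinuousMultilinearMap ℂ (fun _ : Fin n => A) B) {φ : Fin n → ℝ → A}
    (hφ : ∀ i, Integrable (φ i)) :
    Integrable fun ξ : Fin n → ℝ => M fun i => φ i (ξ i) := by
  have hb : Integrable fun ξ : Fin n → ℝ => ‖M‖ * ∏ i, ‖φ i (ξ i)‖ :=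
    (Integrable.fintype_prod (f := fun i t => ‖φ i t‖) fun i => (hφ i).norm).const_mul _
  refine hb.mono' ?_ (.of_forall fun ξ => M.le_opNorm _)
  refine M.cont.comp_aestronglyMeasurable (aestronglyMeasurable_pi fun i => ?_)
  exact (hφ i).1.comp_quasiMeasurePreserving (Measure.quasiMeasurePreserving_eval _ i)

/-- Fubini by induction: with the first variable frozen, currying leaves a multilinear map in one
variable fewer, and its integral depends linearly and continuously on the frozen entry. -/
theorem integral_multilinear [CompleteSpace A] [CompleteSpace B] {n : ℕ}
    (M : ContinuousMultilinearMap ℂ (fun _ : Fin n => A) B) {φ : Fin n → ℝ → A}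
    (hφ : ∀ i, Integrable (φ i)) :
    ∫ ξ : Fin n → ℝ, M (fun i => φ i (ξ i)) = M fun i => ∫ t, φ i t := by
  induction n generalizing B with
  | zero =>
    rw [Measure.volume_pi_eq_dirac (fun i => i.elim0), integral_dirac]
    exact congrArg M (funext fun i => i.elim0)
  | succ n ih =>
    have e := (volume_preserving_piFinSuccAbove (fun _ : Fin (n + 1) => ℝ) 0).symm
    have hi := integrable_multilinear M hφ
    rw [← e.integral_comp']
    rw [← e.integrable_comp_emb (MeasurableEquiv.measurableEmbedding _)] at hi
    rw [Measure.volume_eq_prod, integral_prod _ (by exact hi)]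
    have h1 : ∀ t : ℝ, ∫ y : Fin n → ℝ, M (fun i => φ i
        ((MeasurableEquiv.piFinSuccAbove (fun _ : Fin (n + 1) => ℝ) 0).symm (t, y) i))
        = ContinuousMultilinearMap.apply ℂ (fun _ : Fin n => A) B (fun i => ∫ t, φ i.succ t)
            (M.curryLeft (φ 0 t)) := by
      intro t
      change _ = M.curryLeft (φ 0 t) (fun i : Fin n => ∫ t, φ i.succ t)
      rw [← ih (M.curryLeft (φ 0 t)) fun i => hφ i.succ]
      refine integral_congr_ae (.of_forall fun y => ?_)
      change _ = M (Fin.cons (φ 0 t) fun i : Fin n => φ i.succ (y i))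
      refine congrArg M (funext fun i => ?_)
      refine Fin.cases ?_ (fun j => ?_) i <;> simp [Fin.insertNthEquiv]
    simp_rw [h1]
    rw [ContinuousLinearMap.integral_comp_comm _ (M.curryLeft.integrable_comp (hφ 0)),
      ContinuousLinearMap.integral_comp_comm _ (hφ 0)]
    refine congrArg M (funext fun i => ?_)
    refine Fin.cases ?_ (fun j => ?_) i <;> simp

end Fubini

/-! ### Smooth families and their integrals -/

/-- The quotient map by a closed submodule is bounded and annihilates the integrand, hence also the
integral. -/
theorem submodule_integral_mem {Ω : Type*} [MeasurableSpace Ω] {μ : Measure Ω} {X : Type*}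
    [NormedAddCommGroup X] [NormedSpace ℝ X] [CompleteSpace X] {Z : Submodule ℝ X}
    (hZ : IsClosed (Z : Set X)) {f : Ω → X} (hf : Integrable f μ) (hm : ∀ w, f w ∈ Z) :
    ∫ w, f w ∂μ ∈ Z := by
  have : IsClosed (Z : Set X) := hZ
  have h := Z.mkQL.integral_comp_comm hf
  have h0 : ∀ w, Z.mkQL (f w) = 0 := fun w => (Submodule.Quotient.mk_eq_zero Z).2 (hm w)
  simp only [h0, integral_zero] at h
  exact (Submodule.Quotient.mk_eq_zero Z).1 h.symm

theorem linearIsometryEquiv_integral {Ω : Type*} [MeasurableSpace Ω] {μ : Measure Ω} {X Y : Type*}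
    [NormedAddCommGroup X] [NormedSpace ℝ X] [NormedAddCommGroup Y] [NormedSpace ℝ Y]
    (e : X ≃ₗᵢ[ℝ] Y) (f : Ω → X) : ∫ w, e (f w) ∂μ = e (∫ w, f w ∂μ) :=
  e.toContinuousLinearEquiv.integral_comp_comm f

section CurryLeft

variable {E : Type*} [NormedAddCommGroup E] [NormedSpace ℝ E] {m : ℕ} {Ω : Type*}
  [MeasurableSpace Ω] {μ : Measure Ω} {g : Ω → E[×(m + 1)]→L[ℝ] ℂ}

theorem integral_curryLeft : ∫ w, (g w).curryLeft ∂μ = (∫ w, g w ∂μ).curryLeft :=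
  linearIsometryEquiv_integral (X := E[×(m + 1)]→L[ℝ] ℂ) (Y := E →L[ℝ] E[×m]→L[ℝ] ℂ)
    (continuousMultilinearCurryLeftEquiv ℝ (fun _ : Fin (m + 1) => E) ℂ) g

theorem aestronglyMeasurable_curryLeft (hg : AEStronglyMeasurable g μ) :
    AEStronglyMeasurable (fun w => (g w).curryLeft) μ :=
  (LinearIsometryEquiv.continuous (E := E[×(m + 1)]→L[ℝ] ℂ) (E₂ := E →L[ℝ] E[×m]→L[ℝ] ℂ)
    (continuousMultilinearCurryLeftEquiv ℝ (fun _ : Fin (m + 1) => E) ℂ)).comp_aestronglyMeasurable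
      hg

end CurryLeft

theorem continuous_iteratedFDerivWithin_param {Ω : Type*} [TopologicalSpace Ω]
    {E : Type*} [NormedAddCommGroup E] [NormedSpace ℝ E] {W : Set E} {f : Ω → E → ℂ} {j : ℕ}
    (h : ContinuousOn
    (fun p : Ω × E => iteratedFDerivWithin ℝ j (f p.1) W p.2) (univ ×ˢ W)) {x : E} (hx : x ∈ W) :
    Continuous fun w => iteratedFDerivWithin ℝ j (f w) W x :=
  continuousOn_univ.1 (h.comp (f := fun w => (w, x)) (by fun_prop) fun _ _ => ⟨mem_univ _, hx⟩)

section Family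

variable {Ω : Type*} [TopologicalSpace Ω] [MeasurableSpace Ω] [OpensMeasurableSpace Ω]
  [SecondCountableTopology Ω] {μ : Measure Ω}
  {E : Type*} [NormedAddCommGroup E] [NormedSpace ℝ E]

/-- A family of functions that are smooth on `W`, with derivatives that are jointly continuous
and, locally uniformly on `W`, dominated by an integrable function of the parameter. -/
structure IsDominatedFamily (μ : Measure Ω) (W : Set E) (f : Ω → E → ℂ) : Prop where
  smooth : ∀ w, ContDiffOn ℝ ∞ (f w) W
  continuousOn : ∀ j : ℕ, ContinuousOn
    (fun p : Ω × E => iteratedFDerivWithin ℝ j (f p.1) W p.2) (univ ×ˢ W)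
  dominated : ∀ (j : ℕ) (K : Set E), IsCompact K → K ⊆ W → ∃ b : Ω → ℝ, Integrable b μ ∧
    ∀ w, ∀ x ∈ K, ‖iteratedFDerivWithin ℝ j (f w) W x‖ ≤ b w

variable {W : Set E} {f : Ω → E → ℂ}

namespace IsDominatedFamily

theorem integrable_iteratedFDerivWithin (hf : IsDominatedFamily μ W f) (j : ℕ) {x : E}
    (hx : x ∈ W) : Integrable (fun w => iteratedFDerivWithin ℝ j (f w) W x) μ := by
  obtain ⟨b, hb, hle⟩ := hf.dominated j {x} isCompact_singleton (singleton_subset_iff.2 hx)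
  exact hb.mono' (continuous_iteratedFDerivWithin_param (hf.continuousOn j) hx).aestronglyMeasurable
    (.of_forall fun w => hle w x rfl)

/-- Differentiation under the integral at every order. A compact neighbourhood of the point supplies
the integrable bound for the derivative of the next order. -/
theorem hasFTaylorSeriesUpToOn [LocallyCompactSpace E] (hf : IsDominatedFamily μ W f)
    (hW : IsOpen W) :
    HasFTaylorSeriesUpToOn ∞ (fun x => ∫ w, f w x ∂μ)
      (fun x j => ∫ w, iteratedFDerivWithin ℝ j (f w) W x ∂μ) W := by
  have hd : ∀ (m : ℕ), ∀ x ∈ W, HasFDerivWithinAt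
      (fun x => ∫ w, iteratedFDerivWithin ℝ m (f w) W x ∂μ)
      (∫ w, iteratedFDerivWithin ℝ (m + 1) (f w) W x ∂μ).curryLeft W x := by
    intro m x hx
    obtain ⟨K, hK, hxK, hKW⟩ := exists_compact_subset hW hx
    obtain ⟨b, hb, hle⟩ := hf.dominated (m + 1) K hK hKW
    have hi := hf.integrable_iteratedFDerivWithin (m + 1) hx
    rw [← integral_curryLeft]
    refine (hasFDerivAt_integral_of_dominated_of_fderiv_le (s := interior K) (bound := b)
      (F' := fun x w => (iteratedFDerivWithin ℝ (m + 1) (f w) W x).curryLeft)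
      (isOpen_interior.mem_nhds hxK) ?_ (hf.integrable_iteratedFDerivWithin m hx)
      (aestronglyMeasurable_curryLeft hi.1) ?_ hb ?_).hasFDerivWithinAt
    · filter_upwards [hW.mem_nhds hx] with y hy
      exact (hf.integrable_iteratedFDerivWithin m hy).1
    · refine .of_forall fun w y hy => ?_
      rw [ContinuousMultilinearMap.curryLeft_norm]
      exact hle w y (interior_subset hy)
    · refine .of_forall fun w y hy => ?_
      have hyW : y ∈ W := hKW (interior_subset hy)
      exact (((hf.smooth w).ftaylorSeriesWithin hW.uniqueDiffOn).fderivWithin m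
        (WithTop.coe_lt_coe.2 (ENat.natCast_lt_top m)) y hyW).hasFDerivAt (hW.mem_nhds hyW)
  refine ⟨fun x hx => ?_, fun m _ => hd m, fun m _ x hx => (hd m x hx).continuousWithinAt⟩
  let L := ContinuousMultilinearMap.apply ℝ (fun _ : Fin 0 => E) ℂ 0
  exact (L.integral_comp_comm (hf.integrable_iteratedFDerivWithin 0 hx)).symm

theorem contDiffOn_integral [LocallyCompactSpace E] (hf : IsDominatedFamily μ W f)
    (hW : IsOpen W) : ContDiffOn ℝ ∞ (fun x => ∫ w, f w x ∂μ) W :=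
  (hf.hasFTaylorSeriesUpToOn hW).contDiffOn

theorem iteratedFDerivWithin_integral [LocallyCompactSpace E] (hf : IsDominatedFamily μ W f)
    (hW : IsOpen W) (j : ℕ) {x : E} (hx : x ∈ W) :
    iteratedFDerivWithin ℝ j (fun x => ∫ w, f w x ∂μ) W x
      = ∫ w, iteratedFDerivWithin ℝ j (f w) W x ∂μ :=
  ((hf.hasFTaylorSeriesUpToOn hW).eq_iteratedFDerivWithin_of_uniqueDiffOn
    (WithTop.coe_le_coe.2 le_top) hW.uniqueDiffOn hx).symm

end IsDominatedFamily

end Family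

/-! ### Continuous operators on smooth functions -/

section Operators

theorem isOpen_cube {U : Set ℝ} (hU : IsOpen U) (m : ℕ) : IsOpen (cube m U) :=
  isOpen_set_pi finite_univ fun _ _ => hU

variable {m : ℕ} {U : Set ℝ} {B : Type*} [NormedAddCommGroup B] [NormedSpace ℂ B]

/-- Continuity of a linear map for the Fréchet topology of `C^∞(U^m)`. -/
def IsSmoothContinuous (T : SmoothOn m U →ₗ[ℂ] B) : Prop :=
  ∃ (K : Set (Fin m → ℝ)) (N : ℕ) (C : ℝ), IsCompact K ∧ K ⊆ cube m U ∧
    ∀ (F : SmoothOn m U) (b : ℝ), 0 ≤ b →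
      (∀ j ≤ N, ∀ x ∈ K, ‖iteratedFDerivWithin ℝ j F.1 (cube m U) x‖ ≤ b) → ‖T F‖ ≤ C * b

/-- The space of `N`-jets on `K`. -/
def JetSpace (m N : ℕ) (K : Set (Fin m → ℝ)) : Type :=
  (j : Fin (N + 1)) → C(K, (Fin m → ℝ)[×(j : ℕ)]→L[ℝ] ℂ)

section JetSpace

variable {N : ℕ} {K : Set (Fin m → ℝ)} [CompactSpace K]

instance : NormedAddCommGroup (JetSpace m N K) :=
  inferInstanceAs (NormedAddCommGroup ((j : Fin (N + 1)) → C(K, (Fin m → ℝ)[×(j : ℕ)]→L[ℝ] ℂ)))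

instance : NormedSpace ℂ (JetSpace m N K) :=
  inferInstanceAs (NormedSpace ℂ ((j : Fin (N + 1)) → C(K, (Fin m → ℝ)[×(j : ℕ)]→L[ℝ] ℂ)))

instance : CompleteSpace (JetSpace m N K) :=
  inferInstanceAs (CompleteSpace ((j : Fin (N + 1)) → C(K, (Fin m → ℝ)[×(j : ℕ)]→L[ℝ] ℂ)))

/-- Evaluation of the `j`-th component of a jet at a point. -/
def JetSpace.evalL (j : Fin (N + 1)) (x : K) :
    JetSpace m N K →L[ℝ] ((Fin m → ℝ)[×(j : ℕ)]→L[ℝ] ℂ) :=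
  (ContinuousMap.evalCLM ℝ x).comp (ContinuousLinearMap.proj (R := ℝ)
    (φ := fun j : Fin (N + 1) => C(K, (Fin m → ℝ)[×(j : ℕ)]→L[ℝ] ℂ)) j)

theorem JetSpace.ext' {J J' : JetSpace m N K}
    (h : ∀ j x, JetSpace.evalL j x J = JetSpace.evalL j x J') :
    J = J' :=
  funext fun j => ContinuousMap.ext fun x => h j x

theorem JetSpace.norm_evalL_le (J : JetSpace m N K) (j : Fin (N + 1)) (x : K) :
    ‖JetSpace.evalL j x J‖ ≤ ‖J‖ :=
  (ContinuousMap.norm_coe_le_norm (J j) x).trans (norm_le_pi_norm J j)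

theorem JetSpace.norm_le {J : JetSpace m N K} {b : ℝ} (hb : 0 ≤ b)
    (h : ∀ j x, ‖JetSpace.evalL j x J‖ ≤ b) : ‖J‖ ≤ b :=
  (pi_norm_le_iff_of_nonneg hb).2 fun j => (ContinuousMap.norm_le _ hb).2 fun x => h j x

end JetSpace

/-- The jet of a smooth function on a subset of `U^m`. -/
def jet (hU : IsOpen U) (N : ℕ) {K : Set (Fin m → ℝ)} [CompactSpace K] (hK : K ⊆ cube m U)
    (F : SmoothOn m U) : JetSpace m N K := fun j =>
  ⟨fun x => iteratedFDerivWithin ℝ j F.1 (cube m U) x,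
    ((F.2.continuousOn_iteratedFDerivWithin (WithTop.coe_le_coe.2 le_top)
      (isOpen_cube hU m).uniqueDiffOn).mono hK).domRestrict⟩

theorem smoothOn_contDiffWithinAt (F : SmoothOn m U) (j : ℕ) {x : Fin m → ℝ} (hx : x ∈ cube m U) :
    ContDiffWithinAt ℝ j F.1 (cube m U) x :=
  (F.2 x hx).of_le (WithTop.coe_le_coe.2 le_top)

theorem jet_add (hU : IsOpen U) (N : ℕ) {K : Set (Fin m → ℝ)} [CompactSpace K] (hK : K ⊆ cube m U)
    (F G : SmoothOn m U) : jet hU N hK (F + G) = jet hU N hK F + jet hU N hK G := by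
  refine JetSpace.ext' fun j x => ?_
  exact iteratedFDerivWithin_add_apply (smoothOn_contDiffWithinAt F j (hK x.2))
    (smoothOn_contDiffWithinAt G j (hK x.2)) (isOpen_cube hU m).uniqueDiffOn (hK x.2)

theorem jet_smul (hU : IsOpen U) (N : ℕ) {K : Set (Fin m → ℝ)} [CompactSpace K] (hK : K ⊆ cube m U)
    (c : ℂ) (F : SmoothOn m U) : jet hU N hK (c • F) = c • jet hU N hK F := by
  refine JetSpace.ext' fun j x => ?_
  exact iteratedFDerivWithin_const_smul_apply (smoothOn_contDiffWithinAt F j (hK x.2))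
    (isOpen_cube hU m).uniqueDiffOn (hK x.2)

theorem norm_le_norm_jet (hU : IsOpen U) {N : ℕ} {K : Set (Fin m → ℝ)} 
    [CompactSpace K] (hK : K ⊆ cube m U) {T : SmoothOn m U →ₗ[ℂ] B} {C : ℝ}
    (hT : ∀ (F : SmoothOn m U) (b : ℝ), 0 ≤ b →
      (∀ j ≤ N, ∀ x ∈ K, ‖iteratedFDerivWithin ℝ j F.1 (cube m U) x‖ ≤ b) → ‖T F‖ ≤ C * b)
    (F : SmoothOn m U) : ‖T F‖ ≤ C * ‖jet hU N hK F‖ := by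
  refine hT F _ (norm_nonneg _) fun j hj x hx => ?_
  exact (jet hU N hK F).norm_evalL_le ⟨j, Nat.lt_succ_of_le hj⟩ ⟨x, hx⟩

variable {Ω : Type*} [TopologicalSpace Ω] [MeasurableSpace Ω] [OpensMeasurableSpace Ω]
  [SecondCountableTopology Ω] {μ : Measure Ω} {f : Ω → (Fin m → ℝ) → ℂ}

/-- A continuous linear map on smooth functions commutes with integrals of dominated families. -/
theorem IsSmoothContinuous.integral_comm [CompleteSpace B] (hU : IsOpen U)
    {T : SmoothOn m U →ₗ[ℂ] B} (hT : IsSmoothContinuous T)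
    (hf : IsDominatedFamily μ (cube m U) f) (G : SmoothOn m U)
    (hG : ∀ x ∈ cube m U, G.1 x = ∫ w, f w x ∂μ) :
    Integrable (fun w => T ⟨f w, hf.smooth w⟩) μ ∧ T G = ∫ w, T ⟨f w, hf.smooth w⟩ ∂μ := by
  obtain ⟨K, N, C, hKc, hK, hT⟩ := hT
  have : CompactSpace K := isCompact_iff_compactSpace.1 hKc
  have hW := isOpen_cube hU m
  let F : Ω → SmoothOn m U := fun w => ⟨f w, hf.smooth w⟩
  let J : SmoothOn m U → JetSpace m N K := jet hU N hK
  have hTJ : ∀ F, ‖T F‖ ≤ C * ‖J F‖ := norm_le_norm_jet hU hK hT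
  have hJcont : Continuous fun w => J (F w) := by
    refine continuous_pi (A := fun j : Fin (N + 1) => C(K, (Fin m → ℝ)[×(j : ℕ)]→L[ℝ] ℂ))
      fun j => ContinuousMap.continuous_of_continuous_uncurry _ ?_
    have hm : Continuous fun p : Ω × K => (p.1, (p.2 : Fin m → ℝ)) := by fun_prop
    exact (hf.continuousOn j).comp_continuous hm fun p => ⟨mem_univ _, hK p.2.2⟩
  have hJint : Integrable (fun w => J (F w)) μ := by
    -- The sum of the bounds for the orders `0, …, N` dominates the jet norm.
    choose! b hb hle using fun j => hf.dominated j K hKc hK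
    refine (integrable_finsetSum (Finset.univ : Finset (Fin (N + 1)))
      fun j _ => (hb j).norm).mono' hJcont.aestronglyMeasurable (.of_forall fun w => ?_)
    refine JetSpace.norm_le (Finset.sum_nonneg fun j _ => norm_nonneg _) fun j x => ?_
    refine ((hle j w x x.2).trans (le_abs_self _)).trans ?_
    exact Finset.single_le_sum (f := fun j : Fin (N + 1) => ‖b j w‖) (fun j _ => norm_nonneg _)
      (Finset.mem_univ j)
  have hTsub : ∀ F F', ‖T F - T F'‖ ≤ C * ‖J F - J F'‖ := by
    intro F F'
    have e : J F - J F' = J (F - F') := by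
      rw [sub_eq_add_neg, sub_eq_add_neg, ← neg_one_smul ℂ F', ← neg_one_smul ℂ (J F')]
      simp only [J, jet_add, jet_smul]
    rw [← map_sub, e]
    exact hTJ _
  have hTcont : Continuous fun w => T (F w) := by
    refine continuous_iff_continuousAt.2 fun w₀ => ?_
    refine tendsto_iff_norm_sub_tendsto_zero.2 ?_
    refine squeeze_zero (fun _ => norm_nonneg _) (fun w => hTsub (F w) (F w₀)) ?_
    have h0 := (tendsto_iff_norm_sub_tendsto_zero.1 (hJcont.tendsto w₀)).const_mul C
    rwa [mul_zero] at h0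
  have hTint : Integrable (fun w => T (F w)) μ :=
    (hJint.norm.const_mul C).mono' hTcont.aestronglyMeasurable (.of_forall fun w => hTJ _)
  refine ⟨hTint, ?_⟩
  -- Rather than extending `T` to limits of jets, use the graph of `T` over the jets. The integral
  -- of a family of points of the graph lies in the closure of the graph.
  let S : Submodule ℝ (JetSpace m N K × B) :=
    { carrier := range fun F => (J F, T F)
      add_mem' := by
        rintro _ _ ⟨F, rfl⟩ ⟨F', rfl⟩
        exact ⟨F + F', Prod.ext (jet_add hU N hK F F') (map_add T F F')⟩
      zero_mem' := ⟨0, Prod.ext (by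
        have h0 := jet_smul hU N hK 0 (0 : SmoothOn m U)
        rwa [zero_smul, zero_smul] at h0) (map_zero T)⟩
      smul_mem' := by
        rintro c _ ⟨F, rfl⟩
        exact ⟨(c : ℂ) • F, Prod.ext (jet_smul hU N hK (c : ℂ) F) (T.map_smul (c : ℂ) F)⟩ }
  have hmem : (∫ w, (J (F w), T (F w)) ∂μ) ∈ S.topologicalClosure :=
    submodule_integral_mem S.isClosed_topologicalClosure (hJint.prodMk hTint) fun w =>
      S.le_topologicalClosure ⟨F w, rfl⟩
  have hJG : J G = ∫ w, J (F w) ∂μ := by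
    refine JetSpace.ext' fun j x => ?_
    have h1 := (JetSpace.evalL j x).integral_comp_comm hJint
    refine Eq.trans ?_ h1
    refine Eq.trans ?_ (hf.iteratedFDerivWithin_integral hW j (hK x.2))
    exact iteratedFDerivWithin_congr hG (hK x.2) j
  -- The integrated point and the point of `G` have the same jet. The estimate of `T` by the jet
  -- survives closure, so a point over the zero jet must vanish.
  have hdiff : ((0, ∫ w, T (F w) ∂μ - T G) : JetSpace m N K × B) ∈ S.topologicalClosure := by
    have h1 : ((J G, T G) : JetSpace m N K × B) ∈ S.topologicalClosure :=
      S.le_topologicalClosure ⟨G, rfl⟩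
    have h2 := S.topologicalClosure.sub_mem hmem h1
    rwa [integral_pair hJint hTint, ← hJG, Prod.mk_sub_mk, sub_self] at h2
  have hclosed : ∀ p ∈ S.topologicalClosure, ‖p.2‖ ≤ C * ‖p.1‖ := by
    intro p hp
    refine closure_minimal (s := (S : Set (JetSpace m N K × B)))
      (t := {p | ‖p.2‖ ≤ C * ‖p.1‖}) ?_ (isClosed_le (by fun_prop) (by fun_prop)) hp
    rintro _ ⟨F, rfl⟩
    exact hTJ F
  have h0 := hclosed _ hdiff
  rw [norm_zero, mul_zero, norm_le_zero_iff, sub_eq_zero] at h0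
  exact h0.symm

end Operators

/-! ### Criteria for dominated families -/

section Criteria

variable {E : Type*} [NormedAddCommGroup E] [NormedSpace ℝ E]
  {P : Type*} [NormedAddCommGroup P] [NormedSpace ℝ P]

/-- The slice is a translate of `F` by `(p, 0)` restricted along the linear inclusion `inr`;
translation leaves derivatives unchanged and linear maps compose with them. -/
theorem iteratedFDeriv_comp_prodMk {F : P × E → ℂ} {O : Set (P × E)} (hO : IsOpen O)
    (hF : ContDiffOn ℝ ∞ F O) (j : ℕ) {p : P} {x : E} (h : (p, x) ∈ O) :
    iteratedFDeriv ℝ j (fun x => F (p, x)) x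
      = (iteratedFDeriv ℝ j F (p, x)).compContinuousLinearMap
          fun _ => ContinuousLinearMap.inr ℝ P E := by
  have hs : IsOpen ((fun z : P × E => (p, (0 : E)) + z) ⁻¹' O) := hO.preimage (by fun_prop)
  have hFs : ContDiffOn ℝ ∞ (fun z : P × E => F ((p, (0 : E)) + z))
      ((fun z : P × E => (p, (0 : E)) + z) ⁻¹' O) :=
    hF.comp (by fun_prop) fun z hz => hz
  have hs' := hs.preimage (ContinuousLinearMap.inr ℝ P E).continuous
  have hx : ContinuousLinearMap.inr ℝ P E x ∈ (fun z : P × E => (p, (0 : E)) + z) ⁻¹' O := by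
    simpa using h
  have key := (ContinuousLinearMap.inr ℝ P E).iteratedFDerivWithin_comp_right hFs hs.uniqueDiffOn
    hs'.uniqueDiffOn hx (i := j) (WithTop.coe_le_coe.2 le_top)
  rw [iteratedFDerivWithin_of_isOpen j hs' hx, iteratedFDerivWithin_of_isOpen j hs hx,
    iteratedFDeriv_comp_add_left] at key
  convert key using 3
  · simp
  · simp

variable {Ω : Type*} [TopologicalSpace Ω] {W : Set E}

/-- Derivatives in `x` are restrictions of the full derivatives of `F`, and restriction along `inr`
is a continuous operation on multilinear maps. -/
theorem continuousOn_iteratedFDerivWithin_of_joint (hW : IsOpen W) {F : P × E → ℂ}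
    {O : Set (P × E)} (hO : IsOpen O) (hF : ContDiffOn ℝ ∞ F O) {p : Ω → P} (hp : Continuous p)
    (h : ∀ w, ∀ x ∈ W, (p w, x) ∈ O) (j : ℕ) :
    ContinuousOn (fun q : Ω × E => iteratedFDerivWithin ℝ j (fun x => F (p q.1, x)) W q.2)
      (univ ×ˢ W) := by
  have h1 : ContinuousOn (fun q : Ω × E => (iteratedFDeriv ℝ j F (p q.1, q.2))) (univ ×ˢ W) := by
    have h2 := hF.continuousOn_iteratedFDerivWithin (m := j) (WithTop.coe_le_coe.2 le_top)
      hO.uniqueDiffOn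
    have h3 : ContinuousOn (iteratedFDeriv ℝ j F) O :=
      h2.congr fun z hz => (iteratedFDerivWithin_of_isOpen j hO hz).symm
    exact h3.comp (f := fun q : Ω × E => (p q.1, q.2)) (by fun_prop) fun q hq => h q.1 q.2 hq.2
  have h4 := (ContinuousMultilinearMap.compContinuousLinearMapL (𝕜 := ℝ) (F := ℂ)
    fun _ : Fin j => ContinuousLinearMap.inr ℝ P E).continuous.comp_continuousOn h1
  refine h4.congr fun q hq => ?_
  rw [iteratedFDerivWithin_of_isOpen j hW hq.2]
  exact iteratedFDeriv_comp_prodMk hO hF j (h q.1 q.2 hq.2)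

theorem contDiffOn_comp_prodMk {F : P × E → ℂ} {O : Set (P × E)} (hF : ContDiffOn ℝ ∞ F O) {p : P}
    (h : ∀ x ∈ W, (p, x) ∈ O) : ContDiffOn ℝ ∞ (fun x => F (p, x)) W :=
  hF.comp (by fun_prop) h

theorem isDominatedFamily_of_compactSpace [MeasurableSpace Ω] {μ : Measure Ω} [CompactSpace Ω]
    [IsFiniteMeasure μ] (hW : IsOpen W) {F : P × E → ℂ} {O : Set (P × E)} (hO : IsOpen O)
    (hF : ContDiffOn ℝ ∞ F O) {p : Ω → P}
    (hp : Continuous p) (h : ∀ w, ∀ x ∈ W, (p w, x) ∈ O) :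
    IsDominatedFamily μ W fun w x => F (p w, x) := by
  have hc := continuousOn_iteratedFDerivWithin_of_joint hW hO hF hp h
  refine ⟨fun w => contDiffOn_comp_prodMk hF (h w), hc, fun j K hK hKW => ?_⟩
  obtain ⟨C, hC⟩ := (isCompact_univ.prod hK).exists_bound_of_continuousOn
    ((hc j).mono (prod_mono_right hKW))
  exact ⟨fun _ => C, integrable_const C, fun w x hx => hC (w, x) ⟨mem_univ _, hx⟩⟩

/-- Bounds for the derivatives of `φ · exp (∑ λ_l g_l)`, of polynomial growth in `λ`. -/
theorem exists_norm_iteratedFDerivWithin_exp_le (hW : IsOpen W) {ι : Type*} [Fintype ι]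
    {g : ι → E → ℂ} (hg : ∀ l, ContDiffOn ℝ ∞ (g l) W) {φ : E → ℂ} (hφ : ContDiffOn ℝ ∞ φ W)
    {K : Set E} (hK : IsCompact K) (hKW : K ⊆ W) (j : ℕ) :
    ∃ M, 0 ≤ M ∧ ∀ c : ι → ℝ, ∀ x ∈ K,
      ‖iteratedFDerivWithin ℝ j (fun y => φ y * Complex.exp (∑ l, c l • g l y)) W x‖
        ≤ M * (1 + ∑ l, |c l|) ^ j * Real.exp (∑ l, c l • g l x).re := by
  have hb : ∀ {f : E → ℂ}, ContDiffOn ℝ ∞ f W → ∃ C, 1 ≤ C ∧ ∀ i ≤ j, ∀ x ∈ K,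
      ‖iteratedFDerivWithin ℝ i f W x‖ ≤ C := by
    intro f hf
    have : ∀ i : ℕ, ∃ C, ∀ x ∈ K, ‖iteratedFDerivWithin ℝ i f W x‖ ≤ C := fun i =>
      hK.exists_bound_of_continuousOn ((hf.continuousOn_iteratedFDerivWithin
        (WithTop.coe_le_coe.2 le_top) hW.uniqueDiffOn).mono hKW)
    choose C hC using this
    refine ⟨1 + ∑ i ∈ Finset.range (j + 1), |C i|,
      le_add_of_nonneg_right (Finset.sum_nonneg fun _ _ => abs_nonneg _), fun i hi x hx => ?_⟩
    refine ((hC i x hx).trans (le_abs_self _)).trans ?_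
    have := Finset.single_le_sum (f := fun i => |C i|) (fun i _ => abs_nonneg _)
      (Finset.mem_range.2 (Nat.lt_succ_of_le hi))
    linarith
  choose D hD1 hD using fun l => hb (hg l)
  obtain ⟨Q, hQ1, hQ⟩ := hb hφ
  let D' := 1 + ∑ l, D l
  have hD0 : ∀ l, 0 ≤ D l := fun l => zero_le_one.trans (hD1 l)
  have hD' : ∀ l, D l ≤ D' := fun l => by
    have := Finset.single_le_sum (f := D) (fun i _ => hD0 i) (Finset.mem_univ l)
    simp only [D']; linarith
  have hD'1 : 1 ≤ D' := le_add_of_nonneg_right (Finset.sum_nonneg fun l _ => hD0 l)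
  let R := 1 + ∑ i ∈ Finset.range (j + 1), ‖iteratedFDeriv ℝ i Complex.exp 0‖
  -- Since `exp (z + w) = exp z · exp w`, every derivative at `z` is `exp z` times the derivative at
  -- `0`.
  have hR : ∀ i ≤ j, ∀ z : ℂ, ‖iteratedFDeriv ℝ i Complex.exp z‖ ≤ R * Real.exp z.re := by
    intro i hi z
    have h1 : iteratedFDeriv ℝ i Complex.exp z
        = Complex.exp z • iteratedFDeriv ℝ i Complex.exp 0 := by
      have h2 := iteratedFDeriv_comp_add_left (𝕜 := ℝ) (f := Complex.exp) i z 0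
      rw [add_zero] at h2
      rw [← h2, ← iteratedFDeriv_const_smul_apply (Complex.contDiff_exp.contDiffAt)]
      congr 1
      ext w
      simp [Complex.exp_add]
    have h3 := Finset.single_le_sum (f := fun i => ‖iteratedFDeriv ℝ i Complex.exp 0‖)
      (fun i _ => norm_nonneg _) (Finset.mem_range.2 (Nat.lt_succ_of_le hi))
    rw [h1, norm_smul, Complex.norm_exp, mul_comm]
    exact mul_le_mul_of_nonneg_right (by simp only [R]; linarith) (Real.exp_nonneg _)
  have hR1 : 1 ≤ R := le_add_of_nonneg_right (Finset.sum_nonneg fun l _ => norm_nonneg _)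
  have hcs : ∀ c : ι → ℝ, 0 ≤ ∑ l, |c l| := fun c => Finset.sum_nonneg fun _ _ => abs_nonneg _
  have hsm : ∀ c : ι → ℝ, ContDiffOn ℝ ∞ (fun y => ∑ l, c l • g l y) W := fun c =>
    ContDiffOn.sum fun l _ => (hg l).const_smul (c l)
  have hexp : ∀ c : ι → ℝ, ∀ x ∈ K, ∀ i ≤ j,
      ‖iteratedFDerivWithin ℝ i (fun y => Complex.exp (∑ l, c l • g l y)) W x‖
        ≤ (j.factorial * R * D' ^ j) * (1 + ∑ l, |c l|) ^ j
          * Real.exp (∑ l, c l • g l x).re := by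
    intro c x hx i hi
    have hs1 : 1 ≤ (1 + ∑ l, |c l|) * D' := by nlinarith [hcs c]
    -- Faà di Bruno in the form `i! C Dⁱ`. It asks that the inner derivative of order `i'` be at
    -- most `D ^ i'`; it is at most `D`, which suffices because `D ≥ 1`.
    have h1 := norm_iteratedFDerivWithin_comp_le (𝕜 := ℝ) (g := Complex.exp) (t := univ)
      (f := fun y => ∑ l, c l • g l y) (n := i) (x := x) (C := R * Real.exp (∑ l, c l • g l x).re)
      (D := (1 + ∑ l, |c l|) * D') Complex.contDiff_exp.contDiffOn (hsm c)
      (WithTop.coe_le_coe.2 le_top) uniqueDiffOn_univ hW.uniqueDiffOn (mapsTo_univ _ _) (hKW hx)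
      (fun i' hi' => by
        rw [iteratedFDerivWithin_univ]
        exact hR i' (hi'.trans hi) _)
      (fun i' hi'1 hi' => by
        have hg' : ∀ l, ContDiffWithinAt ℝ i' (g l) W x := fun l =>
          (hg l x (hKW hx)).of_le (WithTop.coe_le_coe.2 le_top)
        have e : iteratedFDerivWithin ℝ i' (fun y => ∑ l, c l • g l y) W x
            = ∑ l, c l • iteratedFDerivWithin ℝ i' (g l) W x := by
          rw [iteratedFDerivWithin_fun_sum_apply hW.uniqueDiffOn (hKW hx)
            fun l _ => (hg' l).const_smul (c l)]
          exact Finset.sum_congr rfl fun l _ =>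
            iteratedFDerivWithin_const_smul_apply (hg' l) hW.uniqueDiffOn (hKW hx)
        rw [e]
        refine le_trans ?_ (le_self_pow₀ hs1 (Nat.one_le_iff_ne_zero.1 hi'1))
        refine (norm_sum_le _ _).trans ?_
        have : ∑ l, ‖c l • iteratedFDerivWithin ℝ i' (g l) W x‖ ≤ ∑ l, |c l| * D' := by
          refine Finset.sum_le_sum fun l _ => ?_
          rw [norm_smul, Real.norm_eq_abs]
          exact mul_le_mul_of_nonneg_left ((hD l i' (hi'.trans hi) x hx).trans (hD' l))
            (abs_nonneg _)
        rw [← Finset.sum_mul] at this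
        nlinarith)
    refine h1.trans ?_
    have h2 : ((1 + ∑ l, |c l|) * D') ^ i ≤ (1 + ∑ l, |c l|) ^ j * D' ^ j := by
      rw [← mul_pow]
      exact pow_le_pow_right₀ hs1 hi
    have h3 : (i.factorial : ℝ) ≤ j.factorial := by exact_mod_cast Nat.factorial_le hi
    calc (i.factorial : ℝ) * (R * Real.exp (∑ l, c l • g l x).re) * ((1 + ∑ l, |c l|) * D') ^ i
        ≤ j.factorial * (R * Real.exp (∑ l, c l • g l x).re)
          * ((1 + ∑ l, |c l|) ^ j * D' ^ j) := by gcongr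
      _ = _ := by ring
  refine ⟨∑ i ∈ Finset.range (j + 1), (j.choose i : ℝ) * Q * (j.factorial * R * D' ^ j),
    by positivity, fun c x hx => ?_⟩
  refine (norm_iteratedFDerivWithin_mul_le hφ ((Complex.contDiff_exp (𝕜 := ℝ)).comp_contDiffOn
    (hsm c)) hW.uniqueDiffOn (hKW hx) (WithTop.coe_le_coe.2 le_top)).trans ?_
  rw [Finset.sum_mul, Finset.sum_mul]
  refine Finset.sum_le_sum fun i hi => ?_
  have hij : i ≤ j := Nat.le_of_lt_succ (Finset.mem_range.1 hi)
  calc (j.choose i : ℝ) * ‖iteratedFDerivWithin ℝ i φ W x‖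
        * ‖iteratedFDerivWithin ℝ (j - i) (fun y => Complex.exp (∑ l, c l • g l y)) W x‖
      ≤ (j.choose i : ℝ) * Q * ((j.factorial * R * D' ^ j) * (1 + ∑ l, |c l|) ^ j
          * Real.exp (∑ l, c l • g l x).re) := by
        gcongr
        · exact hQ i hij x hx
        · exact hexp c x hx (j - i) (Nat.sub_le _ _)
    _ = _ := by ring

end Criteria

/-! ### Cutoff functions -/

section Cutoff

variable {E : Type*} [NormedAddCommGroup E] [NormedSpace ℝ E]

/-- The cutoff is `1` near `K`, not merely on it, so that multiplying by it preserves all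
derivatives on `K`. -/
theorem exists_smooth_cutoff [FiniteDimensional ℝ E] {K W : Set E} (hK : IsCompact K)
    (hW : IsOpen W) (hKW : K ⊆ W) :
    ∃ χ : E → ℝ, ContDiff ℝ ∞ χ ∧ HasCompactSupport χ ∧ tsupport χ ⊆ W ∧
      ∀ᶠ x in 𝓝ˢ K, χ x = 1 := by
  have : ProperSpace E := FiniteDimensional.proper_real E
  obtain ⟨L, hL, hKL, hLW⟩ := exists_compact_between hK hW hKW
  obtain ⟨χ, h1, h0, -⟩ := exists_contMDiffMap_one_nhds_of_subset_interior (n := ⊤)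
    (modelWithCornersSelf ℝ E) hK.isClosed hKL
  have hs : tsupport χ ⊆ L := closure_minimal
    (fun x hx => by_contra fun hxL => hx (h0 x hxL)) hL.isClosed
  exact ⟨χ, χ.contMDiff.contDiff, hL.of_isClosed_subset (isClosed_tsupport _) hs, hs.trans hLW, h1⟩

theorem contDiff_cutoff_mul {χ : E → ℝ} (hχ : ContDiff ℝ ∞ χ) {W : Set E} (hW : IsOpen W)
    (hs : tsupport χ ⊆ W) {f : E → ℂ} (hf : ContDiffOn ℝ ∞ f W) :
    ContDiff ℝ ∞ fun x => (χ x : ℂ) * f x := by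
  refine contDiff_iff_contDiffAt.2 fun x => ?_
  by_cases hx : x ∈ tsupport χ
  · exact ((Complex.ofRealCLM.contDiff.comp hχ).contDiffAt).mul
      (hf.contDiffAt (hW.mem_nhds (hs hx)))
  · refine (contDiffAt_const (c := (0 : ℂ))).congr_of_eventuallyEq ?_
    filter_upwards [notMem_tsupport_iff_eventuallyEq.1 hx] with y hy
    simp [hy]

theorem hasCompactSupport_cutoff_mul {E : Type*} [TopologicalSpace E] {χ : E → ℝ}
    (hχ : HasCompactSupport χ) (f : E → ℂ) :
    HasCompactSupport fun x => (χ x : ℂ) * f x :=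
  (hχ.comp_left (g := fun t : ℝ => (t : ℂ)) Complex.ofReal_zero).mul_right

end Cutoff

/-! ### The Fourier transform on `ℝᵐ` with the product structure -/

section PiFourier

open scoped SchwartzMap FourierTransform RealInnerProductSpace

variable {m : ℕ}

/-- The Fourier transform on `Fin m → ℝ`. -/
def piFourier (m : ℕ) : 𝓢(Fin m → ℝ, ℂ) →L[ℂ] 𝓢(Fin m → ℝ, ℂ) :=
  (SchwartzMap.compCLMOfContinuousLinearEquiv ℂ (EuclideanSpace.equiv (Fin m) ℝ).symm).comp
    ((SchwartzMap.fourierTransformCLM ℂ).comp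
      (SchwartzMap.compCLMOfContinuousLinearEquiv ℂ (EuclideanSpace.equiv (Fin m) ℝ)))

theorem inner_toLp (x ξ : Fin m → ℝ) :
    ⟪(WithLp.toLp 2 x : EuclideanSpace ℝ (Fin m)), WithLp.toLp 2 ξ⟫ = ∑ l, ξ l * x l := by
  simp [PiLp.inner_apply]

theorem integral_euclidean {X : Type*} [NormedAddCommGroup X] [NormedSpace ℝ X]
    (f : EuclideanSpace ℝ (Fin m) → X) :
    ∫ v, f v = ∫ x : Fin m → ℝ, f (WithLp.toLp 2 x) :=
  ((PiLp.volume_preserving_toLp (Fin m)).integral_comp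
    (MeasurableEquiv.toLp 2 (Fin m → ℝ)).measurableEmbedding f).symm

theorem piFourier_apply (G : 𝓢(Fin m → ℝ, ℂ)) (ξ : Fin m → ℝ) :
    piFourier m G ξ = ∫ x, Complex.exp (-∑ l, ξ l • (2 * Real.pi * Complex.I * x l)) * G x := by
  change 𝓕 (fun v : EuclideanSpace ℝ (Fin m) => G (WithLp.ofLp v)) (WithLp.toLp 2 ξ) = _
  rw [Real.fourier_eq', integral_euclidean]
  refine integral_congr_ae (.of_forall fun x => ?_)
  simp only [inner_toLp, smul_eq_mul]
  congr 2
  push_cast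
  rw [Finset.mul_sum, Finset.sum_mul, ← Finset.sum_neg_distrib]
  exact Finset.sum_congr rfl fun l _ => by simp; ring

theorem piFourier_inversion (G : 𝓢(Fin m → ℝ, ℂ)) (x : Fin m → ℝ) :
    G x = ∫ ξ, piFourier m G ξ * Complex.exp (∑ l, ξ l • (2 * Real.pi * Complex.I * x l)) := by
  let Gt : 𝓢(EuclideanSpace ℝ (Fin m), ℂ) :=
    SchwartzMap.compCLMOfContinuousLinearEquiv ℂ (EuclideanSpace.equiv (Fin m) ℝ) G
  have h : 𝓕⁻ (𝓕 (Gt : EuclideanSpace ℝ (Fin m) → ℂ)) (WithLp.toLp 2 x) = Gt (WithLp.toLp 2 x) :=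
    Gt.integrable.fourierInv_fourier_eq (𝓕 Gt).integrable Gt.continuous.continuousAt
  rw [Real.fourierInv_eq', integral_euclidean] at h
  refine h.symm.trans (integral_congr_ae (.of_forall fun ξ => ?_))
  simp only [inner_toLp, smul_eq_mul]
  rw [mul_comm]
  congr 2
  push_cast
  rw [Finset.mul_sum, Finset.sum_mul]
  exact Finset.sum_congr rfl fun l _ => by simp; ring

theorem integrable_piFourier_mul (G : 𝓢(Fin m → ℝ, ℂ)) (j : ℕ) :
    Integrable fun ξ => ‖piFourier m G ξ‖ * (1 + ∑ l, |ξ l|) ^ j := by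
  have h0 := (piFourier m G).integrable_pow_mul volume 0
  have hj := (piFourier m G).integrable_pow_mul volume j
  -- From `1 + ∑ |ξ_l| ≤ (1 + m)(1 + ‖ξ‖)` in the sup norm and `(1 + a)^j ≤ 2^j (1 + a^j)`.
  refine ((h0.add hj).const_mul ((1 + m) ^ j * 2 ^ j : ℝ)).mono' (by
    have := (piFourier m G).continuous
    exact Continuous.aestronglyMeasurable (by fun_prop)) (.of_forall fun ξ => ?_)
  have h1 : ∑ l, |ξ l| ≤ m * ‖ξ‖ := by
    have := Finset.sum_le_sum fun l (_ : l ∈ Finset.univ) => norm_le_pi_norm ξ l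
    simpa using this
  have hs : 0 ≤ ∑ l, |ξ l| := Finset.sum_nonneg fun _ _ => abs_nonneg _
  have h2 : 1 + ∑ l, |ξ l| ≤ (1 + m) * (1 + ‖ξ‖) := by nlinarith [norm_nonneg ξ]
  have h3 : (1 + ‖ξ‖) ^ j ≤ 2 ^ j * (1 + ‖ξ‖ ^ j) := by
    have h4 : 1 + ‖ξ‖ ≤ 2 * max 1 ‖ξ‖ := by linarith [le_max_left 1 ‖ξ‖, le_max_right 1 ‖ξ‖]
    have h5 : (max 1 ‖ξ‖) ^ j ≤ 1 + ‖ξ‖ ^ j := by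
      rcases max_choice 1 ‖ξ‖ with h | h <;> rw [h]
      · simp
      · simp
    calc (1 + ‖ξ‖) ^ j ≤ (2 * max 1 ‖ξ‖) ^ j := by gcongr
      _ = 2 ^ j * (max 1 ‖ξ‖) ^ j := mul_pow _ _ _
      _ ≤ _ := by gcongr
  rw [Real.norm_of_nonneg (by positivity)]
  calc ‖piFourier m G ξ‖ * (1 + ∑ l, |ξ l|) ^ j
      ≤ ‖piFourier m G ξ‖ * ((1 + m) * (1 + ‖ξ‖)) ^ j := by gcongr
    _ = ‖piFourier m G ξ‖ * ((1 + m) ^ j * (1 + ‖ξ‖) ^ j) := by rw [mul_pow]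
    _ ≤ ‖piFourier m G ξ‖ * ((1 + m) ^ j * (2 ^ j * (1 + ‖ξ‖ ^ j))) := by gcongr
    _ = _ := by simp; ring

end PiFourier

/-! ### Continuous operators agreeing on exponentials -/

section Agreement

open scoped SchwartzMap

variable {m : ℕ} {U : Set ℝ} {B : Type*} [NormedAddCommGroup B] [NormedSpace ℂ B]

theorem contDiff_expFun (ξ : Fin m → ℝ) : ContDiff ℝ ∞ fun x : Fin m → ℝ =>
    Complex.exp (∑ l, ξ l • (2 * Real.pi * Complex.I * x l)) := by
  refine Complex.contDiff_exp.comp (ContDiff.sum fun l _ => ContDiff.const_smul _ ?_)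
  exact contDiff_const.mul (Complex.ofRealCLM.contDiff.comp (contDiff_apply ℝ ℝ l))

/-- The exponential `x ↦ exp (2πi ξ·x)` as a smooth function on `U^m`. -/
def expFun (U : Set ℝ) (ξ : Fin m → ℝ) : SmoothOn m U :=
  ⟨_, (contDiff_expFun ξ).contDiffOn⟩

/-- The exponents are purely imaginary, so derivatives in `x` grow only polynomially in `ξ`, and the
rapid decay of the Fourier transform makes them integrable. -/
theorem isDominatedFamily_fourier (hU : IsOpen U) (G : 𝓢(Fin m → ℝ, ℂ)) :
    IsDominatedFamily volume (cube m U) fun ξ x =>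
      piFourier m G ξ * Complex.exp (∑ l, ξ l • (2 * Real.pi * Complex.I * x l)) := by
  have hW := isOpen_cube hU m
  have hF : ContDiff ℝ ∞ fun p : (Fin m → ℝ) × (Fin m → ℝ) => piFourier m G p.1 *
      Complex.exp (∑ l, p.1 l • (2 * Real.pi * Complex.I * p.2 l)) := by
    refine (((piFourier m G).smooth ⊤).comp contDiff_fst).mul
      (Complex.contDiff_exp.comp (ContDiff.sum fun l _ => ContDiff.fun_smul ?_ ?_))
    · exact (contDiff_apply ℝ ℝ l).comp contDiff_fst
    · exact contDiff_const.mul (Complex.ofRealCLM.contDiff.comp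
        ((contDiff_apply ℝ ℝ l).comp contDiff_snd))
  have hsm : ∀ ξ : Fin m → ℝ, ContDiffOn ℝ ∞ (fun x => piFourier m G ξ *
      Complex.exp (∑ l, ξ l • (2 * Real.pi * Complex.I * x l))) (cube m U) := fun ξ =>
    (contDiff_const.mul (contDiff_expFun ξ)).contDiffOn
  have hc := continuousOn_iteratedFDerivWithin_of_joint (W := cube m U) hW isOpen_univ
    hF.contDiffOn (continuous_id (X := Fin m → ℝ)) fun _ _ _ => mem_univ _
  refine ⟨hsm, hc, fun j K hK hKW => ?_⟩
  have hg : ∀ l, ContDiffOn ℝ ∞ (fun x : Fin m → ℝ => 2 * Real.pi * Complex.I * x l)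
      (cube m U) := fun l => (contDiff_const.mul
        (Complex.ofRealCLM.contDiff.comp (contDiff_apply ℝ ℝ l))).contDiffOn
  obtain ⟨M, hM0, hM⟩ := exists_norm_iteratedFDerivWithin_exp_le hW hg
    (φ := fun _ => 1) contDiffOn_const hK hKW j
  refine ⟨fun ξ => M * (‖piFourier m G ξ‖ * (1 + ∑ l, |ξ l|) ^ j),
    (integrable_piFourier_mul G j).const_mul M, fun ξ x hx => ?_⟩
  have h := hM ξ x hx
  have e := iteratedFDerivWithin_const_smul_apply (𝕜 := ℝ) (i := j) (a := piFourier m G ξ)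
    (smoothOn_contDiffWithinAt (expFun U ξ) j (hKW hx)) hW.uniqueDiffOn (hKW hx)
  simp only [one_mul] at h
  have hre : (∑ l, ξ l • (2 * Real.pi * Complex.I * (x l : ℂ))).re = 0 := by simp
  rw [hre, Real.exp_zero, mul_one] at h
  change ‖iteratedFDerivWithin ℝ j (piFourier m G ξ • (expFun U ξ).1) (cube m U) x‖ ≤ _
  rw [e, norm_smul]
  calc _ ≤ ‖piFourier m G ξ‖ * (M * (1 + ∑ l, |ξ l|) ^ j) :=
        mul_le_mul_of_nonneg_left h (norm_nonneg _)
    _ = _ := by ring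

/-- A continuous operator is determined by its values on exponentials. -/
theorem IsSmoothContinuous.ext_expFun [CompleteSpace B] (hU : IsOpen U)
    {T₁ T₂ : SmoothOn m U →ₗ[ℂ] B} (h₁ : IsSmoothContinuous T₁) (h₂ : IsSmoothContinuous T₂)
    (h : ∀ ξ, T₁ (expFun U ξ) = T₂ (expFun U ξ)) : T₁ = T₂ := by
  have hW := isOpen_cube hU m
  ext F
  obtain ⟨K₁, N₁, C₁, hK₁, hKW₁, hT₁⟩ := h₁
  obtain ⟨K₂, N₂, C₂, hK₂, hKW₂, hT₂⟩ := h₂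
  obtain ⟨χ, hχ, hχc, hχW, hχ1⟩ := exists_smooth_cutoff (hK₁.union hK₂) hW
    (union_subset hKW₁ hKW₂)
  let G : 𝓢(Fin m → ℝ, ℂ) := (hasCompactSupport_cutoff_mul hχc F.1).toSchwartzMap
    (contDiff_cutoff_mul hχ hW hχW F.2)
  let G' : SmoothOn m U := ⟨G, (G.smooth ⊤).contDiffOn⟩
  -- A continuous operator sees only the derivatives on its compact set, where `F` and `χF` have the
  -- same ones; so `F` may be replaced by a Schwartz function.
  have hloc : ∀ {T : SmoothOn m U →ₗ[ℂ] B} {K : Set (Fin m → ℝ)} {N : ℕ} {C : ℝ},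
      K ⊆ K₁ ∪ K₂ → K ⊆ cube m U → (∀ (F : SmoothOn m U) (b : ℝ), 0 ≤ b →
      (∀ j ≤ N, ∀ x ∈ K, ‖iteratedFDerivWithin ℝ j F.1 (cube m U) x‖ ≤ b) → ‖T F‖ ≤ C * b) →
      T F = T G' := by
    intro T K N C hK hKW hT
    have := hT (F - G') 0 le_rfl fun j _ x hx => by
      have e : (F - G').1 =ᶠ[𝓝[cube m U] x] fun _ => 0 := by
        refine nhdsWithin_le_nhds ?_
        filter_upwards [hχ1.filter_mono (nhds_le_nhdsSet (hK hx))] with y hy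
        change F.1 y - (χ y : ℂ) * F.1 y = 0
        rw [hy]; simp
      rw [e.iteratedFDerivWithin_eq (e.self_of_nhdsWithin (hKW hx))]
      simp
    rw [mul_zero, norm_le_zero_iff, map_sub, sub_eq_zero] at this
    exact this
  rw [hloc subset_union_left hKW₁ hT₁, hloc subset_union_right hKW₂ hT₂]
  have hf := isDominatedFamily_fourier hU G
  have hexp : ∀ {T : SmoothOn m U →ₗ[ℂ] B}, IsSmoothContinuous T →
      T G' = ∫ ξ, piFourier m G ξ • T (expFun U ξ) := by
    intro T hT
    refine (hT.integral_comm hU hf G' fun x _ => piFourier_inversion G x).2.trans ?_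
    refine integral_congr_ae (.of_forall fun ξ => ?_)
    exact T.map_smul (piFourier m G ξ) (expFun U ξ)
  rw [hexp ⟨K₁, N₁, C₁, hK₁, hKW₁, hT₁⟩, hexp ⟨K₂, N₂, C₂, hK₂, hKW₂, hT₂⟩]
  simp_rw [h]

end Agreement

/-! ### Complex functions of a self-adjoint element -/

section RealCalculus

variable {A : Type*} [CStarAlgebra A] {h : A}

/-- A complex function of a real variable, applied to a self-adjoint element. -/
def fc (h : A) (f : ℝ → ℂ) : A := cfc (fun t : ℂ => f t.re) h

theorem re_mem_spectrum (hh : IsSelfAdjoint h) {z : ℂ} (hz : z ∈ spectrum ℂ h) :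
    z.re ∈ spectrum ℝ h := by
  rw [hh.mem_spectrum_eq_re hz] at hz
  exact (spectrum.algebraMap_mem_iff (S := ℂ) (R := ℝ)).1 hz

theorem fc_congr (hh : IsSelfAdjoint h) {f g : ℝ → ℂ} (hfg : ∀ t ∈ spectrum ℝ h, f t = g t) :
    fc h f = fc h g :=
  cfc_congr fun _ hz => hfg _ (re_mem_spectrum hh hz)

theorem norm_fc_le (hh : IsSelfAdjoint h) {f : ℝ → ℂ} {c : ℝ} (hc : 0 ≤ c)
    (hf : ∀ t ∈ spectrum ℝ h, ‖f t‖ ≤ c) : ‖fc h f‖ ≤ c :=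
  norm_cfc_le hc fun _ hz => hf _ (re_mem_spectrum hh hz)

theorem fc_mul {f g : ℝ → ℂ} (hf : Continuous f) (hg : Continuous g) :
    fc h f * fc h g = fc h fun t => f t * g t :=
  (cfc_mul _ _ h (hf.comp Complex.continuous_re).continuousOn
    (hg.comp Complex.continuous_re).continuousOn).symm

theorem fc_smul (c : ℂ) {f : ℝ → ℂ} (hf : Continuous f) :
    fc h (fun t => c * f t) = c • fc h f :=
  cfc_const_mul c _ h (hf.comp Complex.continuous_re).continuousOn

theorem fc_one (hh : IsSelfAdjoint h) : fc h (fun _ => 1) = 1 :=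
  cfc_const_one ℂ h hh.isStarNormal

theorem fc_pow (hh : IsSelfAdjoint h) {f : ℝ → ℂ} (hf : Continuous f) (n : ℕ) :
    fc h (fun t => f t ^ n) = fc h f ^ n :=
  cfc_pow _ n h (hf.comp Complex.continuous_re).continuousOn hh.isStarNormal

theorem fc_exp (hh : IsSelfAdjoint h) :
    fc h (fun t => Complex.exp t) = NormedSpace.exp h := by
  rw [← CFC.complex_exp_eq_normedSpace_exp hh.isStarNormal]
  exact cfc_congr fun z hz => congrArg Complex.exp (hh.mem_spectrum_eq_re hz).symm

/-- Composition of functional calculi. Continuity on the positive axis is enough because `exp` takes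
positive values; this is how `k^{-(d+1)}` becomes a function of `h`. -/
theorem cfc_exp_eq_fc (hh : IsSelfAdjoint h) {g : ℝ → ℝ} (hg : ContinuousOn g (Ioi 0)) :
    cfc g (NormedSpace.exp h) = fc h fun t => (g (Real.exp t) : ℂ) := by
  rw [← CFC.real_exp_eq_normedSpace_exp hh, ← cfc_comp g Real.exp h hh
    (hg.mono (by rintro _ ⟨t, -, rfl⟩; exact Real.exp_pos t)) Real.continuous_exp.continuousOn,
    cfc_real_eq_complex _ hh]
  rfl

/-- Joint continuity gives, by currying, continuity in the compact-open topology, hence uniform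
convergence on the compact spectrum. -/
theorem continuous_fc {X : Type*} [TopologicalSpace X] {F : X → ℝ → ℂ}
    (hF : Continuous fun p : X × ℝ => F p.1 p.2) : Continuous fun x => fc h (F x) := by
  have hF' : Continuous fun p : X × ℂ => F p.1 p.2.re :=
    hF.comp (continuous_fst.prodMk (Complex.continuous_re.comp continuous_snd))
  let G : C(X, C(ℂ, ℂ)) := (⟨fun p : X × ℂ => F p.1 p.2.re, hF'⟩ : C(X × ℂ, ℂ)).curry
  refine continuous_iff_continuousAt.2 fun x₀ => ?_
  refine continuousAt_cfc_fun ?_ (.of_forall fun x => (G x).continuous.continuousOn)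
  exact (ContinuousMap.tendsto_iff_forall_isCompact_tendstoUniformlyOn.1 (G.continuous.tendsto x₀))
    _ (spectrum.isCompact h)

theorem integrableOn_fc (hh : IsSelfAdjoint h) {X : Type*} [TopologicalSpace X]
    [MeasurableSpace X] [OpensMeasurableSpace X] [SecondCountableTopology X] {μ : Measure X}
    {s : Set X} (hs : MeasurableSet s) {F : X → ℝ → ℂ}
    (hF : Continuous fun p : X × ℝ => F p.1 p.2) {b : X → ℝ} (hb : IntegrableOn b s μ)
    (hle : ∀ x ∈ s, ∀ t ∈ spectrum ℝ h, ‖F x t‖ ≤ b x) :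
    IntegrableOn (fun x => fc h (F x)) s μ ∧
      ∫ x in s, fc h (F x) ∂μ = fc h fun t => ∫ x in s, F x t ∂μ := by
  have hF' : Continuous fun p : X × ℂ => F p.1 p.2.re :=
    hF.comp (continuous_fst.prodMk (Complex.continuous_re.comp continuous_snd))
  have h1 : ∀ᵐ x ∂(μ.restrict s), ∀ z ∈ spectrum ℂ h, ‖F x z.re‖ ≤ b x :=
    ae_restrict_of_forall_mem hs fun x hx z hz => hle x hx _ (re_mem_spectrum hh hz)
  exact ⟨integrableOn_cfc hs (fun x (z : ℂ) => F x z.re) b h hF'.continuousOn h1 hb.2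
    hh.isStarNormal, (cfc_setIntegral hs (fun x (z : ℂ) => F x z.re) b h hF'.continuousOn h1 hb.2
      hh.isStarNormal).symm⟩

end RealCalculus

/-! ### Multiplication by smooth functions -/

section Multiplication

theorem exists_norm_iteratedFDerivWithin_mul_le {E : Type*} [NormedAddCommGroup E]
    [NormedSpace ℝ E] {W K : Set E} (hW : IsOpen W) (hK : IsCompact K) (hKW : K ⊆ W) {φ : E → ℂ}
    (hφ : ContDiffOn ℝ ∞ φ W) (N : ℕ) :
    ∃ M, 0 ≤ M ∧ ∀ f : E → ℂ, ContDiffOn ℝ ∞ f W → ∀ b : ℝ, 0 ≤ b →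
      (∀ j ≤ N, ∀ x ∈ K, ‖iteratedFDerivWithin ℝ j f W x‖ ≤ b) →
      ∀ j ≤ N, ∀ x ∈ K, ‖iteratedFDerivWithin ℝ j (fun x => φ x * f x) W x‖ ≤ M * b := by
  have : ∀ i : ℕ, ∃ C, ∀ x ∈ K, ‖iteratedFDerivWithin ℝ i φ W x‖ ≤ C := fun i =>
    hK.exists_bound_of_continuousOn ((hφ.continuousOn_iteratedFDerivWithin
      (WithTop.coe_le_coe.2 le_top) hW.uniqueDiffOn).mono hKW)
  choose C hC using this
  refine ⟨∑ j ∈ Finset.range (N + 1), ∑ i ∈ Finset.range (j + 1), (j.choose i : ℝ) * |C i|,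
    by positivity, fun f hf b hb hfb j hj x hx => ?_⟩
  refine (norm_iteratedFDerivWithin_mul_le hφ hf hW.uniqueDiffOn (hKW hx)
    (WithTop.coe_le_coe.2 le_top)).trans ?_
  have h1 : ∑ i ∈ Finset.range (j + 1), (j.choose i : ℝ) * |C i|
      ≤ ∑ j ∈ Finset.range (N + 1), ∑ i ∈ Finset.range (j + 1), (j.choose i : ℝ) * |C i| :=
    Finset.single_le_sum
      (f := fun j => ∑ i ∈ Finset.range (j + 1), (j.choose i : ℝ) * |C i|)
      (fun j _ => by positivity) (Finset.mem_range.2 (Nat.lt_succ_of_le hj))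
  refine le_trans ?_ (mul_le_mul_of_nonneg_right h1 hb)
  rw [Finset.sum_mul]
  refine Finset.sum_le_sum fun i _ => ?_
  gcongr
  · exact (hC i x hx).trans (le_abs_self _)
  · exact hfb _ ((Nat.sub_le _ _).trans hj) x hx

variable {m : ℕ} {U : Set ℝ} {B : Type*} [NormedAddCommGroup B] [NormedSpace ℂ B]

/-- Multiplication by a smooth function. -/
def mulSmooth (φ : SmoothOn m U) : SmoothOn m U →ₗ[ℂ] SmoothOn m U where
  toFun F := ⟨fun x => φ.1 x * F.1 x, ContDiffOn.mul φ.2 F.2⟩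
  map_add' _ _ := Subtype.ext (funext fun _ => mul_add _ _ _)
  map_smul' _ _ := Subtype.ext (funext fun _ => mul_left_comm _ _ _)

theorem IsSmoothContinuous.comp_mulSmooth (hU : IsOpen U) {T : SmoothOn m U →ₗ[ℂ] B}
    (hT : IsSmoothContinuous T) (φ : SmoothOn m U) : IsSmoothContinuous (T ∘ₗ mulSmooth φ) := by
  obtain ⟨K, N, C, hK, hKW, hT⟩ := hT
  obtain ⟨M, hM0, hM⟩ := exists_norm_iteratedFDerivWithin_mul_le (isOpen_cube hU m) hK hKW φ.2 N
  refine ⟨K, N, C * M, hK, hKW, fun F b hb hF => ?_⟩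
  rw [mul_assoc]
  exact hT (mulSmooth φ F) (M * b) (mul_nonneg hM0 hb) (hM F.1 F.2 b hb hF)

theorem IsSmoothContinuous.clm_comp {B' : Type*} [NormedAddCommGroup B'] [NormedSpace ℂ B']
    {T : SmoothOn m U →ₗ[ℂ] B} (hT : IsSmoothContinuous T) (L : B →L[ℂ] B') :
    IsSmoothContinuous (L.toLinearMap ∘ₗ T) := by
  obtain ⟨K, N, C, hK, hKW, hT⟩ := hT
  refine ⟨K, N, ‖L‖ * C, hK, hKW, fun F b hb hF => ?_⟩
  rw [mul_assoc]
  exact (L.le_opNorm _).trans (mul_le_mul_of_nonneg_left (hT F b hb hF) (norm_nonneg _))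

end Multiplication

/-! ### Uniqueness and multiplicativity of the smooth calculus -/

section Calculus

variable {A : Type*} [CStarAlgebra A] {h : A} {m : ℕ} {U : Set ℝ}

theorem expFun_apply (ξ x : Fin m → ℝ) : (expFun U ξ).1 x
    = ∏ l, Complex.exp (ξ l • (2 * Real.pi * Complex.I * x l)) := Complex.exp_sum _ _

theorem contDiff_exp_one (s : ℝ) :
    ContDiff ℝ ∞ fun t : ℝ => Complex.exp (s • (2 * Real.pi * Complex.I * t)) :=
  Complex.contDiff_exp.comp (ContDiff.const_smul _
    (contDiff_const.mul Complex.ofRealCLM.contDiff))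

theorem IsSmoothCalculus.apply_eq {Ψ : SmoothOn m U →ₗ[ℂ] ProjTensor ℂ A m}
    (hΨ : IsSmoothCalculus h U Ψ) {f : Fin m → ℝ → ℂ} (hf : ∀ i, ContDiffOn ℝ ∞ (f i) U)
    (F : SmoothOn m U) (hF : ∀ x ∈ cube m U, F.1 x = ∏ i, f i (x i)) :
    Ψ F = elemTensor ℂ fun i => fc h (f i) := hΨ.map_elemTensor f hf F hF

theorem IsSmoothCalculus.unique (hU : IsOpen U) {Ψ Ψ' : SmoothOn m U →ₗ[ℂ] ProjTensor ℂ A m}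
    (hΨ : IsSmoothCalculus h U Ψ) (hΨ' : IsSmoothCalculus h U Ψ') : Ψ = Ψ' := by
  refine IsSmoothContinuous.ext_expFun hU hΨ.continuous hΨ'.continuous fun ξ => ?_
  rw [hΨ.apply_eq (fun i => (contDiff_exp_one (ξ i)).contDiffOn) _ fun x _ => expFun_apply ξ x,
    hΨ'.apply_eq (fun i => (contDiff_exp_one (ξ i)).contDiffOn) _ fun x _ => expFun_apply ξ x]

/-- The smooth calculus turns multiplication by a function of the first variable into
multiplication by an element of the first slot. -/
theorem IsSmoothCalculus.slot_mul (hU : IsOpen U)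
    {Ψ : SmoothOn (m + 1) U →ₗ[ℂ] ProjTensor ℂ A (m + 1)} (hΨ : IsSmoothCalculus h U Ψ)
    {f : ℝ → ℂ} (hf : ContDiff ℝ ∞ f) (F G : SmoothOn (m + 1) U)
    (hG : ∀ x ∈ cube (m + 1) U, G.1 x = f (x 0) * F.1 x) :
    slot ℂ 0 (fc h f) * Ψ F = Ψ G := by
  let φ : SmoothOn (m + 1) U := ⟨fun x => f (x 0), (hf.comp (contDiff_apply ℝ ℝ 0)).contDiffOn⟩
  let L := ContinuousLinearMap.mul ℂ (ProjTensor ℂ A (m + 1)) (slot ℂ 0 (fc h f))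
  have hΨc : IsSmoothContinuous Ψ := hΨ.continuous
  have key : L.toLinearMap ∘ₗ Ψ = Ψ ∘ₗ mulSmooth φ := by
    refine IsSmoothContinuous.ext_expFun hU (hΨc.clm_comp L) (hΨc.comp_mulSmooth hU φ)
      fun ξ => ?_
    change slot ℂ 0 (fc h f) * Ψ (expFun U ξ) = Ψ (mulSmooth φ (expFun U ξ))
    rw [hΨ.apply_eq (fun i => (contDiff_exp_one (ξ i)).contDiffOn) _ fun x _ => expFun_apply ξ x,
      slot_mul_elemTensor]
    -- An exponential times a function of the first variable is again an elementary tensor, with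
    -- only factor `0` altered.
    let g : Fin (m + 1) → ℝ → ℂ := fun i t =>
      (Fin.cons (α := fun _ => ℂ) (f t) (fun _ => 1) i)
        * Complex.exp (ξ i • (2 * Real.pi * Complex.I * t))
    have hg : ∀ i, ContDiff ℝ ∞ (g i) := by
      intro i
      refine Fin.cases ?_ (fun j => ?_) i
      · exact hf.mul (contDiff_exp_one _)
      · exact contDiff_const.mul (contDiff_exp_one _)
    rw [hΨ.apply_eq (f := g) (fun i => (hg i).contDiffOn)]
    · congr 1
      ext i
      refine Fin.cases ?_ (fun j => ?_) i
      · rw [Fin.cons_zero, fc_mul hf.continuous (contDiff_exp_one _).continuous]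
        rfl
      · simp [g, Fin.tail]
    · intro x _
      change f (x 0) * (expFun U ξ).1 x = _
      rw [expFun_apply, Finset.prod_mul_distrib]
      congr 1
      rw [Fin.prod_univ_succ]
      simp
  have h1 : slot ℂ 0 (fc h f) * Ψ F = Ψ (mulSmooth φ F) := LinearMap.congr_fun key F
  rw [h1, ← sub_eq_zero, ← map_sub]
  obtain ⟨K, N, C, -, hKW, hT⟩ := hΨc
  -- The two representatives may differ outside the cube, where values are irrelevant; on it their
  -- difference has zero derivatives.
  have h2 := hT (mulSmooth φ F - G) 0 le_rfl fun j _ x hx => by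
    have e : EqOn (mulSmooth φ F - G).1 (fun _ => 0) (cube (m + 1) U) := fun y hy => by
      change f (y 0) * F.1 y - G.1 y = 0
      rw [hG y hy, sub_self]
    rw [iteratedFDerivWithin_congr e (hKW hx)]
    simp
  rwa [mul_zero, norm_le_zero_iff] at h2

end Calculus

/-! ### Existence of the smooth calculus -/

section Existence

open scoped SchwartzMap FourierTransform

variable {A : Type*} [CStarAlgebra A] {h : A} {m : ℕ} {U : Set ℝ}

/-- The unitary element `exp (2πi s h)`. -/
def fcExp (h : A) (s : ℝ) : A := fc h fun t => Complex.exp (s • (2 * Real.pi * Complex.I * t))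

theorem norm_fcExp_le (hh : IsSelfAdjoint h) (s : ℝ) : ‖fcExp h s‖ ≤ 1 :=
  norm_fc_le hh zero_le_one fun t _ => by
    rw [Complex.norm_exp]
    simp

theorem continuous_fcExp : Continuous (fcExp h) := continuous_fc (by fun_prop)

theorem norm_elemTensor_fcExp_le (hh : IsSelfAdjoint h) (ξ : Fin m → ℝ) :
    ‖elemTensor ℂ fun l => fcExp h (ξ l)‖ ≤ 1 :=
  (norm_elemTensor_le _).trans
    (Finset.prod_le_one (fun _ _ => norm_nonneg _) fun _ _ => norm_fcExp_le hh _)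

theorem integrable_fourierCalculus (hh : IsSelfAdjoint h) (G : 𝓢(Fin m → ℝ, ℂ)) :
    Integrable fun ξ => piFourier m G ξ • elemTensor ℂ fun l => fcExp h (ξ l) := by
  refine (piFourier m G).integrable.norm.mono' ?_ (.of_forall fun ξ => ?_)
  · refine Continuous.aestronglyMeasurable ((piFourier m G).continuous.smul ?_)
    exact continuous_elemTensor.comp
      (continuous_pi fun l => continuous_fcExp.comp (continuous_apply l))
  · rw [norm_smul]
    exact mul_le_of_le_one_right (norm_nonneg _) (norm_elemTensor_fcExp_le hh ξ)

/-- The functional calculus of Schwartz functions through their Fourier transform. -/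
def fourierCalculus (hh : IsSelfAdjoint h) (m : ℕ) : 𝓢(Fin m → ℝ, ℂ) →ₗ[ℂ] ProjTensor ℂ A m where
  toFun G := ∫ ξ, piFourier m G ξ • elemTensor ℂ fun l => fcExp h (ξ l)
  map_add' G G' := by
    rw [← integral_add (integrable_fourierCalculus hh G) (integrable_fourierCalculus hh G')]
    simp_rw [map_add, add_apply, add_smul]
  map_smul' c G := by
    rw [RingHom.id_apply, ← integral_smul]
    simp_rw [map_smul, smul_apply, smul_assoc]

theorem fourierCalculus_apply (hh : IsSelfAdjoint h) (G : 𝓢(Fin m → ℝ, ℂ)) :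
    fourierCalculus hh m G = ∫ ξ, piFourier m G ξ • elemTensor ℂ fun l => fcExp h (ξ l) := rfl

theorem norm_fourierCalculus_le (hh : IsSelfAdjoint h) (G : 𝓢(Fin m → ℝ, ℂ)) :
    ‖fourierCalculus hh m G‖ ≤ ‖(piFourier m G).toLp 1 volume‖ := by
  rw [SchwartzMap.norm_toLp_one]
  refine norm_integral_le_of_norm_le (piFourier m G).integrable.norm (.of_forall fun ξ => ?_)
  rw [norm_smul]
  exact mul_le_of_le_one_right (norm_nonneg _) (norm_elemTensor_fcExp_le hh ξ)

/-- The `L¹` norm of the Fourier transform is a continuous seminorm on Schwartz space, so finitely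
many Schwartz seminorms dominate it. For functions supported in a compact set, the polynomial
weights in these are bounded. -/
theorem exists_norm_fourierCalculus_le (hh : IsSelfAdjoint h) {K : Set (Fin m → ℝ)}
    (hK : IsCompact K) : ∃ (N : ℕ) (C : ℝ), 0 ≤ C ∧ ∀ (G : 𝓢(Fin m → ℝ, ℂ)) (b : ℝ), 0 ≤ b →
      tsupport G ⊆ K → (∀ j ≤ N, ∀ x ∈ K, ‖iteratedFDeriv ℝ j G x‖ ≤ b) →
      ‖fourierCalculus hh m G‖ ≤ C * b := by
  let T := (SchwartzMap.toLpCLM ℂ ℂ 1 (volume : Measure (Fin m → ℝ))).comp (piFourier m)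
  let q : Seminorm ℂ 𝓢(Fin m → ℝ, ℂ) := (normSeminorm ℂ _).comp T.toLinearMap
  have hq : Continuous q := continuous_norm.comp T.continuous
  obtain ⟨s, C, -, hC⟩ := Seminorm.bound_of_continuous
    (schwartz_withSeminorms ℂ (Fin m → ℝ) ℂ) q hq
  obtain ⟨R, hR⟩ := hK.isBounded.exists_norm_le
  let R' := max R 1
  let k := s.sup Prod.fst
  refine ⟨s.sup Prod.snd, C * R' ^ k, by positivity, fun G b hb hs hG => ?_⟩
  refine (norm_fourierCalculus_le hh G).trans ((hC G).trans ?_)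
  rw [mul_assoc]
  refine mul_le_mul_of_nonneg_left ?_ C.2
  refine Seminorm.finset_sup_apply_le (by positivity) fun p hp => ?_
  refine SchwartzMap.seminorm_le_bound ℂ _ _ _ (by positivity) fun x => ?_
  by_cases hx : x ∈ K
  · have h1 : ‖x‖ ^ p.1 ≤ R' ^ k :=
      (pow_le_pow_left₀ (norm_nonneg _) ((hR x hx).trans (le_max_left _ _)) _).trans
        (pow_le_pow_right₀ (le_max_right _ _) (Finset.le_sup (f := Prod.fst) hp))
    exact mul_le_mul h1 (hG _ (Finset.le_sup (f := Prod.snd) hp) x hx) (norm_nonneg _)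
      (by positivity)
  · have h0 : iteratedFDeriv ℝ p.2 G x = 0 := by
      by_contra hne
      exact hx (hs (support_iteratedFDeriv_subset p.2 hne))
    rw [h0, norm_zero, mul_zero]
    positivity

/-- The smooth calculus of an elementary tensor of Schwartz functions. -/
theorem fourierCalculus_prod (hh : IsSelfAdjoint h) (g : Fin m → 𝓢(ℝ, ℂ)) (G : 𝓢(Fin m → ℝ, ℂ))
    (hG : ∀ x, G x = ∏ i, g i (x i)) :
    fourierCalculus hh m G = elemTensor ℂ fun i => fc h (g i) := by
  -- Characters factor over coordinates, so the transform of a product function is the product of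
  -- the transforms.
  have h1 : ∀ ξ, piFourier m G ξ = ∏ i, 𝓕 (g i) (ξ i) := by
    intro ξ
    rw [piFourier_apply]
    have : ∀ x : Fin m → ℝ,
        Complex.exp (-∑ l, ξ l • (2 * Real.pi * Complex.I * x l)) * G x
          = ∏ l, Complex.exp (-(ξ l • (2 * Real.pi * Complex.I * x l))) * g l (x l) := by
      intro x
      rw [hG, ← Finset.sum_neg_distrib, Complex.exp_sum, Finset.prod_mul_distrib]
    simp_rw [this]
    rw [integral_fintype_prod_volume_eq_prod
      (fun l (t : ℝ) => Complex.exp (-(ξ l • (2 * Real.pi * Complex.I * t))) * g l t)]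
    refine Finset.prod_congr rfl fun l _ => ?_
    rw [SchwartzMap.fourier_coe, Real.fourier_eq']
    refine integral_congr_ae (.of_forall fun t => ?_)
    simp only [smul_eq_mul]
    congr 2
    simp
    ring
  -- One-variable Fourier inversion, performed under the functional calculus of `h`.
  have h2 : ∀ i, Integrable (fun s => 𝓕 (g i) s • fcExp h s) ∧
      ∫ s, 𝓕 (g i) s • fcExp h s = fc h (g i) := by
    intro i
    have h3 := integrableOn_fc hh (μ := (volume : Measure ℝ)) MeasurableSet.univ
      (F := fun (s : ℝ) (t : ℝ) => 𝓕 (g i) s * Complex.exp (s • (2 * Real.pi * Complex.I * t)))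
      (by
        have := (𝓕 (g i)).continuous
        fun_prop) (b := fun s => ‖𝓕 (g i) s‖)
      (𝓕 (g i)).integrable.norm.integrableOn (fun s _ t _ => by
        rw [norm_mul, Complex.norm_exp]
        simp)
    have h4 : ∀ s, fc h (fun t => 𝓕 (g i) s * Complex.exp (s • (2 * Real.pi * Complex.I * t)))
        = 𝓕 (g i) s • fcExp h s := fun s => fc_smul _ (contDiff_exp_one s).continuous
    simp only [h4, integrableOn_univ, Measure.restrict_univ] at h3
    refine ⟨h3.1, h3.2.trans (fc_congr hh fun t _ => ?_)⟩
    have h5 : 𝓕⁻ (𝓕 (g i : ℝ → ℂ)) t = g i t :=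
      (g i).integrable.fourierInv_fourier_eq (𝓕 (g i)).integrable (g i).continuous.continuousAt
    rw [← h5, Real.fourierInv_eq']
    refine integral_congr_ae (.of_forall fun s => ?_)
    simp only [smul_eq_mul]
    rw [mul_comm]
    congr 2
    simp
    ring
  rw [fourierCalculus_apply]
  have h6 := integral_multilinear (elemTensorL ℂ A m) fun i => (h2 i).1
  simp only [elemTensorL_apply, (h2 _).2] at h6
  rw [← h6]
  refine integral_congr_ae (.of_forall fun ξ => ?_)
  simp only [h1]
  exact ((elemTensorL ℂ A m).map_smul_univ (fun i => 𝓕 (g i) (ξ i)) _).symm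

theorem exists_isSmoothCalculus (hh : IsSelfAdjoint h) (hU : IsOpen U) (hspec : spectrum ℝ h ⊆ U)
    (m : ℕ) : ∃ Ψ : SmoothOn m U →ₗ[ℂ] ProjTensor ℂ A m, IsSmoothCalculus h U Ψ := by
  obtain ⟨χ, hχ, hχc, hχU, hχ1⟩ := exists_smooth_cutoff (spectrum.isCompact (𝕜 := ℝ) h) hU hspec
  have hW := isOpen_cube hU m
  -- A product cutoff keeps elementary tensors elementary, so `fourierCalculus_prod` applies to
  -- them; each factor is `1` on the spectrum and does not change `f_i(h)`.
  let X : (Fin m → ℝ) → ℝ := fun x => ∏ i, χ (x i)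
  let K : Set (Fin m → ℝ) := Set.univ.pi fun _ => tsupport χ
  have hK : IsCompact K := isCompact_univ_pi fun _ => hχc
  have hKW : K ⊆ cube m U := Set.pi_mono fun _ _ => hχU
  have hX : ContDiff ℝ ∞ X := contDiff_prod fun i _ => hχ.comp (contDiff_apply ℝ ℝ i)
  have hXs : tsupport X ⊆ K := by
    refine closure_minimal (fun x hx i _ => subset_tsupport _ fun h0 => hx ?_) hK.isClosed
    exact Finset.prod_eq_zero (Finset.mem_univ i) h0
  have hXc : HasCompactSupport X := hK.of_isClosed_subset (isClosed_tsupport _) hXs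
  let S : SmoothOn m U →ₗ[ℂ] 𝓢(Fin m → ℝ, ℂ) :=
    { toFun := fun F => (hasCompactSupport_cutoff_mul hXc F.1).toSchwartzMap
        (contDiff_cutoff_mul hX hW (hXs.trans hKW) F.2)
      map_add' := fun F G => by
        ext x
        exact mul_add _ _ _
      map_smul' := fun c F => by
        ext x
        exact mul_left_comm _ _ _ }
  have hS : ∀ F x, S F x = (X x : ℂ) * F.1 x := fun _ _ => rfl
  refine ⟨fourierCalculus hh m ∘ₗ S, ⟨?_, ?_⟩⟩
  · obtain ⟨N, C, hC0, hC⟩ := exists_norm_fourierCalculus_le hh hK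
    obtain ⟨M, hM0, hM⟩ := exists_norm_iteratedFDerivWithin_mul_le hW hK hKW
      (φ := fun x => (X x : ℂ)) (Complex.ofRealCLM.contDiff.comp hX).contDiffOn N
    refine ⟨K, N, C * M, hK, hKW, fun F b hb hF => ?_⟩
    rw [mul_assoc]
    refine hC (S F) (M * b) (mul_nonneg hM0 hb) ?_ fun j hj x hx => ?_
    · refine (closure_mono fun x hx => ?_).trans hXs
      intro h0
      apply hx
      rw [hS, h0, Complex.ofReal_zero, zero_mul]
    · rw [← iteratedFDerivWithin_of_isOpen j hW (hKW hx)]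
      exact hM F.1 F.2 b hb hF j hj x hx
  · intro f hf F hF
    let g : Fin m → 𝓢(ℝ, ℂ) := fun i => (hasCompactSupport_cutoff_mul hχc (f i)).toSchwartzMap
      (contDiff_cutoff_mul hχ hU hχU (hf i))
    have hg : ∀ i t, g i t = (χ t : ℂ) * f i t := fun _ _ => rfl
    change fourierCalculus hh m (S F) = elemTensor ℂ fun i => fc h (f i)
    rw [fourierCalculus_prod hh g (S F)]
    · congr 1
      ext i
      refine fc_congr hh fun t ht => ?_
      rw [hg, hχ1.self_of_nhdsSet t ht, Complex.ofReal_one, one_mul]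
    · intro x
      rw [hS]
      simp only [hg]
      rw [Finset.prod_mul_distrib]
      by_cases hx : x ∈ cube m U
      · rw [hF x hx]
        simp [X]
      · have h0 : X x = 0 := by
          by_contra hne
          exact hx (hKW (hXs (subset_tsupport _ hne)))
        have h0' : ∏ i, (χ (x i) : ℂ) = 0 := by
          rw [← Complex.ofReal_prod]
          exact_mod_cast h0
        rw [h0, h0']
        simp

end Existence

/-! ### Fourier inversion for multilinear convolutions -/

section Convolution

variable {A : Type*} [NormedAddCommGroup A] [NormedSpace ℂ A]
  {B : Type*} [NormedAddCommGroup B] [NormedSpace ℂ B] {n : ℕ}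

/-- The convolution of `n + 1` functions on `ℝ`, with a multilinear map as product. -/
def multiConv (M : ContinuousMultilinearMap ℂ (fun _ : Fin (n + 1) => A) B)
    (φ : Fin (n + 1) → ℝ → A) (s : ℝ) : B :=
  ∫ u : Fin n → ℝ, M (Fin.cons (φ 0 (s - ∑ l, u l)) fun l => φ l.succ (u l))

/-- A proper affine subspace, since it misses the origin. It carries the only discontinuity of the
convolution integrand at `s = 1`. -/
theorem volume_sum_eq_one : volume {u : Fin n → ℝ | ∑ l, u l = 1} = 0 := by
  let f : (Fin n → ℝ) →ₗ[ℝ] ℝ := ∑ l, LinearMap.proj l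
  have hf : ∀ u, f u = ∑ l, u l := fun u => by simp [f]
  let S : AffineSubspace ℝ (Fin n → ℝ) :=
    (AffineSubspace.mk' (1 : ℝ) (⊥ : Submodule ℝ ℝ)).comap f.toAffineMap
  have hS : ∀ u, u ∈ S ↔ ∑ l, u l = 1 := by
    intro u
    change f u ∈ AffineSubspace.mk' (1 : ℝ) (⊥ : Submodule ℝ ℝ) ↔ _
    rw [AffineSubspace.mem_mk', hf, vsub_eq_sub, Submodule.mem_bot, sub_eq_zero]
  have h1 : S ≠ ⊤ := by
    intro h
    have : (0 : Fin n → ℝ) ∈ S := h ▸ AffineSubspace.mem_top ..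
    rw [hS] at this
    simp at this
  convert Measure.addHaar_affineSubspace volume S h1 using 2
  ext u
  exact (hS u).symm

theorem measurePreserving_sub_sum : MeasurePreserving
    (fun p : (Fin n → ℝ) × ℝ => (p.1, p.2 - ∑ l, p.1 l))
    ((volume : Measure (Fin n → ℝ)).prod (volume : Measure ℝ))
    ((volume : Measure (Fin n → ℝ)).prod (volume : Measure ℝ)) :=
  MeasurePreserving.skew_product (g := fun (u : Fin n → ℝ) (s : ℝ) => s - ∑ l, u l)
    (MeasurePreserving.id _)
    (Continuous.measurable (by fun_prop)) (.of_forall fun u =>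
      (measurePreserving_sub_right volume (∑ l, u l)).map_eq)

variable (M : ContinuousMultilinearMap ℂ (fun _ : Fin (n + 1) => A) B)
  {φ : Fin (n + 1) → ℝ → A}

theorem integrable_multilinear_cons (hφ : ∀ i, Integrable (φ i)) :
    Integrable (fun p : (Fin n → ℝ) × ℝ => M (Fin.cons (φ 0 p.2) fun l => φ l.succ (p.1 l)))
      ((volume : Measure (Fin n → ℝ)).prod (volume : Measure ℝ)) := by
  have e := (volume_preserving_piFinSuccAbove (fun _ : Fin (n + 1) => ℝ) 0).symm
  have hi := integrable_multilinear M hφ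
  rw [← e.integrable_comp_emb (MeasurableEquiv.measurableEmbedding _)] at hi
  refine (Integrable.swap (by exact hi)).congr (.of_forall fun p => ?_)
  refine congrArg M (funext fun i => ?_)
  refine Fin.cases ?_ (fun j => ?_) i <;> simp [Fin.insertNthEquiv]

theorem integral_multilinear_cons [CompleteSpace A] [CompleteSpace B]
    (hφ : ∀ i, Integrable (φ i)) :
    ∫ p : (Fin n → ℝ) × ℝ, M (Fin.cons (φ 0 p.2) fun l => φ l.succ (p.1 l))
      ∂((volume : Measure (Fin n → ℝ)).prod (volume : Measure ℝ)) = M fun i => ∫ t, φ i t := by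
  have e := (volume_preserving_piFinSuccAbove (fun _ : Fin (n + 1) => ℝ) 0).symm
  rw [← integral_multilinear M hφ, ← e.integral_comp', Measure.volume_eq_prod,
    ← integral_prod_swap]
  refine integral_congr_ae (.of_forall fun p => ?_)
  refine congrArg M (funext fun i => ?_)
  refine Fin.cases ?_ (fun j => ?_) i <;> simp [Fin.insertNthEquiv]

theorem integrable_multilinear_sub (hφ : ∀ i, Integrable (φ i)) :
    Integrable (fun p : (Fin n → ℝ) × ℝ =>
      M (Fin.cons (φ 0 (p.2 - ∑ l, p.1 l)) fun l => φ l.succ (p.1 l)))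
      ((volume : Measure (Fin n → ℝ)).prod (volume : Measure ℝ)) :=
  measurePreserving_sub_sum.integrable_comp_of_integrable (integrable_multilinear_cons M hφ)

theorem integrable_multiConv (hφ : ∀ i, Integrable (φ i)) : Integrable (multiConv M φ) :=
  (integrable_multilinear_sub M hφ).integral_prod_right

theorem integral_multiConv [CompleteSpace A] [CompleteSpace B] (hφ : ∀ i, Integrable (φ i)) :
    ∫ s, multiConv M φ s = M fun i => ∫ t, φ i t := by
  rw [← integral_multilinear_cons M hφ]
  have h1 := integral_prod_symm _ (integrable_multilinear_sub M hφ)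
  refine h1.symm.trans ?_
  have emb : MeasurableEmbedding fun p : (Fin n → ℝ) × ℝ => (p.1, p.2 - ∑ l, p.1 l) :=
    (Homeomorph.measurableEmbedding
      { toFun := fun p : (Fin n → ℝ) × ℝ => (p.1, p.2 - ∑ l, p.1 l)
        invFun := fun p : (Fin n → ℝ) × ℝ => (p.1, p.2 + ∑ l, p.1 l)
        left_inv := fun p => by simp
        right_inv := fun p => by simp
        continuous_toFun := by fun_prop
        continuous_invFun := by fun_prop })
  exact measurePreserving_sub_sum.integral_comp emb
    (fun p : (Fin n → ℝ) × ℝ => M (Fin.cons (φ 0 p.2) fun l => φ l.succ (p.1 l)))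

/-- The character at `s = (s - ∑ u_l) + ∑ u_l` splits into one factor per argument. Absorbing these
into the functions reduces the transform to the total integral of a convolution. -/
theorem fourier_multiConv [CompleteSpace A] [CompleteSpace B] (hφ : ∀ i, Integrable (φ i)) (ξ : ℝ) :
    𝓕 (multiConv M φ) ξ = M fun i => 𝓕 (φ i) ξ := by
  let ψ : Fin (n + 1) → ℝ → A := fun i t =>
    Complex.exp (↑(-2 * Real.pi * t * ξ) * Complex.I) • φ i t
  have hψ : ∀ i, Integrable (ψ i) := by
    intro i
    refine (hφ i).norm.mono' ?_ (.of_forall fun t => ?_)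
    · exact (Continuous.aestronglyMeasurable (by fun_prop)).smul (hφ i).1
    · rw [norm_smul, Complex.norm_exp_ofReal_mul_I, one_mul]
  have h1 : ∀ s, Complex.exp (↑(-2 * Real.pi * s * ξ) * Complex.I) • multiConv M φ s
      = multiConv M ψ s := by
    intro s
    rw [multiConv, multiConv, ← integral_smul]
    refine integral_congr_ae (.of_forall fun u => ?_)
    let c : Fin (n + 1) → ℂ := Fin.cons
      (Complex.exp (↑(-2 * Real.pi * (s - ∑ l, u l) * ξ) * Complex.I))
      fun l => Complex.exp (↑(-2 * Real.pi * u l * ξ) * Complex.I)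
    have e : (Fin.cons (ψ 0 (s - ∑ l, u l)) fun l => ψ l.succ (u l) : Fin (n + 1) → A)
        = fun i => c i • (Fin.cons (φ 0 (s - ∑ l, u l)) fun l => φ l.succ (u l) :
          Fin (n + 1) → A) i := by
      funext i
      refine Fin.cases ?_ (fun j => ?_) i <;> simp [c, ψ]
    have hc : ∏ i, c i = Complex.exp (↑(-2 * Real.pi * s * ξ) * Complex.I) := by
      rw [Fin.prod_univ_succ]
      simp only [c, Fin.cons_zero, Fin.cons_succ]
      rw [← Complex.exp_sum, ← Complex.exp_add]
      congr 1
      push_cast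
      rw [← Finset.sum_mul, ← Finset.sum_mul, ← Finset.mul_sum]
      ring
    change _ = M _
    rw [e, M.map_smul_univ, hc]
  rw [Real.fourier_real_eq_integral_exp_smul]
  simp_rw [h1]
  rw [integral_multiConv M hψ]
  refine congrArg M (funext fun i => ?_)
  rw [Real.fourier_real_eq_integral_exp_smul]

/-- Only the first function depends on `s`. Its possible jump at `0` is met at `s = 1` only on the
null hyperplane `∑ u_l = 1`, so dominated convergence applies. -/
theorem continuousAt_multiConv (hφ : ∀ i, Integrable (φ i)) (hm : StronglyMeasurable (φ 0))
    {C : ℝ} (hC : ∀ t, ‖φ 0 t‖ ≤ C)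
    (hcont : ∀ t ≠ 0, ContinuousAt (φ 0) t) : ContinuousAt (multiConv M φ) 1 := by
  have hm' : ∀ s : ℝ, AEStronglyMeasurable
      (fun u : Fin n → ℝ => M (Fin.cons (φ 0 (s - ∑ l, u l)) fun l => φ l.succ (u l))) := by
    refine fun s => M.cont.comp_aestronglyMeasurable (aestronglyMeasurable_pi fun i => ?_)
    refine Fin.cases ?_ (fun j => ?_) i
    · exact (hm.comp_measurable (Continuous.measurable (by fun_prop))).aestronglyMeasurable
    · exact (hφ j.succ).1.comp_quasiMeasurePreserving (Measure.quasiMeasurePreserving_eval _ j)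
  refine continuousAt_of_dominated (bound := fun u => ‖M‖ * (C * ∏ l, ‖φ l.succ (u l)‖))
    (.of_forall hm') (.of_forall fun s => .of_forall fun u => ?_) ?_ ?_
  · refine (M.le_opNorm _).trans ?_
    rw [Fin.prod_univ_succ]
    simp only [Fin.cons_zero, Fin.cons_succ]
    gcongr
    exact hC _
  · exact ((Integrable.fintype_prod (f := fun l t => ‖φ (Fin.succ l) t‖)
      fun i => (hφ i.succ).norm).const_mul _).const_mul _
  · have h0 : ∀ᵐ u : Fin n → ℝ, ¬ ∑ l, u l = 1 := by
      rw [ae_iff]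
      simpa using volume_sum_eq_one (n := n)
    filter_upwards [h0] with u hu
    refine M.cont.continuousAt.comp ?_
    refine continuousAt_pi.2 fun i => ?_
    refine Fin.cases ?_ (fun j => ?_) i
    · simp only [Fin.cons_zero]
      have := hcont (1 - ∑ l, u l) (sub_ne_zero.2 (Ne.symm hu))
      exact ContinuousAt.comp (f := fun s : ℝ => s - ∑ l, u l) this (by fun_prop)
    · simpa using continuousAt_const

/-- Fourier inversion for a multilinear convolution, at the point `1`. -/
theorem integral_multilinear_fourier [CompleteSpace A] [CompleteSpace B]
    (hφ : ∀ i, Integrable (φ i)) (hm : StronglyMeasurable (φ 0)) {C : ℝ}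
    (hC : ∀ t, ‖φ 0 t‖ ≤ C) (hcont : ∀ t ≠ 0, ContinuousAt (φ 0) t)
    (hF : Integrable fun ξ : ℝ => M fun i => 𝓕 (φ i) ξ) :
    ∫ ξ : ℝ, Complex.exp (↑(2 * Real.pi * ξ) * Complex.I) • M (fun i => 𝓕 (φ i) ξ)
      = multiConv M φ 1 := by
  have e : 𝓕 (multiConv M φ) = fun ξ => M fun i => 𝓕 (φ i) ξ :=
    funext fun ξ => fourier_multiConv M hφ ξ
  rw [← (integrable_multiConv M hφ).fourierInv_fourier_eq (by rwa [e])
    (continuousAt_multiConv M hφ hm hC hcont), Real.fourierInv_eq', e]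
  simp

end Convolution

/-! ### The Gamma integral with a complex rate -/

section GammaIntegral

/-- Half of the exponential absorbs the power, by `(ct/2)^m / m! ≤ e^{ct/2}`. -/
theorem pow_mul_exp_neg_le {c t : ℝ} (hc : 0 < c) (ht : 0 ≤ t) (m : ℕ) :
    t ^ m * Real.exp (-(c * t)) ≤ m.factorial * (2 / c) ^ m * Real.exp (-(c / 2 * t)) := by
  have h1 := Real.pow_div_factorial_le_exp (c / 2 * t) (by positivity) m
  rw [div_le_iff₀ (by positivity)] at h1
  have h2 : t ^ m = (2 / c) ^ m * (c / 2 * t) ^ m := by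
    rw [← mul_pow]
    congr 1
    field_simp
  have h3 : Real.exp (-(c * t)) = Real.exp (-(c / 2 * t)) * Real.exp (-(c / 2 * t)) := by
    rw [← Real.exp_add]
    ring_nf
  rw [h2, h3]
  calc (2 / c) ^ m * (c / 2 * t) ^ m * (Real.exp (-(c / 2 * t)) * Real.exp (-(c / 2 * t)))
      ≤ (2 / c) ^ m * (Real.exp (c / 2 * t) * m.factorial)
          * (Real.exp (-(c / 2 * t)) * Real.exp (-(c / 2 * t))) := by gcongr
    _ = m.factorial * (2 / c) ^ m * Real.exp (-(c / 2 * t))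
          * (Real.exp (c / 2 * t) * Real.exp (-(c / 2 * t))) := by ring
    _ = _ := by rw [← Real.exp_add, add_neg_cancel, Real.exp_zero, mul_one]

theorem integrableOn_pow_mul_exp_neg {c : ℝ} (hc : 0 < c) (m : ℕ) :
    IntegrableOn (fun t : ℝ => t ^ m * Real.exp (-(c * t))) (Ioi 0) := by
  have h1 := (exp_neg_integrableOn_Ioi 0 (half_pos hc)).const_mul (m.factorial * (2 / c) ^ m)
  refine Integrable.mono' h1 (Continuous.aestronglyMeasurable (by fun_prop))
    (ae_restrict_of_forall_mem measurableSet_Ioi fun t ht => ?_)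
  have ht' : 0 ≤ t := le_of_lt ht
  rw [Real.norm_of_nonneg (by positivity), neg_mul]
  exact pow_mul_exp_neg_le hc ht' m

theorem norm_pow_mul_cexp_neg {c : ℂ} {t : ℝ} (ht : 0 ≤ t) (m : ℕ) :
    ‖((t ^ m : ℝ) : ℂ) * Complex.exp (-(c * t))‖ = t ^ m * Real.exp (-(c.re * t)) := by
  rw [norm_mul, Complex.norm_exp, Complex.norm_real, Real.norm_of_nonneg (by positivity)]
  simp

theorem integrableOn_pow_mul_cexp_neg {c : ℂ} (hc : 0 < c.re) (m : ℕ) :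
    IntegrableOn (fun t : ℝ => ((t ^ m : ℝ) : ℂ) * Complex.exp (-(c * t))) (Ioi 0) :=
  Integrable.mono' (integrableOn_pow_mul_exp_neg hc m)
    (Continuous.aestronglyMeasurable (by fun_prop))
    (ae_restrict_of_forall_mem measurableSet_Ioi fun _ ht =>
      (norm_pow_mul_cexp_neg (le_of_lt ht) m).le)

theorem tendsto_pow_mul_cexp_neg {c : ℂ} (hc : 0 < c.re) (m : ℕ) :
    Tendsto (fun t : ℝ => ((t ^ m : ℝ) : ℂ) * Complex.exp (-(c * t))) atTop (𝓝 0) := by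
  have h1 : Tendsto (fun t : ℝ => m.factorial * (2 / c.re) ^ m * Real.exp (-(c.re / 2 * t)))
      atTop (𝓝 (m.factorial * (2 / c.re) ^ m * 0)) := by
    refine Tendsto.const_mul _ (Real.tendsto_exp_neg_atTop_nhds_zero.comp ?_)
    exact tendsto_id.const_mul_atTop (half_pos hc)
  rw [mul_zero] at h1
  refine squeeze_zero_norm' ?_ h1
  filter_upwards [eventually_ge_atTop 0] with t ht
  rw [norm_pow_mul_cexp_neg ht]
  exact pow_mul_exp_neg_le hc ht m

/-- Integration by parts in `t`, by induction on `m`; the boundary terms vanish at infinity because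
`Re c > 0`. -/
theorem integral_pow_mul_cexp_neg {c : ℂ} (hc : 0 < c.re) (m : ℕ) :
    ∫ t in Ioi (0 : ℝ), ((t ^ m : ℝ) : ℂ) * Complex.exp (-(c * t))
      = m.factorial * (c⁻¹) ^ (m + 1) := by
  have hc0 : c ≠ 0 := fun h => by simp [h] at hc
  have hexp : ∀ t : ℝ, HasDerivAt (fun t : ℝ => Complex.exp (-(c * t)))
      (Complex.exp (-(c * t)) * -(c * 1)) t := fun t =>
    ((Complex.ofRealCLM.hasDerivAt.const_mul c).neg).cexp
  induction m with
  | zero =>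
    have h1 := integral_Ioi_of_hasDerivAt_of_tendsto (a := 0) (m := 0)
      (f := fun t : ℝ => -c⁻¹ * Complex.exp (-(c * t)))
      (f' := fun t : ℝ => ((t ^ 0 : ℝ) : ℂ) * Complex.exp (-(c * t)))
      (Continuous.continuousWithinAt (by fun_prop)) (fun t _ => by
        convert! (hexp t).const_mul (-c⁻¹) using 1
        push_cast
        field_simp) (integrableOn_pow_mul_cexp_neg hc 0) (by
        have := (tendsto_pow_mul_cexp_neg hc 0).const_mul (-c⁻¹)
        simpa using this)
    rw [h1]
    simp
  | succ m ih =>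
    have h1 := integral_Ioi_of_hasDerivAt_of_tendsto (a := 0) (m := 0)
      (f := fun t : ℝ => ((t ^ (m + 1) : ℝ) : ℂ) * Complex.exp (-(c * t)))
      (f' := fun t : ℝ => (m + 1) * (((t ^ m : ℝ) : ℂ) * Complex.exp (-(c * t)))
        - c * (((t ^ (m + 1) : ℝ) : ℂ) * Complex.exp (-(c * t))))
      (Continuous.continuousWithinAt (by fun_prop)) (fun t _ => by
        convert! ((hasDerivAt_pow (m + 1) t).ofReal_comp).mul (hexp t) using 1
        push_cast
        simp
        ring)
      (((integrableOn_pow_mul_cexp_neg hc m).const_mul _).sub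
        ((integrableOn_pow_mul_cexp_neg hc (m + 1)).const_mul _))
      (tendsto_pow_mul_cexp_neg hc (m + 1))
    rw [integral_sub ((integrableOn_pow_mul_cexp_neg hc m).const_mul _)
      ((integrableOn_pow_mul_cexp_neg hc (m + 1)).const_mul _), integral_const_mul,
      integral_const_mul, ih] at h1
    simp only [Complex.ofReal_zero, mul_zero, neg_zero, Complex.exp_zero, mul_one, sub_zero, ne_eq,
      Nat.add_eq_zero_iff, one_ne_zero, and_false, not_false_eq_true, zero_pow, sub_eq_zero] at h1
    rw [Nat.factorial_succ, pow_succ (c⁻¹) (m + 1), Nat.cast_mul, Nat.cast_succ]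
    refine mul_left_cancel₀ hc0 (h1.symm.trans ?_)
    field_simp

end GammaIntegral

/-! ### The resolvents of `k` -/

section Resolvent

/-- The scalar function `t ↦ (r eᵗ - i x)⁻¹`. -/
def resolventFun (r x t : ℝ) : ℂ := ((r : ℂ) * Complex.exp t - Complex.I * x)⁻¹

theorem resolvent_re (r x t : ℝ) :
    ((r : ℂ) * Complex.exp t - Complex.I * x).re = r * Real.exp t := by
  simp [← Complex.ofReal_exp]

theorem resolvent_ne_zero {r : ℝ} (hr : 0 < r) (x t : ℝ) :
    (r : ℂ) * Complex.exp t - Complex.I * x ≠ 0 := fun h => by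
  have h1 := resolvent_re r x t
  rw [h, Complex.zero_re] at h1
  exact (mul_pos hr (Real.exp_pos t)).ne h1

theorem continuous_resolventFun {r : ℝ} (hr : 0 < r) :
    Continuous fun p : ℝ × ℝ => resolventFun r p.1 p.2 :=
  Continuous.inv₀ (by fun_prop) fun p => resolvent_ne_zero hr _ _

theorem continuous_resolventFun_right {r : ℝ} (hr : 0 < r) (x : ℝ) :
    Continuous (resolventFun r x) :=
  (continuous_resolventFun hr).comp (continuous_const.prodMk continuous_id)

theorem norm_resolventFun_le {r : ℝ} (hr : 0 < r) {ρ t : ℝ} (x : ℝ) (ht : ρ ≤ t) :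
    ‖resolventFun r x t‖ ≤ (√((r * Real.exp ρ) ^ 2 + x ^ 2))⁻¹ := by
  rw [resolventFun, norm_inv]
  have h0 : 0 < r * Real.exp ρ := by positivity
  refine inv_anti₀ (Real.sqrt_pos.2 (by positivity)) ?_
  rw [Complex.norm_eq_sqrt_sq_add_sq, resolvent_re]
  have him : ((r : ℂ) * Complex.exp t - Complex.I * x).im = -x := by
    simp [← Complex.ofReal_exp]
  rw [him, neg_sq]
  gcongr

variable {A : Type*} [CStarAlgebra A] {h : A}

theorem exists_le_spectrum (h : A) : ∃ ρ : ℝ, ∀ t ∈ spectrum ℝ h, ρ ≤ t :=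
  (spectrum.isCompact (𝕜 := ℝ) h).bddBelow

theorem fc_resolvent (hh : IsSelfAdjoint h) (r x : ℝ) :
    fc h (fun t => (r : ℂ) * Complex.exp t - Complex.I * x)
      = (r : ℂ) • NormedSpace.exp h - (Complex.I * x) • 1 := by
  have h1 : fc h (fun t : ℝ => (r : ℂ) * Complex.exp t) = (r : ℂ) • NormedSpace.exp h := by
    rw [fc_smul _ (by fun_prop), fc_exp hh]
  have h2 : fc h (fun _ => (Complex.I * x) * 1) = (Complex.I * x) • 1 := by
    rw [fc_smul _ continuous_const, fc_one hh]
  rw [← h1, ← h2]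
  simp_rw [mul_one]
  exact cfc_sub _ _ h (Continuous.continuousOn (by fun_prop)) continuousOn_const

variable {m : ℕ}

/-- The element `r k⁽ˡ⁾ - i x` as a unit. -/
def slotResolvent (hh : IsSelfAdjoint h) {r : ℝ} (hr : 0 < r) (x : ℝ) (l : Fin m) :
    (ProjTensor ℂ A m)ˣ where
  val := (r : ℂ) • slot ℂ l (NormedSpace.exp h) - (Complex.I * x) • 1
  inv := slot ℂ l (fc h (resolventFun r x))
  val_inv := by
    rw [← slotHom_apply, ← slotHom_apply, ← map_one (slotHom ℂ A l), ← map_smul, ← map_smul,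
      ← map_sub, ← map_mul, ← fc_resolvent hh,
      fc_mul (by fun_prop) (continuous_resolventFun_right hr x), ← fc_one hh]
    exact congrArg _ (congrArg _ (funext fun t => mul_inv_cancel₀ (resolvent_ne_zero hr x t)))
  inv_val := by
    rw [← slotHom_apply, ← slotHom_apply, ← map_one (slotHom ℂ A l), ← map_smul, ← map_smul,
      ← map_sub, ← map_mul, ← fc_resolvent hh,
      fc_mul (continuous_resolventFun_right hr x) (by fun_prop), ← fc_one hh]
    exact congrArg _ (congrArg _ (funext fun t => inv_mul_cancel₀ (resolvent_ne_zero hr x t)))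

theorem integrand_eq (hh : IsSelfAdjoint h) {n : ℕ} (α : Fin (n + 1) → ℕ) (d : ℝ) {r : ℝ}
    (hr : 0 < r) (x : ℝ) : integrand h α d r x
      = (Complex.exp (-(Complex.I * x)) * ((r ^ d : ℝ) : ℂ)) •
        elemTensor ℂ fun l => fc h fun t => resolventFun r x t ^ α l := by
  rw [integrand, ← prod_ofFn_slot]
  congr 3
  funext l
  rw [fc_pow hh (continuous_resolventFun_right hr x), ← slotHom_apply l (_ ^ _), map_pow]
  exact congrArg (· ^ α l) (Ring.inverse_unit (slotResolvent hh hr x l))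

theorem continuous_resolvent_tensor {r : ℝ} (hr : 0 < r) (α : Fin m → ℕ) :
    Continuous fun x : ℝ => elemTensor ℂ fun l => fc h fun t => resolventFun r x t ^ α l :=
  continuous_elemTensor.comp (continuous_pi fun l =>
    continuous_fc ((continuous_resolventFun hr).pow (α l)))

theorem continuous_integrand (hh : IsSelfAdjoint h) {n : ℕ} (α : Fin (n + 1) → ℕ) (d : ℝ) {r : ℝ}
    (hr : 0 < r) : Continuous (integrand h α d r) := by
  rw [show integrand h α d r = _ from funext fun x => integrand_eq hh α d hr x]
  have h1 : Continuous fun x : ℝ => Complex.exp (-(Complex.I * x)) * ((r ^ d : ℝ) : ℂ) := by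
    fun_prop
  exact h1.smul (continuous_resolvent_tensor hr α)

theorem norm_resolvent_tensor_le (hh : IsSelfAdjoint h) {ρ : ℝ}
    (hρ : ∀ t ∈ spectrum ℝ h, ρ ≤ t) {r : ℝ} (hr : 0 < r) (α : Fin m → ℕ) (x : ℝ) :
    ‖elemTensor ℂ fun l => fc h fun t => resolventFun r x t ^ α l‖
      ≤ (√((r * Real.exp ρ) ^ 2 + x ^ 2))⁻¹ ^ ∑ l, α l := by
  refine (norm_elemTensor_le _).trans ?_
  rw [← Finset.prod_pow_eq_pow_sum]
  refine Finset.prod_le_prod (fun _ _ => norm_nonneg _) fun l _ => ?_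
  refine norm_fc_le hh (by positivity) fun t ht => ?_
  rw [norm_pow]
  exact pow_le_pow_left₀ (norm_nonneg _) (norm_resolventFun_le hr x (hρ t ht)) _

theorem integrable_resolvent_tensor (hh : IsSelfAdjoint h) {r : ℝ} (hr : 0 < r) {α : Fin m → ℕ}
    (hα : 2 ≤ ∑ l, α l) :
    Integrable fun x : ℝ => elemTensor ℂ fun l => fc h fun t => resolventFun r x t ^ α l := by
  obtain ⟨ρ, hρ⟩ := exists_le_spectrum h
  obtain ⟨N, hN⟩ := Nat.exists_eq_add_of_le hα
  set c := r * Real.exp ρ with hc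
  have hc0 : 0 < c := by positivity
  -- Two of the factors give `(c² + x²)⁻¹ ≤ (1 + c⁻²)(1 + x²)⁻¹`; each of the other `N` is at most
  -- `c⁻¹`.
  refine (integrable_inv_one_add_sq.const_mul (c⁻¹ ^ N * (1 + c⁻¹ ^ 2))).mono'
    (continuous_resolvent_tensor hr α).aestronglyMeasurable (.of_forall fun x => ?_)
  refine (norm_resolvent_tensor_le hh hρ hr α x).trans ?_
  have h1 : c ≤ √(c ^ 2 + x ^ 2) := Real.le_sqrt_of_sq_le (by nlinarith [sq_nonneg x])
  have h2 : (√(c ^ 2 + x ^ 2))⁻¹ ^ 2 ≤ (1 + c⁻¹ ^ 2) * (1 + x ^ 2)⁻¹ := by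
    rw [inv_pow, Real.sq_sqrt (by positivity), inv_le_iff_one_le_mul₀ (by positivity),
      mul_right_comm, ← div_eq_mul_inv, le_div_iff₀ (by positivity), one_mul]
    have : c⁻¹ ^ 2 * c ^ 2 = 1 := by field_simp
    nlinarith [sq_nonneg x, sq_nonneg (c⁻¹ * x), sq_nonneg c]
  rw [hN, add_comm 2 N, pow_add, mul_assoc]
  gcongr

theorem integrable_integrand (hh : IsSelfAdjoint h) {n : ℕ} {α : Fin (n + 1) → ℕ}
    (hα : 2 ≤ ∑ l, α l) (d : ℝ) {r : ℝ} (hr : 0 < r) : Integrable (integrand h α d r) := by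
  refine ((integrable_resolvent_tensor hh hr hα).norm.const_mul (‖((r ^ d : ℝ) : ℂ)‖)).mono'
    (continuous_integrand hh α d hr).aestronglyMeasurable (.of_forall fun x => ?_)
  rw [integrand_eq hh α d hr, norm_smul, norm_mul]
  have : ‖Complex.exp (-(Complex.I * x))‖ = 1 := by simp [Complex.norm_exp]
  rw [this, one_mul]

end Resolvent

/-! ### The inner integral -/

section InnerIntegral

variable {A : Type*} [CStarAlgebra A] {h : A}

/-- The scalar function `Γ(m)⁻¹ t^(m-1) e^{-r t eˢ}`. -/
def gammaKer (r : ℝ) (m : ℕ) (t s : ℝ) : ℂ :=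
  (((Real.Gamma m)⁻¹ * t ^ (m - 1) : ℝ) : ℂ) * Complex.exp (-(r * t * Real.exp s : ℝ))

/-- The function `t ↦ Γ(m)⁻¹ t^(m-1) e^{-r t k}` on the half line, extended by zero. -/
def gammaFun (h : A) (r : ℝ) (m : ℕ) : ℝ → A :=
  (Ici 0).indicator fun t => fc h (gammaKer r m t)

theorem continuous_gammaKer (r : ℝ) (m : ℕ) :
    Continuous fun p : ℝ × ℝ => gammaKer r m p.1 p.2 := by
  unfold gammaKer
  fun_prop

theorem continuous_gammaKer_right (r : ℝ) (m : ℕ) (t : ℝ) : Continuous (gammaKer r m t) :=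
  (continuous_gammaKer r m).comp (continuous_const.prodMk continuous_id)

theorem norm_gammaKer_le {ρ r s t : ℝ} {m : ℕ} (hr : 0 < r) (hm : 0 < m) (ht : 0 ≤ t)
    (hs : ρ ≤ s) : ‖gammaKer r m t s‖
      ≤ (Real.Gamma m)⁻¹ * (t ^ (m - 1) * Real.exp (-(r * Real.exp ρ * t))) := by
  have hG : 0 < Real.Gamma m := Real.Gamma_pos_of_pos (by exact_mod_cast hm)
  rw [gammaKer, norm_mul, ← Complex.ofReal_neg, Complex.norm_exp_ofReal, Complex.norm_real,
    Real.norm_of_nonneg (by positivity), mul_assoc, mul_right_comm r]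
  gcongr

theorem stronglyMeasurable_gammaFun (r : ℝ) (m : ℕ) : StronglyMeasurable (gammaFun h r m) :=
  (continuous_fc (continuous_gammaKer r m)).stronglyMeasurable.indicator measurableSet_Ici

theorem continuousAt_gammaFun (r : ℝ) (m : ℕ) {t : ℝ} (ht : t ≠ 0) :
    ContinuousAt (gammaFun h r m) t := by
  rcases ht.lt_or_gt with ht | ht
  · refine (continuousAt_const (y := (0 : A))).congr ?_
    filter_upwards [Iio_mem_nhds ht] with s hs
    exact (indicator_of_notMem (fun hs' => not_lt.2 hs' hs) _).symm
  · refine (continuous_fc (h := h) (continuous_gammaKer r m)).continuousAt.congr ?_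
    filter_upwards [Ioi_mem_nhds ht] with s hs
    rw [gammaFun, indicator_of_mem (Ioi_subset_Ici_self hs)]

theorem norm_gammaFun_le (hh : IsSelfAdjoint h) {ρ : ℝ} (hρ : ∀ t ∈ spectrum ℝ h, ρ ≤ t)
    {r : ℝ} (hr : 0 < r) {m : ℕ} (hm : 0 < m) {t : ℝ} (ht : 0 ≤ t) :
    ‖gammaFun h r m t‖
      ≤ (Real.Gamma m)⁻¹ * (t ^ (m - 1) * Real.exp (-(r * Real.exp ρ * t))) := by
  have hG : 0 < Real.Gamma m := Real.Gamma_pos_of_pos (by exact_mod_cast hm)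
  rw [gammaFun, indicator_of_mem (by exact ht)]
  exact norm_fc_le hh (by positivity) fun s hs => norm_gammaKer_le hr hm ht (hρ s hs)

theorem integrable_gammaFun (hh : IsSelfAdjoint h) {r : ℝ} (hr : 0 < r) {m : ℕ} (hm : 0 < m) :
    Integrable (gammaFun h r m) := by
  obtain ⟨ρ, hρ⟩ := exists_le_spectrum h
  have h1 : IntegrableOn (gammaFun h r m) (Ioi 0) :=
    ((integrableOn_pow_mul_exp_neg (by positivity : 0 < r * Real.exp ρ) (m - 1)).const_mul _).mono'
      (stronglyMeasurable_gammaFun r m).aestronglyMeasurable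
      (ae_restrict_of_forall_mem measurableSet_Ioi fun t ht =>
        norm_gammaFun_le hh hρ hr hm (le_of_lt ht))
  rw [← integrableOn_Ici_iff_integrableOn_Ioi] at h1
  refine (integrableOn_iff_integrable_of_support_subset ?_).1 h1
  exact support_indicator_subset

theorem exists_norm_gammaFun_le (hh : IsSelfAdjoint h) {r : ℝ} (hr : 0 < r) {m : ℕ}
    (hm : 0 < m) : ∃ C, ∀ t, ‖gammaFun h r m t‖ ≤ C := by
  obtain ⟨ρ, hρ⟩ := exists_le_spectrum h
  have hG : 0 < Real.Gamma m := Real.Gamma_pos_of_pos (by exact_mod_cast hm)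
  have hc : 0 < r * Real.exp ρ := by positivity
  refine ⟨(Real.Gamma m)⁻¹ * ((m - 1).factorial * (2 / (r * Real.exp ρ)) ^ (m - 1) * 1),
    fun t => ?_⟩
  rcases lt_or_ge t 0 with ht | ht
  · rw [gammaFun, indicator_of_notMem (by simpa using ht), norm_zero]
    positivity
  · refine (norm_gammaFun_le hh hρ hr hm ht).trans ?_
    refine mul_le_mul_of_nonneg_left ((pow_mul_exp_neg_le hc ht _).trans ?_) (by positivity)
    gcongr
    exact Real.exp_le_one_iff.2 (by simp; positivity)

theorem fourier_gammaFun (hh : IsSelfAdjoint h) {r : ℝ} (hr : 0 < r) {m : ℕ} (hm : 0 < m)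
    (ξ : ℝ) : 𝓕 (gammaFun h r m) ξ
      = fc h fun s => resolventFun r (-(2 * Real.pi * ξ)) s ^ m := by
  obtain ⟨ρ, hρ⟩ := exists_le_spectrum h
  have hG : 0 < Real.Gamma m := Real.Gamma_pos_of_pos (by exact_mod_cast hm)
  let G : ℝ → ℝ → ℂ := fun t s => Complex.exp (↑(-2 * Real.pi * t * ξ) * Complex.I) *
    gammaKer r m t s
  have hGc : Continuous fun p : ℝ × ℝ => G p.1 p.2 :=
    Continuous.mul (by fun_prop) (continuous_gammaKer r m)
  have h1 : ∀ t : ℝ, Complex.exp (↑(-2 * Real.pi * t * ξ) * Complex.I) • gammaFun h r m t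
      = (Ici 0).indicator (fun t => fc h (G t)) t := by
    intro t
    by_cases ht : t ∈ Ici (0 : ℝ)
    · rw [gammaFun, indicator_of_mem ht, indicator_of_mem ht,
        ← fc_smul _ (continuous_gammaKer_right r m t)]
    · rw [gammaFun, indicator_of_notMem ht, indicator_of_notMem ht, smul_zero]
  rw [Real.fourier_real_eq_integral_exp_smul]
  simp_rw [h1]
  rw [integral_indicator measurableSet_Ici, integral_Ici_eq_integral_Ioi]
  have h2 := (integrableOn_fc hh measurableSet_Ioi hGc
    ((integrableOn_pow_mul_exp_neg (by positivity : 0 < r * Real.exp ρ) (m - 1)).const_mul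
      (Real.Gamma m)⁻¹) fun t ht s hs => by
        rw [norm_mul, Complex.norm_exp_ofReal_mul_I, one_mul]
        exact norm_gammaKer_le hr hm (le_of_lt ht) (hρ s hs)).2
  rw [h2]
  refine congrArg _ (funext fun s => ?_)
  -- The character merges with `e^{-r t eˢ}` into one exponential of complex rate `r eˢ - ix`, where
  -- `x = -2πξ`.
  set c : ℂ := (r : ℂ) * Complex.exp s - Complex.I * ((-(2 * Real.pi * ξ) : ℝ) : ℂ) with hc
  have hcre : 0 < c.re := by
    rw [hc, resolvent_re]
    positivity
  have h3 : ∀ t : ℝ, G t s = ((Real.Gamma m)⁻¹ : ℂ)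
      * (((t ^ (m - 1) : ℝ) : ℂ) * Complex.exp (-(c * t))) := by
    intro t
    have e : Complex.exp (-(c * t)) = Complex.exp (↑(-2 * Real.pi * t * ξ) * Complex.I)
        * Complex.exp (-(r * t * Real.exp s : ℝ)) := by
      rw [← Complex.exp_add, hc]
      congr 1
      push_cast
      ring
    simp only [G, gammaKer]
    rw [e, Complex.ofReal_mul (Real.Gamma m)⁻¹, Complex.ofReal_inv]
    ring
  simp_rw [h3]
  rw [integral_const_mul, integral_pow_mul_cexp_neg hcre]
  obtain ⟨k, rfl⟩ := Nat.exists_eq_succ_of_ne_zero hm.ne'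
  have hk : Real.Gamma ((k.succ : ℕ) : ℝ) = k.factorial := by
    rw [Nat.cast_succ, Real.Gamma_nat_eq_factorial]
  rw [hk, Nat.succ_sub_one, ← mul_assoc, Complex.ofReal_natCast, inv_mul_cancel₀
    (by exact_mod_cast k.factorial_ne_zero), one_mul]
  rfl

variable {n : ℕ}

/-- The barycentric coordinates `(1 - ∑ u_l, u₁, …, uₙ)`. -/
def bary (u : Fin n → ℝ) : Fin (n + 1) → ℝ := Fin.cons (1 - ∑ l, u l) u

/-- The tensor `e^{-r w₀ k} ⊗ ⋯ ⊗ e^{-r wₙ k}` with `w = (1 - ∑ u_l, u₁, …, uₙ)`. -/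
def expTensor (h : A) (r : ℝ) (u : Fin n → ℝ) : ProjTensor ℂ A (n + 1) :=
  elemTensor ℂ fun l => fc h fun s =>
    Complex.exp (-(r * bary u l * Real.exp s : ℝ))

theorem isCompact_simplex : IsCompact (simplex n) := by
  have h1 : IsClosed (simplex n) := by
    simp only [simplex, ofPred_and, ofPred_forall]
    exact (isClosed_iInter fun l => isClosed_le continuous_const (continuous_apply l)).inter
      (isClosed_le (by fun_prop) continuous_const)
  refine (isCompact_univ_pi fun _ => isCompact_Icc (a := (0 : ℝ)) (b := 1)).of_isClosed_subset h1
    fun u hu l _ => ⟨hu.1 l, ?_⟩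
  exact (Finset.single_le_sum (fun i _ => hu.1 i) (Finset.mem_univ l)).trans hu.2

/-- At the point `1` the arguments of the convolution are barycentric coordinates. Outside the
simplex one of them is negative and its factor vanishes; inside, the scalar prefactors multiply to
`ω_α`. -/
theorem multiConv_gammaFun (r : ℝ) (α : Fin (n + 1) → ℕ) :
    multiConv (elemTensorL ℂ A (n + 1)) (fun l => gammaFun h r (α l)) 1
      = ∫ u in simplex n, omega α u • expTensor h r u := by
  rw [multiConv, ← integral_indicator isCompact_simplex.measurableSet]
  refine integral_congr_ae (.of_forall fun u => ?_)
  have e : (Fin.cons (gammaFun h r (α 0) (1 - ∑ l, u l)) fun l => gammaFun h r (α l.succ) (u l) :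
      Fin (n + 1) → A) = fun l => gammaFun h r (α l) (bary u l) := by
    funext l
    refine Fin.cases ?_ (fun j => ?_) l <;> simp [bary]
  change elemTensorL ℂ A (n + 1) _ = _
  rw [e]
  by_cases hu : u ∈ simplex n
  · have hw : ∀ l, 0 ≤ bary u l :=
      Fin.cases (by simpa [bary] using hu.2) (by simpa [bary] using hu.1)
    rw [indicator_of_mem hu]
    have h1 : (fun l => gammaFun h r (α l) (bary u l)) = fun l =>
        (((Real.Gamma (α l))⁻¹ * bary u l ^ (α l - 1) : ℝ) : ℂ) • fc h fun s =>
          Complex.exp (-(r * bary u l * Real.exp s : ℝ)) := by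
      funext l
      rw [gammaFun, indicator_of_mem (by exact hw l), ← fc_smul _ (by fun_prop)]
      rfl
    rw [h1, ContinuousMultilinearMap.map_smul_univ, ← Complex.ofReal_prod, Complex.coe_smul]
    congr 1
    rw [Finset.prod_mul_distrib, Finset.prod_inv_distrib, omega, mul_assoc, Fin.prod_univ_succ
      fun l => bary u l ^ _]
    simp [bary]
  · rw [indicator_of_notMem hu]
    have h1 : ∃ l, bary u l < 0 := by
      by_contra! hw
      exact hu ⟨fun l => by simpa [bary] using hw l.succ, by simpa [bary] using hw 0⟩
    obtain ⟨l, hl⟩ := h1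
    refine ContinuousMultilinearMap.map_coord_zero _ l ?_
    rw [gammaFun, indicator_of_notMem (by simpa using hl)]

theorem integral_resolvent_tensor (hh : IsSelfAdjoint h) {r : ℝ} (hr : 0 < r)
    {α : Fin (n + 1) → ℕ} (hα : ∀ l, 0 < α l) (hα2 : 2 ≤ ∑ l, α l) :
    ∫ x : ℝ, Complex.exp (-(Complex.I * x)) •
        elemTensor ℂ (fun l => fc h fun t => resolventFun r x t ^ α l)
      = (2 * Real.pi) • ∫ u in simplex n, omega α u • expTensor h r u := by
  obtain ⟨C, hC⟩ := exists_norm_gammaFun_le hh hr (hα 0)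
  let R : ℝ → ProjTensor ℂ A (n + 1) := fun x => Complex.exp (-(Complex.I * x)) •
        elemTensor ℂ (fun l => fc h fun t => resolventFun r x t ^ α l)
  have hF : ∀ ξ : ℝ, elemTensorL ℂ A (n + 1) (fun l => 𝓕 (gammaFun h r (α l)) ξ)
      = elemTensor ℂ fun l => fc h fun t => resolventFun r (-(2 * Real.pi) * ξ) t ^ α l := by
    intro ξ
    rw [elemTensorL_apply]
    congr 1
    funext l
    rw [fourier_gammaFun hh hr (hα l), neg_mul]
  have h1 := integral_multilinear_fourier (elemTensorL ℂ A (n + 1))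
    (φ := fun l => gammaFun h r (α l)) (fun l => integrable_gammaFun hh hr (hα l))
    (stronglyMeasurable_gammaFun r _) hC (fun t ht => continuousAt_gammaFun r _ ht) (by
      simp_rw [hF]
      exact (integrable_resolvent_tensor hh hr hα2).comp_mul_left'
        (neg_ne_zero.2 (by positivity)))
  rw [multiConv_gammaFun] at h1
  rw [← h1]
  have h2 : ∀ ξ : ℝ, Complex.exp (↑(2 * Real.pi * ξ) * Complex.I) •
      elemTensorL ℂ A (n + 1) (fun l => 𝓕 (gammaFun h r (α l)) ξ) = R (-(2 * Real.pi) * ξ) := by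
    intro ξ
    rw [hF]
    simp only [R]
    congr 2
    push_cast
    ring
  simp_rw [h2]
  -- The substitution `x = -2πξ` produces the factor `2π`.
  rw [Measure.integral_comp_mul_left R, abs_inv, abs_neg, abs_of_pos (by positivity), smul_smul,
    mul_inv_cancel₀ (by positivity), one_smul]

end InnerIntegral

/-! ### The improper inner integral, including the case of a single resolvent -/

section ImproperIntegral

variable {A : Type*} [CStarAlgebra A] {h : A} {n : ℕ}

/-- The value of the inner integral. -/
def innerIntegral (h : A) (α : Fin (n + 1) → ℕ) (d r : ℝ) : ProjTensor ℂ A (n + 1) :=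
  (2 * Real.pi * r ^ d) • ∫ u in simplex n, omega α u • expTensor h r u

theorem integrand_eq_smul (hh : IsSelfAdjoint h) (α : Fin (n + 1) → ℕ) (d : ℝ) {r : ℝ}
    (hr : 0 < r) (x : ℝ) : integrand h α d r x = (r ^ d) • Complex.exp (-(Complex.I * x)) •
      elemTensor ℂ fun l => fc h fun t => resolventFun r x t ^ α l := by
  rw [integrand_eq hh α d hr, mul_comm, mul_smul, Complex.coe_smul]

theorem integral_integrand (hh : IsSelfAdjoint h) {α : Fin (n + 1) → ℕ} (hα : ∀ l, 0 < α l)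
    (hα2 : 2 ≤ ∑ l, α l) (d : ℝ) {r : ℝ} (hr : 0 < r) :
    ∫ x, integrand h α d r x = innerIntegral h α d r := by
  simp_rw [integrand_eq_smul hh α d hr]
  rw [integral_smul, integral_resolvent_tensor hh hr hα hα2, smul_smul, innerIntegral, mul_comm]

theorem hasImproperIntegral_of_integrable {E : Type*} [NormedAddCommGroup E] [NormedSpace ℝ E]
    {f : ℝ → E} (hf : Integrable f) : HasImproperIntegral f (∫ x, f x) :=
  ⟨hf.locallyIntegrable, intervalIntegral_tendsto_integral hf tendsto_fst tendsto_snd⟩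

theorem tendsto_resolvent_slot (hh : IsSelfAdjoint h) {r : ℝ} (hr : 0 < r) {l : Filter ℝ}
    (hl : Tendsto (fun x : ℝ => |x|) l atTop) (i : Fin n) :
    Tendsto (fun x : ℝ => Complex.exp (-(Complex.I * x)) •
      (slot ℂ i (fc h (resolventFun r x)) : ProjTensor ℂ A n)) l (𝓝 0) := by
  obtain ⟨ρ, hρ⟩ := exists_le_spectrum h
  have h1 : Tendsto (fun x : ℝ => (√((r * Real.exp ρ) ^ 2 + x ^ 2))⁻¹) l (𝓝 0) := by
    refine tendsto_inv_atTop_zero.comp (tendsto_atTop_mono (fun x => ?_) hl)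
    exact Real.abs_le_sqrt (by nlinarith [sq_nonneg (r * Real.exp ρ)])
  let L : A →L[ℂ] ProjTensor ℂ A n := (elemTensorL ℂ A n).toContinuousLinearMap 1 i
  have h3 := h1.const_mul ‖L‖
  rw [mul_zero] at h3
  refine squeeze_zero_norm (fun x => ?_) h3
  have e : ‖Complex.exp (-(Complex.I * x))‖ = 1 := by simp [Complex.norm_exp]
  rw [norm_smul, e, one_mul]
  refine (L.le_opNorm _).trans (mul_le_mul_of_nonneg_left ?_ (norm_nonneg _))
  exact norm_fc_le hh (by positivity) fun t ht => norm_resolventFun_le hr x (hρ t ht)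

/-- With `R = (rk - ix)⁻¹` in a slot, `R' = iR²`. Thus `e^{-ix} R` and `e^{-ix} R²` differ by a
derivative. -/
theorem hasDerivAt_resolvent_slot (hh : IsSelfAdjoint h) {r : ℝ} (hr : 0 < r) (i : Fin n)
    (x : ℝ) : HasDerivAt (fun x : ℝ => Complex.exp (-(Complex.I * x)) •
      (slot ℂ i (fc h (resolventFun r x)) : ProjTensor ℂ A n))
      (Complex.I • (Complex.exp (-(Complex.I * x)) • slot ℂ i (fc h (resolventFun r x)) ^ 2
        - Complex.exp (-(Complex.I * x)) • slot ℂ i (fc h (resolventFun r x)))) x := by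
  have h1 : HasDerivAt (fun x : ℝ => ((r : ℂ) • slot ℂ i (NormedSpace.exp h) - (Complex.I * x) • 1 :
      ProjTensor ℂ A n)) (-((Complex.I * 1) • 1)) x :=
    ((Complex.ofRealCLM.hasDerivAt.const_mul Complex.I).smul_const 1).const_sub _
  have h2 := (hasFDerivAt_ringInverse (𝕜 := ℝ) (slotResolvent (m := n) hh hr x i)).comp_hasDerivAt
    x h1
  have h3 : HasDerivAt (fun x : ℝ => (slot ℂ i (fc h (resolventFun r x)) : ProjTensor ℂ A n))
      (Complex.I • slot ℂ i (fc h (resolventFun r x)) ^ 2) x := by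
    convert! h2 using 1
    · funext y
      exact (Ring.inverse_unit (slotResolvent hh hr y i)).symm
    · change _ = -(slot ℂ i (fc h (resolventFun r x)) * -((Complex.I * 1) • 1)
        * slot ℂ i (fc h (resolventFun r x)))
      simp [pow_two]
  have h4 : HasDerivAt (fun x : ℝ => Complex.exp (-(Complex.I * x)))
      (Complex.exp (-(Complex.I * x)) * -(Complex.I * 1)) x :=
    (Complex.ofRealCLM.hasDerivAt.const_mul Complex.I).neg.cexp
  convert! h4.smul h3 using 1
  rw [smul_sub, sub_eq_add_neg, smul_smul, smul_smul, smul_smul, mul_comm Complex.I, mul_one,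
    mul_neg, neg_smul]

theorem hasImproperIntegral_integrand (hh : IsSelfAdjoint h) {α : Fin (n + 1) → ℕ}
    (hα : ∀ l, 0 < α l) (d : ℝ) {r : ℝ} (hr : 0 < r) :
    HasImproperIntegral (integrand h α d r) (innerIntegral h α d r) := by
  by_cases hα2 : 2 ≤ ∑ l, α l
  · rw [← integral_integrand hh hα hα2 d hr]
    exact hasImproperIntegral_of_integrable (integrable_integrand hh hα2 d hr)
  -- Each of the `n + 1` exponents is at least `1`, so total exponent below `2` leaves only one
  -- slot.
  have hn : n = 0 := by
    have : ∑ l : Fin (n + 1), 1 ≤ ∑ l, α l := Finset.sum_le_sum fun l _ => hα l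
    simp at this
    omega
  subst hn
  have hα1 : α 0 = 1 := by
    have := hα 0
    simp at hα2
    omega
  refine ⟨(continuous_integrand hh α d hr).locallyIntegrable, ?_⟩
  let R : ℝ → ProjTensor ℂ A 1 := fun x => slot ℂ 0 (fc h (resolventFun r x))
  let e : ℝ → ℂ := fun x => Complex.exp (-(Complex.I * x))
  have he : Continuous e := by fun_prop
  have hR : ∀ (x : ℝ) (k : ℕ), R x ^ k
      = elemTensor ℂ fun _ : Fin 1 => fc h fun t => resolventFun r x t ^ k := by
    intro x k
    simp only [R]
    rw [← slotHom_apply, ← map_pow, slotHom_apply, slot,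
      fc_pow hh (continuous_resolventFun_right hr x)]
    congr 1
    funext l
    rw [Subsingleton.elim l 0, Function.update_self]
  have hRc : ∀ k, Continuous fun x => R x ^ k := by
    intro k
    simp_rw [hR]
    exact continuous_resolvent_tensor hr fun _ => k
  have hint : ∀ k a b, IntervalIntegrable (fun x => e x • R x ^ k) volume a b := fun k a b =>
    (he.smul (hRc k)).intervalIntegrable a b
  have hRc1 : Continuous R := by simpa using hRc 1
  have hint1 : ∀ a b, IntervalIntegrable (fun x => e x • R x) volume a b := fun a b =>
    (he.smul hRc1).intervalIntegrable a b
  have hI : ∀ x, integrand h α d r x = r ^ d • (e x • R x) := by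
    intro x
    rw [integrand_eq_smul hh α d hr, ← pow_one (R x), hR]
    congr 3
    funext l
    rw [Fin.fin_one_eq_zero l, hα1]
  -- The boundary terms are `O(1/|x|)`, so the conditionally convergent integral becomes an
  -- absolutely convergent one.
  have hparts : ∀ a b : ℝ, ∫ x in a..b, e x • R x
      = Complex.I • (e b • R b - e a • R a) + ∫ x in a..b, e x • R x ^ 2 := by
    intro a b
    have := intervalIntegral.integral_eq_sub_of_hasDerivAt (a := a) (b := b)
      (fun x _ => hasDerivAt_resolvent_slot (n := 1) hh hr 0 x)
      (((hint 2 a b).sub (hint1 a b)).smul Complex.I)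
    rw [intervalIntegral.integral_smul, intervalIntegral.integral_sub (hint 2 a b) (hint1 a b)]
      at this
    change Complex.I • (_ - ∫ x in a..b, e x • R x) = e b • R b - e a • R a at this
    rw [← this, smul_smul, Complex.I_mul_I]
    simp [e, R]
  have h2 : Integrable fun x => e x • R x ^ 2 := by
    have h3 := integrable_integrand hh (α := fun _ : Fin 1 => 2) (by simp) 0 hr
    refine h3.congr (.of_forall fun x => ?_)
    dsimp only
    rw [integrand_eq_smul hh _ 0 hr, hR, Real.rpow_zero, one_smul]
  -- Exponents `1` and `2` have the same value here: with no simplex variables the weight is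
  -- `1/Γ(α₀)`, and `Γ(1) = Γ(2) = 1`.
  have h3 : ∫ x, e x • R x ^ 2 = (2 * Real.pi) • ∫ u in simplex 0, omega α u • expTensor h r u := by
    have h4 := integral_resolvent_tensor hh (α := fun _ : Fin 1 => 2) hr (by simp) (by simp)
    simp_rw [hR]
    rw [h4]
    congr 2
    funext u
    congr 1
    simp [omega, hα1]
  have h5 := (intervalIntegral_tendsto_integral h2 (tendsto_fst (g := (atTop : Filter ℝ)))
    (tendsto_snd (f := (atBot : Filter ℝ))))
  rw [h3] at h5
  have hb : Tendsto (fun p : ℝ × ℝ => e p.2 • R p.2) (atBot ×ˢ atTop) (𝓝 0) :=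
    (tendsto_resolvent_slot hh hr tendsto_abs_atTop_atTop 0).comp tendsto_snd
  have ha : Tendsto (fun p : ℝ × ℝ => e p.1 • R p.1) (atBot ×ˢ atTop) (𝓝 0) :=
    (tendsto_resolvent_slot hh hr tendsto_abs_atBot_atTop 0).comp tendsto_fst
  have h6 := ((((hb.sub ha).const_smul Complex.I).add h5)).const_smul (r ^ d)
  rw [sub_zero, smul_zero, zero_add, smul_smul, mul_comm] at h6
  refine h6.congr fun p => ?_
  rw [← hparts, ← intervalIntegral.integral_smul]
  simp_rw [hI]

end ImproperIntegral

/-! ### The scalar hypergeometric integral -/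

section Scalar

variable {n : ℕ}

/-- The product of the `y`'s telescopes. -/
theorem zVar_eq (x : Fin (n + 1) → ℝ) (l : Fin n) : zVar x l = 1 - Real.exp (x l.succ - x 0) := by
  have h1 : ∀ j : Fin n, yVar x j = Real.exp (x j.succ - x j.castSucc) := fun j => by
    rw [yVar, ← Real.exp_neg, ← Real.exp_add, neg_add_eq_sub]
  rw [zVar, Finset.prod_congr rfl fun j _ => h1 j, ← Real.exp_sum, Fin.sum_Iic_sub]

theorem sum_bary (u : Fin n → ℝ) : ∑ l, bary u l = 1 := by
  rw [Fin.sum_univ_succ]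
  simp [bary]

theorem bary_nonneg {u : Fin n → ℝ} (hu : u ∈ simplex n) (l : Fin (n + 1)) : 0 ≤ bary u l :=
  Fin.cases (by simpa [bary] using hu.2) (by simpa [bary] using hu.1) l

theorem le_sum_bary {u : Fin n → ℝ} (hu : u ∈ simplex n) {c : Fin (n + 1) → ℝ} {ε : ℝ}
    (hc : ∀ l, ε ≤ c l) : ε ≤ ∑ l, bary u l * c l := by
  calc ε = ∑ l, bary u l * ε := by rw [← Finset.sum_mul, sum_bary, one_mul]
    _ ≤ _ := Finset.sum_le_sum fun l _ => mul_le_mul_of_nonneg_left (hc l) (bary_nonneg hu l)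

theorem sum_bary_pos {u : Fin n → ℝ} (hu : u ∈ simplex n) {c : Fin (n + 1) → ℝ}
    (hc : ∀ l, 0 < c l) : 0 < ∑ l, bary u l * c l := by
  obtain ⟨l, hl⟩ := Finite.exists_min c
  exact (hc l).trans_le (le_sum_bary hu hl)

theorem one_sub_dotProduct (z u : Fin n → ℝ) :
    1 - z ⬝ᵥ u = ∑ l, bary u l * (Fin.cons 1 (fun l => 1 - z l) : Fin (n + 1) → ℝ) l := by
  rw [Fin.sum_univ_succ]
  simp only [bary, Fin.cons_zero, Fin.cons_succ, mul_one, dotProduct, mul_one_sub,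
    Finset.sum_sub_distrib, mul_comm (z _)]
  ring

theorem one_sub_dotProduct_pos {z u : Fin n → ℝ} (hz : ∀ l, z l < 1) (hu : u ∈ simplex n) :
    0 < 1 - z ⬝ᵥ u := by
  rw [one_sub_dotProduct]
  exact sum_bary_pos hu (Fin.cases (by simp) fun l => by simpa using hz l)

theorem zVar_lt_one (x : Fin (n + 1) → ℝ) (l : Fin n) : zVar x l < 1 := by
  rw [zVar_eq]
  linarith [Real.exp_pos (x l.succ - x 0)]

/-- The rate of the Laplace integral is `e^{x₀}` times the base of the hypergeometric kernel; this
is where `(k⁽⁰⁾)^{-(d+1)}` splits off. -/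
theorem one_sub_zVar_dotProduct (x : Fin (n + 1) → ℝ) (u : Fin n → ℝ) :
    1 - zVar x ⬝ᵥ u = Real.exp (-x 0) * ∑ l, bary u l * Real.exp (x l) := by
  rw [one_sub_dotProduct, Finset.mul_sum]
  refine Finset.sum_congr rfl fun l _ => ?_
  rw [mul_left_comm, ← Real.exp_add]
  congr 1
  refine Fin.cases ?_ (fun j => ?_) l
  · simp
  · rw [Fin.cons_succ, zVar_eq, sub_sub_cancel, neg_add_eq_sub]

instance : CompactSpace (simplex n) := isCompact_iff_compactSpace.1 isCompact_simplex

/-- Lebesgue measure on the simplex. -/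
def simplexMeasure (n : ℕ) : Measure (simplex n) := Measure.comap Subtype.val volume

instance : IsFiniteMeasure (simplexMeasure n) := by
  refine ⟨?_⟩
  rw [simplexMeasure, comap_subtype_coe_apply isCompact_simplex.measurableSet, image_univ,
    Subtype.range_coe]
  exact isCompact_simplex.measure_lt_top

theorem contDiff_omega (α : Fin (n + 1) → ℕ) : ContDiff ℝ ∞ (omega α : (Fin n → ℝ) → ℝ) := by
  unfold omega
  refine (contDiff_const.mul (ContDiff.pow ?_ _)).mul ?_
  · fun_prop
  · exact contDiff_prod fun l _ => (contDiff_apply ℝ ℝ l).pow _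

theorem omega_continuous (α : Fin (n + 1) → ℕ) : Continuous (omega α : (Fin n → ℝ) → ℝ) :=
  (contDiff_omega α).continuous

theorem integrableOn_omega_mul_rpow (α : Fin (n + 1) → ℕ) (d : ℝ) {z : Fin n → ℝ}
    (hz : ∀ l, z l < 1) :
    IntegrableOn (fun u => omega α u * (1 - z ⬝ᵥ u) ^ (-(d + 1))) (simplex n) := by
  refine ContinuousOn.integrableOn_compact isCompact_simplex ?_
  refine (omega_continuous α).continuousOn.mul (ContinuousOn.rpow_const ?_ fun u hu =>
    Or.inl (one_sub_dotProduct_pos hz hu).ne')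
  simp only [dotProduct]
  fun_prop

/-- The function `(u, x) ↦ (1 - z(x) · u)^(-(d+1))`. -/
def hyperKernel (d : ℝ) (p : (Fin n → ℝ) × (Fin (n + 1) → ℝ)) : ℂ :=
  (((1 - zVar p.2 ⬝ᵥ p.1) ^ (-(d + 1)) : ℝ) : ℂ)

/-- The set of pairs `(u, x)` with `z(x) · u < 1`. -/
def hyperDomain (n : ℕ) : Set ((Fin n → ℝ) × (Fin (n + 1) → ℝ)) :=
  {p | 0 < 1 - zVar p.2 ⬝ᵥ p.1}

theorem contDiff_one_sub_zVar :
    ContDiff ℝ ∞ fun p : (Fin n → ℝ) × (Fin (n + 1) → ℝ) => 1 - zVar p.2 ⬝ᵥ p.1 := by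
  simp only [dotProduct, zVar_eq]
  fun_prop

theorem isOpen_hyperDomain : IsOpen (hyperDomain n) :=
  isOpen_lt continuous_const contDiff_one_sub_zVar.continuous

theorem contDiffOn_hyperKernel (d : ℝ) : ContDiffOn ℝ ∞ (hyperKernel d) (hyperDomain n) :=
  Complex.ofRealCLM.contDiff.comp_contDiffOn
    (contDiff_one_sub_zVar.contDiffOn.rpow_const_of_ne fun _ hp => ne_of_gt hp)

theorem mem_hyperDomain {u : Fin n → ℝ} (hu : u ∈ simplex n) (x : Fin (n + 1) → ℝ) :
    (u, x) ∈ hyperDomain n := one_sub_dotProduct_pos (zVar_lt_one x) hu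

/-- Taking the simplex itself as parameter space makes it compact and keeps `1 - z(x)·u` positive
for every parameter. -/
theorem isDominatedFamily_hyper (α : Fin (n + 1) → ℕ) (d : ℝ) {W : Set (Fin (n + 1) → ℝ)}
    (hW : IsOpen W) : IsDominatedFamily (simplexMeasure n) W
      fun u x => (omega α u.1 : ℂ) * hyperKernel d (u.1, x) :=
  isDominatedFamily_of_compactSpace hW (p := fun u : simplex n => u.1)
    (F := fun p => (omega α p.1 : ℂ) * hyperKernel d p) isOpen_hyperDomain
    ((Complex.ofRealCLM.contDiff.comp ((contDiff_omega α).comp contDiff_fst)).contDiffOn.mul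
      (contDiffOn_hyperKernel d)) continuous_subtype_val fun u x _ => mem_hyperDomain u.2 x

theorem Htilde_eq (α : Fin (n + 1) → ℕ) (d : ℝ) (x : Fin (n + 1) → ℝ) :
    ((Htilde α d (zVar x) : ℝ) : ℂ) = (Real.Gamma (d + 1) : ℂ)
      * ∫ u : simplex n, (omega α u.1 : ℂ) * hyperKernel d (u.1, x) ∂(simplexMeasure n) := by
  rw [Htilde, Complex.ofReal_mul, ← integral_complex_ofReal, simplexMeasure,
    integral_subtype_comap isCompact_simplex.measurableSet
      fun u => (omega α u : ℂ) * hyperKernel d (u, x)]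
  simp [hyperKernel]

end Scalar

/-! ### The hypergeometric element as an integral in the tensor product -/

section SmoothCalculus

variable {A : Type*} [CStarAlgebra A] {h : A} {U : Set ℝ} {n : ℕ}

theorem hyperKernel_mem_smoothOn (U : Set ℝ) (d : ℝ) {u : Fin n → ℝ} (hu : u ∈ simplex n) :
    (fun x => hyperKernel d (u, x)) ∈ SmoothOn (n + 1) U :=
  contDiffOn_comp_prodMk (contDiffOn_hyperKernel d) fun x _ => mem_hyperDomain hu x

theorem Htilde_mem_smoothOn (hU : IsOpen U) (α : Fin (n + 1) → ℕ) (d : ℝ) :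
    (fun x => ((Htilde α d (zVar x) : ℝ) : ℂ)) ∈ SmoothOn (n + 1) U := by
  simp_rw [Htilde_eq]
  exact contDiffOn_const.mul
    ((isDominatedFamily_hyper α d (isOpen_cube hU _)).contDiffOn_integral (isOpen_cube hU _))

open Classical in
/-- The element `(1 - z·u)^(-(d+1))` of the tensor product, for `u` in the simplex. -/
def hyperTensor (Ψ : SmoothOn (n + 1) U →ₗ[ℂ] ProjTensor ℂ A (n + 1)) (d : ℝ) (u : Fin n → ℝ) :
    ProjTensor ℂ A (n + 1) :=
  if hu : u ∈ simplex n then Ψ ⟨_, hyperKernel_mem_smoothOn U d hu⟩ else 0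

theorem hyperTensor_of_mem (Ψ : SmoothOn (n + 1) U →ₗ[ℂ] ProjTensor ℂ A (n + 1)) (d : ℝ)
    {u : Fin n → ℝ} (hu : u ∈ simplex n) :
    hyperTensor Ψ d u = Ψ ⟨_, hyperKernel_mem_smoothOn U d hu⟩ := dif_pos hu

/-- Continuity of the calculus moves it inside the integral over the simplex. -/
theorem IsSmoothCalculus.apply_Htilde (hU : IsOpen U)
    {Ψ : SmoothOn (n + 1) U →ₗ[ℂ] ProjTensor ℂ A (n + 1)} (hΨ : IsSmoothCalculus h U Ψ)
    (α : Fin (n + 1) → ℕ) (d : ℝ) :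
    IntegrableOn (fun u => omega α u • hyperTensor Ψ d u) (simplex n) ∧
      Ψ ⟨_, Htilde_mem_smoothOn hU α d⟩
        = Real.Gamma (d + 1) • ∫ u in simplex n, omega α u • hyperTensor Ψ d u := by
  have hf := isDominatedFamily_hyper α d (isOpen_cube hU (n + 1))
  let G : SmoothOn (n + 1) U := ⟨_, hf.contDiffOn_integral (isOpen_cube hU _)⟩
  have hΨc : IsSmoothContinuous Ψ := hΨ.continuous
  obtain ⟨hi, he⟩ := hΨc.integral_comm hU hf G fun _ _ => rfl
  have h1 : ∀ u : simplex n, Ψ ⟨_, hf.smooth u⟩ = omega α u.1 • hyperTensor Ψ d u.1 := by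
    intro u
    rw [hyperTensor_of_mem Ψ d u.2, ← Complex.coe_smul, ← map_smul]
    rfl
  have hm := isCompact_simplex (n := n).measurableSet
  have h2 : (⟨_, Htilde_mem_smoothOn hU α d⟩ : SmoothOn (n + 1) U)
      = (Real.Gamma (d + 1) : ℂ) • G :=
    Subtype.ext (funext fun x => Htilde_eq α d x)
  simp_rw [h1] at hi he
  refine ⟨?_, ?_⟩
  · rw [IntegrableOn, ← map_comap_subtype_coe hm,
      (MeasurableEmbedding.subtype_coe hm).integrable_map_iff]
    exact hi
  · rw [h2, map_smul, he, simplexMeasure, Complex.coe_smul,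
      integral_subtype_comap hm fun u => omega α u • hyperTensor Ψ d u]

end SmoothCalculus

/-! ### The outer integral -/

section OuterIntegral

variable {n : ℕ}

/-- Lebesgue measure on the positive half line. -/
def rayMeasure : Measure (Ioi (0 : ℝ)) := Measure.comap Subtype.val volume

instance : SigmaFinite rayMeasure := by
  refine SigmaFinite.of_map _ measurable_subtype_coe.aemeasurable ?_
  rw [rayMeasure, map_comap_subtype_coe measurableSet_Ioi]
  infer_instance

theorem integrable_rayMeasure_iff {E : Type*} [NormedAddCommGroup E] {f : ℝ → E} :
    Integrable (fun r : Ioi (0 : ℝ) => f r) rayMeasure ↔ IntegrableOn f (Ioi 0) := by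
  rw [IntegrableOn, ← map_comap_subtype_coe measurableSet_Ioi,
    (MeasurableEmbedding.subtype_coe measurableSet_Ioi).integrable_map_iff]
  rfl

/-- The scalar kernel `ω_α(u) r^d e^{-r ∑ w_l e^{x_l}}` with `w = (1 - ∑ u_l, u₁, …, uₙ)`. -/
def laplaceKernel (α : Fin (n + 1) → ℕ) (d : ℝ) (p : (ℝ × (Fin n → ℝ)) × (Fin (n + 1) → ℝ)) : ℂ :=
  ((omega α p.1.2 * p.1.1 ^ d : ℝ) : ℂ)
    * Complex.exp (-(p.1.1 * ∑ l, bary p.1.2 l * Real.exp (p.2 l) : ℝ))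

theorem contDiff_bary (l : Fin (n + 1)) : ContDiff ℝ ∞ fun u : Fin n → ℝ => bary u l := by
  refine Fin.cases ?_ (fun j => ?_) l
  · simp only [bary, Fin.cons_zero]
    fun_prop
  · simp only [bary, Fin.cons_succ]
    fun_prop

theorem contDiffOn_laplaceKernel (α : Fin (n + 1) → ℕ) (d : ℝ) :
    ContDiffOn ℝ ∞ (laplaceKernel α d) {p | 0 < p.1.1} := by
  refine ContDiffOn.mul ?_ (ContDiff.contDiffOn ?_)
  · refine Complex.ofRealCLM.contDiff.comp_contDiffOn (ContDiffOn.mul ?_ ?_)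
    · exact ((contDiff_omega α).comp (contDiff_snd.comp contDiff_fst)).contDiffOn
    · exact ContDiffOn.rpow_const_of_ne (contDiff_fst.comp contDiff_fst).contDiffOn
        fun p hp => ne_of_gt hp
  · refine Complex.contDiff_exp.comp (Complex.ofRealCLM.contDiff.comp ?_).neg
    refine (contDiff_fst.comp contDiff_fst).mul (ContDiff.sum fun l _ => ?_)
    exact ((contDiff_bary l).comp (contDiff_snd.comp contDiff_fst)).mul
      (Real.contDiff_exp.comp ((contDiff_apply ℝ ℝ l).comp contDiff_snd))

theorem integrableOn_rpow_mul_exp_neg {d c : ℝ} (hd : 0 < d) (hc : 0 < c) :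
    IntegrableOn (fun r : ℝ => r ^ d * Real.exp (-(c * r))) (Ioi 0) := by
  simpa using integrableOn_rpow_mul_exp_neg_mul_rpow (s := d) (by linarith) one_pos hc

theorem integrableOn_rpow_mul_pow_mul_exp_neg {d c : ℝ} (hd : 0 < d) (hc : 0 < c) (j : ℕ) :
    IntegrableOn (fun r : ℝ => r ^ d * ((1 + r) ^ j * Real.exp (-(c * r)))) (Ioi 0) := by
  refine Integrable.mono' ((integrableOn_rpow_mul_exp_neg hd (half_pos hc)).const_mul
    (j.factorial * (2 / c) ^ j * Real.exp (c / 2))) ?_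
    (ae_restrict_of_forall_mem measurableSet_Ioi fun r hr => ?_)
  · refine ContinuousOn.aestronglyMeasurable (ContinuousOn.mul ?_ (by fun_prop)) measurableSet_Ioi
    exact ContinuousOn.rpow_const continuousOn_id fun r hr => Or.inl (ne_of_gt hr)
  · have hr' : 0 < r := hr
    have h1 := pow_mul_exp_neg_le hc (by positivity : 0 ≤ 1 + r) j
    -- Shifting to `1 + r` lets half of the exponential absorb `(1 + r)^j`; the other half remains
    -- against `r^d`.
    have e1 : Real.exp (-(c * r)) = Real.exp c * Real.exp (-(c * (1 + r))) := by
      rw [← Real.exp_add]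
      ring_nf
    have e2 : Real.exp (c / 2) * Real.exp (-(c / 2 * r))
        = Real.exp c * Real.exp (-(c / 2 * (1 + r))) := by
      rw [← Real.exp_add, ← Real.exp_add]
      ring_nf
    rw [Real.norm_of_nonneg (by positivity), e1]
    calc r ^ d * ((1 + r) ^ j * (Real.exp c * Real.exp (-(c * (1 + r)))))
        = r ^ d * Real.exp c * ((1 + r) ^ j * Real.exp (-(c * (1 + r)))) := by ring
      _ ≤ r ^ d * Real.exp c
          * (j.factorial * (2 / c) ^ j * Real.exp (-(c / 2 * (1 + r)))) := by gcongr
      _ = j.factorial * (2 / c) ^ j * r ^ d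
          * (Real.exp c * Real.exp (-(c / 2 * (1 + r)))) := by ring
      _ = _ := by rw [← e2]; ring

theorem laplaceKernel_eq_smul (α : Fin (n + 1) → ℕ) (d r : ℝ) (u : Fin n → ℝ) :
    (fun y => laplaceKernel α d ((r, u), y)) = (omega α u * r ^ d) • fun y =>
      1 * Complex.exp (∑ l, (r * bary u l) • ((-Real.exp (y l) : ℝ) : ℂ)) := by
  funext y
  simp only [laplaceKernel, Pi.smul_apply, one_mul, Complex.real_smul]
  congr 2
  push_cast
  rw [Finset.mul_sum, ← Finset.sum_neg_distrib]
  exact Finset.sum_congr rfl fun l _ => by ring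

theorem contDiff_neg_exp (l : Fin (n + 1)) :
    ContDiff ℝ ∞ fun x : Fin (n + 1) → ℝ => ((-Real.exp (x l) : ℝ) : ℂ) :=
  Complex.ofRealCLM.contDiff.comp (Real.contDiff_exp.comp (contDiff_apply ℝ ℝ l)).neg

theorem exists_norm_laplaceKernel_le (α : Fin (n + 1) → ℕ) (d : ℝ)
    {W K : Set (Fin (n + 1) → ℝ)} (hW : IsOpen W) (hK : IsCompact K) (hKW : K ⊆ W) (j : ℕ) :
    ∃ C ε : ℝ, 0 < ε ∧ ∀ r > 0, ∀ u ∈ simplex n, ∀ x ∈ K,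
      ‖iteratedFDerivWithin ℝ j (fun y => laplaceKernel α d ((r, u), y)) W x‖
        ≤ C * (r ^ d * ((1 + r) ^ j * Real.exp (-(ε * r)))) := by
  obtain ⟨M, hM0, hM⟩ := exists_norm_iteratedFDerivWithin_exp_le hW
    (fun l => (contDiff_neg_exp (n := n) l).contDiffOn) (contDiffOn_const (c := (1 : ℂ))) hK hKW j
  obtain ⟨Co, hCo⟩ := (isCompact_simplex (n := n)).exists_bound_of_continuousOn
    (omega_continuous α).continuousOn
  obtain ⟨R, hR⟩ := hK.isBounded.exists_norm_le
  have hCo' : 0 ≤ Co := (norm_nonneg _).trans (hCo 0 ⟨fun _ => le_rfl, by simp⟩)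
  -- On `K` every `x_l ≥ -R`, so the convex combination of the `e^{x_l}` is at least `e^{-R}`. The
  -- coefficients `r w_l` sum to `r`, whence the polynomial factor `(1 + r)^j`.
  refine ⟨Co * M, Real.exp (-R), Real.exp_pos _, fun r hr u hu x hx => ?_⟩
  have hE : ContDiff ℝ ∞ fun y : Fin (n + 1) → ℝ =>
      1 * Complex.exp (∑ l, (r * bary u l) • ((-Real.exp (y l) : ℝ) : ℂ)) :=
    contDiff_const.mul (Complex.contDiff_exp.comp
      (ContDiff.sum fun l _ => (contDiff_neg_exp l).const_smul _))
  have hs : ∑ l, |r * bary u l| = r := by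
    rw [Finset.sum_congr rfl fun l _ => abs_of_nonneg (mul_nonneg hr.le (bary_nonneg hu l)),
      ← Finset.mul_sum, sum_bary, mul_one]
  have hre : (∑ l, (r * bary u l) • ((-Real.exp (x l) : ℝ) : ℂ)).re
      = -(r * ∑ l, bary u l * Real.exp (x l)) := by
    rw [Complex.re_sum, Finset.mul_sum, ← Finset.sum_neg_distrib]
    refine Finset.sum_congr rfl fun l _ => ?_
    rw [Complex.real_smul, ← Complex.ofReal_mul, Complex.ofReal_re]
    ring
  have hle : Real.exp (-R) ≤ ∑ l, bary u l * Real.exp (x l) := le_sum_bary hu fun l =>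
    Real.exp_le_exp.2 (abs_le.1 ((norm_le_pi_norm x l).trans (hR x hx))).1
  have h2 := hM (fun l => r * bary u l) x hx
  rw [hs, hre] at h2
  rw [laplaceKernel_eq_smul, iteratedFDerivWithin_const_smul_apply
    ((hE.contDiffOn x (hKW hx)).of_le (WithTop.coe_le_coe.2 le_top)) hW.uniqueDiffOn (hKW hx),
    norm_smul, norm_mul, Real.norm_of_nonneg (by positivity : 0 ≤ r ^ d)]
  have h3 : Real.exp (-(r * ∑ l, bary u l * Real.exp (x l)))
      ≤ Real.exp (-(Real.exp (-R) * r)) := by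
    rw [mul_comm _ r]
    gcongr
  have h4 := h2.trans (mul_le_mul_of_nonneg_left h3 (by positivity))
  refine (mul_le_mul (mul_le_mul_of_nonneg_right (hCo u hu) (by positivity)) h4
    (norm_nonneg _) (by positivity)).trans_eq ?_
  ring

theorem isDominatedFamily_laplace (α : Fin (n + 1) → ℕ) {d : ℝ} (hd : 0 < d)
    {W : Set (Fin (n + 1) → ℝ)} (hW : IsOpen W) :
    IsDominatedFamily (rayMeasure.prod (simplexMeasure n)) W
      fun w x => laplaceKernel α d ((w.1.1, w.2.1), x) := by
  have hO : IsOpen {p : (ℝ × (Fin n → ℝ)) × (Fin (n + 1) → ℝ) | 0 < p.1.1} :=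
    isOpen_lt continuous_const (by fun_prop)
  have hp : Continuous fun w : Ioi (0 : ℝ) × simplex n => (w.1.1, w.2.1) := by fun_prop
  have hs := contDiffOn_laplaceKernel α d
  have hO' : ∀ (w : Ioi (0 : ℝ) × simplex n), ∀ x ∈ W, ((w.1.1, w.2.1), x) ∈
      {p : (ℝ × (Fin n → ℝ)) × (Fin (n + 1) → ℝ) | 0 < p.1.1} := fun w x _ => w.1.2
  constructor
  case smooth => exact fun w => contDiffOn_comp_prodMk hs (hO' w)
  case continuousOn =>
    intro j
    exact continuousOn_iteratedFDerivWithin_of_joint hW hO hs hp hO' j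
  case dominated =>
    intro j K hK hKW
    obtain ⟨C, ε, hε, hC⟩ := exists_norm_laplaceKernel_le α d hW hK hKW j
    let b : ℝ → ℝ := fun r => C * (r ^ d * ((1 + r) ^ j * Real.exp (-(ε * r))))
    have hb : Integrable (fun r : Ioi (0 : ℝ) => b r) rayMeasure :=
      integrable_rayMeasure_iff.2 ((integrableOn_rpow_mul_pow_mul_exp_neg hd hε j).const_mul C)
    refine ⟨fun w => b w.1 * 1,
      hb.mul_prod (integrable_const (μ := simplexMeasure n) (1 : ℝ)), fun w x hx => ?_⟩
    exact (hC w.1 w.1.2 w.2 w.2.2 x hx).trans_eq (mul_one _).symm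

theorem IsDominatedFamily.integrable_apply {Ω E : Type*} [TopologicalSpace Ω] [MeasurableSpace Ω]
    [OpensMeasurableSpace Ω] [SecondCountableTopology Ω] {μ : Measure Ω} [NormedAddCommGroup E]
    [NormedSpace ℝ E] {W : Set E} {f : Ω → E → ℂ} (hf : IsDominatedFamily μ W f) {x : E}
    (hx : x ∈ W) : Integrable (fun w => f w x) μ :=
  (ContinuousMultilinearMap.apply ℝ (fun _ : Fin 0 => E) ℂ 0).integrable_comp
    (hf.integrable_iteratedFDerivWithin 0 hx)

end OuterIntegral

/-! ### The outer integral computed in both orders -/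

section Assembly

variable {A : Type*} [CStarAlgebra A] {h : A} {U : Set ℝ} {n : ℕ}

/-- Integrating over `r` first leaves the Gamma integral `Γ(d+1) c^{-(d+1)}`, and `c = e^{x₀} (1 -
z·u)`. -/
theorem integral_laplaceKernel (α : Fin (n + 1) → ℕ) {d : ℝ} (hd : 0 < d)
    (x : Fin (n + 1) → ℝ) :
    ∫ w : Ioi (0 : ℝ) × simplex n, laplaceKernel α d ((w.1.1, w.2.1), x)
        ∂(rayMeasure.prod (simplexMeasure n))
      = ((Real.exp (x 0) ^ (-(d + 1)) : ℝ) : ℂ) * ((Htilde α d (zVar x) : ℝ) : ℂ) := by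
  rw [integral_prod_symm _ ((isDominatedFamily_laplace α hd isOpen_univ).integrable_apply
    (mem_univ x)), Htilde_eq, ← mul_assoc, ← integral_const_mul]
  refine integral_congr_ae (.of_forall fun u => ?_)
  set c := ∑ l, bary u.1 l * Real.exp (x l) with hc
  have hc0 : 0 < c := sum_bary_pos u.2 fun l => Real.exp_pos _
  have h1 : ∫ r : Ioi (0 : ℝ), laplaceKernel α d ((r.1, u.1), x) ∂rayMeasure
      = ((∫ r in Ioi (0 : ℝ), omega α u.1 * (r ^ d * Real.exp (-(c * r))) : ℝ) : ℂ) := by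
    rw [rayMeasure, integral_subtype_comap measurableSet_Ioi
      fun r => laplaceKernel α d ((r, u.1), x), ← integral_complex_ofReal]
    refine integral_congr_ae (.of_forall fun r => ?_)
    simp only [laplaceKernel, ← hc]
    push_cast
    ring_nf
  have h2 := Real.integral_rpow_mul_exp_neg_mul_Ioi (a := d + 1) (by linarith) hc0
  rw [add_sub_cancel_right] at h2
  dsimp only
  rw [h1, integral_const_mul, h2, hyperKernel, one_sub_zVar_dotProduct, ← hc]
  have h3 : (1 / c) ^ (d + 1) = Real.exp (x 0) ^ (-(d + 1))
      * (Real.exp (-x 0) * c) ^ (-(d + 1)) := by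
    rw [← Real.mul_rpow (Real.exp_pos _).le (by positivity), ← mul_assoc, ← Real.exp_add,
      add_neg_cancel, Real.exp_zero, one_mul, one_div, Real.inv_rpow hc0.le, Real.rpow_neg hc0.le]
  rw [h3]
  push_cast
  ring

theorem contDiff_expTensorFun (s : ℝ) :
    ContDiff ℝ ∞ fun t : ℝ => Complex.exp (-(s * Real.exp t : ℝ)) :=
  Complex.contDiff_exp.comp
    (Complex.ofRealCLM.contDiff.comp (contDiff_const.mul Real.contDiff_exp)).neg

theorem IsSmoothCalculus.apply_laplaceKernel
    {Ψ : SmoothOn (n + 1) U →ₗ[ℂ] ProjTensor ℂ A (n + 1)} (hΨ : IsSmoothCalculus h U Ψ)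
    (α : Fin (n + 1) → ℕ) (d r : ℝ) (u : Fin n → ℝ)
    (hF : (fun x => laplaceKernel α d ((r, u), x)) ∈ SmoothOn (n + 1) U) :
    Ψ ⟨_, hF⟩ = r ^ d • omega α u • expTensor h r u := by
  let E : (Fin (n + 1) → ℝ) → ℂ := fun x =>
    ∏ l, Complex.exp (-(r * bary u l * Real.exp (x l) : ℝ))
  have hE : E ∈ SmoothOn (n + 1) U := ContDiff.contDiffOn (contDiff_prod fun l _ =>
    (contDiff_expTensorFun (r * bary u l)).comp (contDiff_apply ℝ ℝ l))
  -- For fixed `r` and `u` the exponential of the sum is an elementary tensor, on which the calculus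
  -- is prescribed.
  have h1 : (⟨_, hF⟩ : SmoothOn (n + 1) U) = ((omega α u * r ^ d : ℝ) : ℂ) • ⟨E, hE⟩ := by
    refine Subtype.ext (funext fun x => ?_)
    change laplaceKernel α d ((r, u), x) = ((omega α u * r ^ d : ℝ) : ℂ) * E x
    simp only [laplaceKernel, E]
    rw [← Complex.exp_sum, Finset.sum_neg_distrib, ← Complex.ofReal_sum, Finset.mul_sum]
    simp only [mul_assoc]
  rw [h1, map_smul, Complex.coe_smul, smul_smul, mul_comm,
    hΨ.apply_eq (fun l => (contDiff_expTensorFun (r * bary u l)).contDiffOn) _ fun x _ => rfl]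
  rfl

/-- The calculus commutes with the double integral of the Laplace kernel. On the tensor side the
integral over `u` is done first and gives the inner integral; on the scalar side `r` comes first and
gives `H̃_α`. -/
theorem IsSmoothCalculus.integral_innerIntegral (hh : IsSelfAdjoint h) (hU : IsOpen U)
    {Ψ : SmoothOn (n + 1) U →ₗ[ℂ] ProjTensor ℂ A (n + 1)} (hΨ : IsSmoothCalculus h U Ψ)
    (α : Fin (n + 1) → ℕ) {d : ℝ} (hd : 0 < d) :
    IntegrableOn (innerIntegral h α d) (Ioi 0) ∧
      (2 * Real.pi)⁻¹ • ∫ r in Ioi 0, innerIntegral h α d r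
        = slot ℂ 0 (cfc (fun t : ℝ => t ^ (-(d + 1))) (NormedSpace.exp h))
          * Ψ ⟨_, Htilde_mem_smoothOn hU α d⟩ := by
  have hf := isDominatedFamily_laplace α hd (isOpen_cube hU (n + 1))
  have hΨc : IsSmoothContinuous Ψ := hΨ.continuous
  let G : SmoothOn (n + 1) U := ⟨_, hf.contDiffOn_integral (isOpen_cube hU _)⟩
  obtain ⟨hi, he⟩ := hΨc.integral_comm hU hf G fun _ _ => rfl
  have hE : ∀ w : Ioi (0 : ℝ) × simplex n, Ψ ⟨_, hf.smooth w⟩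
      = w.1.1 ^ d • omega α w.2.1 • expTensor h w.1.1 w.2.1 := fun w =>
    hΨ.apply_laplaceKernel α d w.1.1 w.2.1 (hf.smooth w)
  simp_rw [hE] at hi he
  let K : ℝ → ProjTensor ℂ A (n + 1) := fun r =>
    r ^ d • ∫ u in simplex n, omega α u • expTensor h r u
  have hK : ∀ r : Ioi (0 : ℝ), ∫ u : simplex n,
      r.1 ^ d • omega α u.1 • expTensor h r.1 u.1 ∂(simplexMeasure n) = K r.1 := by
    intro r
    rw [integral_smul, simplexMeasure, integral_subtype_comap isCompact_simplex.measurableSet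
      fun u => omega α u • expTensor h r.1 u]
  have hJ : innerIntegral h α d = fun r => (2 * Real.pi) • K r := by
    funext r
    rw [innerIntegral, mul_smul]
  have hiK := hi.integral_prod_left
  simp_rw [hK] at hiK
  rw [integral_prod _ hi] at he
  simp_rw [hK] at he
  rw [rayMeasure, integral_subtype_comap measurableSet_Ioi K] at he
  refine ⟨?_, ?_⟩
  · rw [hJ]
    exact (integrable_rayMeasure_iff.1 hiK).smul (2 * Real.pi)
  · rw [hJ, integral_smul, smul_smul, inv_mul_cancel₀ (by positivity), one_smul, ← he,
      cfc_exp_eq_fc (g := fun t : ℝ => t ^ (-(d + 1))) hh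
        (ContinuousOn.rpow_const continuousOn_id fun t ht => Or.inl (ne_of_gt ht))]
    refine (hΨ.slot_mul hU ?_ _ _ fun x _ => ?_).symm
    · exact Complex.ofRealCLM.contDiff.comp
        (Real.contDiff_exp.rpow_const_of_ne fun t => (Real.exp_pos t).ne')
    · exact integral_laplaceKernel α hd x

end Assembly

end

end Rearrangement

/-! ### The rearrangement lemma -/

open Rearrangement in
theorem theorem2p1 {A : Type*} [CStarAlgebra A] (h : A) (hh : IsSelfAdjoint h)
    (U : Set ℝ) (hU : IsOpen U) (hspec : spectrum ℝ h ⊆ U) (n : ℕ) :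
    (∃! Ψ : SmoothOn (n + 1) U →ₗ[ℂ] ProjTensor ℂ A (n + 1), IsSmoothCalculus h U Ψ) ∧
    ∀ Ψ : SmoothOn (n + 1) U →ₗ[ℂ] ProjTensor ℂ A (n + 1), IsSmoothCalculus h U Ψ →
    ∀ α : Fin (n + 1) → ℕ, (∀ l, 0 < α l) → ∀ d : ℝ, 0 < d →
      (∀ z : Fin n → ℝ, (∀ l, z l < 1) →
        IntegrableOn (fun u => omega α u * (1 - z ⬝ᵥ u) ^ (-(d + 1))) (simplex n)) ∧
      (∀ r : ℝ, 0 < r → ∀ (x : ℝ) (l : Fin (n + 1)),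
        IsUnit ((r : ℂ) • (slot ℂ l (NormedSpace.exp h) : ProjTensor ℂ A (n + 1))
          - (Complex.I * x) • 1)) ∧
      ∃ (hH : (fun x => ((Htilde α d (zVar x) : ℝ) : ℂ)) ∈ SmoothOn (n + 1) U)
        (J : ℝ → ProjTensor ℂ A (n + 1)) (S : (Fin n → ℝ) → ProjTensor ℂ A (n + 1)),
        (∀ r : ℝ, 0 < r → HasImproperIntegral (integrand h α d r) (J r)) ∧
        (2 ≤ ∑ l, α l → ∀ r : ℝ, 0 < r →
          Integrable (integrand h α d r) ∧ J r = ∫ x, integrand h α d r x) ∧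
        IntegrableOn J (Ioi 0) ∧
        (∀ u ∈ simplex n,
          ∃ hu : (fun x => (((1 - zVar x ⬝ᵥ u) ^ (-(d + 1)) : ℝ) : ℂ)) ∈ SmoothOn (n + 1) U,
            S u = Ψ ⟨_, hu⟩) ∧
        IntegrableOn (fun u => omega α u • S u) (simplex n) ∧
        Ψ ⟨_, hH⟩ = Real.Gamma (d + 1) • ∫ u in simplex n, omega α u • S u ∧
        (2 * Real.pi)⁻¹ • ∫ r in Ioi 0, J r
          = slot ℂ 0 (cfc (fun t : ℝ => t ^ (-(d + 1))) (NormedSpace.exp h)) * Ψ ⟨_, hH⟩ ∧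
        contraction ℂ A n ((2 * Real.pi)⁻¹ • ∫ r in Ioi 0, J r)
          = (ContinuousLinearMap.mul ℂ A
              (cfc (fun t : ℝ => t ^ (-(d + 1))) (NormedSpace.exp h))).comp
            (contraction ℂ A n (Ψ ⟨_, hH⟩)) := by
  refine ⟨?_, fun Ψ hΨ α hα d hd => ⟨fun z hz => integrableOn_omega_mul_rpow α d hz,
    fun r hr x l => (slotResolvent hh hr x l).isUnit, Htilde_mem_smoothOn hU α d,
    innerIntegral h α d, hyperTensor Ψ d, fun r hr => hasImproperIntegral_integrand hh hα d hr,
    fun hα2 r hr => ⟨integrable_integrand hh hα2 d hr, (integral_integrand hh hα hα2 d hr).symm⟩,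
    (hΨ.integral_innerIntegral hh hU α hd).1,
    fun u hu => ⟨hyperKernel_mem_smoothOn U d hu, hyperTensor_of_mem Ψ d hu⟩,
    (hΨ.apply_Htilde hU α d).1, (hΨ.apply_Htilde hU α d).2,
    (hΨ.integral_innerIntegral hh hU α hd).2, ?_⟩⟩
  · obtain ⟨Ψ, hΨ⟩ := exists_isSmoothCalculus hh hU hspec (n + 1)
    exact ⟨Ψ, hΨ, fun Ψ' hΨ' => hΨ'.unique hU hΨ⟩
  · rw [(hΨ.integral_innerIntegral hh hU α hd).2, contraction_slot_mul]
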